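/- Notation. $\langle x\rangle=(1+x^2)^{1/2}$. For $t>0$ let $A(x,y,t)=\iint_{\mathbb R^2}e^{i(t\xi^3+t\xi\eta^2+x\xi+y\eta)}\,d\xi\,d\eta$ (an oscillatory integral: the limit as $\varepsilon\to0^+$ of the integrals with the additional factor $e^{-\varepsilon(\xi^2+\eta^2)}$), and let $$[S(t)\phi](x,y)=(2\pi)^{-2}\iint A(x',y',t)\,\phi(x+t-x',y-y')\,dx'\,dy',$$ the linear flow of $\partial_t\rho-\partial_x(-\Delta+1)\rho=0$. For $\sigma\in\mathbb R$ let $\tilde\sigma=\min(\sigma-\frac94,\frac23\sigma-\frac5{12})$; thus $\tilde\sigma_1,\tilde\sigma_2$ are obtained from $\sigma_1,\sigma_2$. Hypotheses. Let $F(x,y,t)$ be a measurable complex-valued function of $(x,y)\in\mathbb R^2$, $t>0$, and let $\nu,\sigma_1,\sigma_2\in\mathbb R$, $C_2\ge0$, $s_0>0$. We say that $F$ satisfies $H(s_0)$ if, for almost every $t>0$, * for almost every $(x,y)$ with $x>0$: $|F(x,y,t)|\le C_2\,t^{-\nu}\langle x\rangle^{-\sigma_1}$ if $t<1$, and $|F(x,y,t)|\le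 C_2\langle x\rangle^{-\sigma_2}$ if $t>s_0$; * $\|\langle x\rangle^{-1}F(\cdot,\cdot,t)\|_{L^2(x<0,\,y\in\mathbb R)}\le C_2$; * the weak derivative $\partial_xF(\cdot,\cdot,t)$ on $\mathbb R^2$ exists as a locally integrable function, with $\|\langle x\rangle^{-1}\partial_xF(\cdot,\cdot,t)\|_{L^1(x<0,\,y\in\mathbb R)}\le C_2$ and $\|\partial_xF(\cdot,\cdot,t)\|_{L^1(x>0,\,y\in\mathbb R)}\le C_2$. Put $$G(x,y,t)=\int_0^t[\partial_xS(t-t')F(\cdot,\cdot,t')](x,y)\,dt'.$$ (1) Duhamel estimate. Let $\nu>1$, $\frac94<\sigma_2\le\sigma_1$ and $K>0$. There is a constant $C$ depending only on $\nu,\sigma_1,\sigma_2,K$ such that, whenever $F$ satisfies $H(\frac12)$, then for all $t>0$, $x>0$, $y\in\mathbb R$ the term $G(x,y,t)$ is well defined (for almost every $t'\in(0,t)$ the integral defining $S(t-t')F(\cdot,\cdot,t')$ at $(x,y)$ converges absolutely and $S(t-t')F(\cdot,\cdot,t')$ is differentiable in $x$ there, and the integral over $t'$ converges absolutely), and $$|G(x,y,t)|\le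 C\,C_2\begin{cases} t^{1/3}&\text{if }t^{\nu+\frac5{12}}\le K\langle x\rangle^{-(\sigma_1-\frac94)},\\ t^{-\frac45\nu}\langle x\rangle^{-\frac45(\sigma_1-\frac94)}&\text{if }\langle x\rangle^{-(\sigma_1-\frac94)}\le K\,t^{\nu+\frac5{12}},\ t^{\nu+\frac5{12}}<1\text{ and }\nu<\frac54,\\ t^{-\frac23-\frac5{12\nu}}\langle x\rangle^{-\frac1\nu(\sigma_1-\frac94)}&\text{if }\langle x\rangle^{-(\sigma_1-\frac94)}\le K\,t^{\nu+\frac5{12}},\ t^{\nu+\frac5{12}}<1\text{ and }\nu>\frac54,\\ \langle x\rangle^{-\min(\tilde\sigma_1/\nu,\ \tilde\sigma_2,\ \frac45(\sigma_2-\frac94))}&\text{if }t>1 \end{cases}$$ (each bound holds wherever its condition does). (2) Corollary. Let $\nu>\frac54$, $r\ge0$, $\sigma_2\le\sigma_1$, $\sigma_1\ge\frac{11}2$, $\sigma_2\ge\frac{11}2$, $$\sigma_2\ge\max\left(\tfrac{27}7+\tfrac{15}7r,\ \tfrac54+3r\right),\qquad \sigma_1\ge\tfrac{27}7(\nu+1),\qquad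 \sigma_1\ge\tfrac\nu2\sigma_2+\tfrac58+\tfrac32\nu r.$$ There is a constant $C$ depending only on $\nu,\sigma_1,\sigma_2,r$ such that, whenever $F$ satisfies $H(1)$, then for all $t\ge0$, $x>0$, $y\in\mathbb R$ the term $G(x,y,t)$ is well defined in the same sense, and $$|G(x,y,t)|\le C\,C_2\begin{cases} t^{-\nu/3}\langle x\rangle^{-\sigma_1/3}&\text{if }0\le t\le1,\text{ provided also }(1-\frac\nu3)\sigma_1-\frac94>0,\\ \langle x\rangle^{-\frac13\sigma_2-r}&\text{if }t>\frac12 \end{cases}$$ (the first bound has no content at $t=0$, where $G=0$). -/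

import Mathlib

open MeasureTheory Filter Topology Set

noncomputable section

namespace ZK

/-- The bracket `⟨x⟩ = (1 + x²)^{1/2}`. -/
def bracket (x : ℝ) : ℝ := Real.sqrt (1 + x ^ 2)

/-- The fundamental solution
`A(x,y,t) = ∬ exp (i (t ξ³ + t ξ η² + x ξ + y η)) dξ dη`.
The double integral is not absolutely convergent; as usual for oscillatory integrals it is the
limit, as `ε → 0+`, of the absolutely convergent integrals with the factor
`exp (-ε (ξ² + η²))`. For `t > 0` this limit exists at every `(x, y)`. -/
def kernelA (x y t : ℝ) : ℂ :=
  limUnder (𝓝[>] (0 : ℝ)) fun ε : ℝ =>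
    ∫ q : ℝ × ℝ,
      Complex.exp (Complex.I *
          ((t * q.1 ^ 3 + t * q.1 * q.2 ^ 2 + x * q.1 + y * q.2 : ℝ) : ℂ)) *
        ((Real.exp (-ε * (q.1 ^ 2 + q.2 ^ 2)) : ℝ) : ℂ)

/-- The integrand of `S(t)φ` at `(x, y)`. -/
def propagatorIntegrand (t : ℝ) (φ : ℝ × ℝ → ℂ) (x y : ℝ) (p : ℝ × ℝ) : ℂ :=
  kernelA p.1 p.2 t * φ (x + t - p.1, y - p.2)

/-- The linear flow `S(t)` of `∂_t ρ - ∂_x (-Δ + 1) ρ = 0`,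
`[S(t)φ](x,y) = ∬ A(x',y',t) φ(x+t-x', y-y') dx' dy'`, with the constant `(2π)⁻²` of
Fourier inversion that makes `S(0)` the identity. -/
def propagator (t : ℝ) (φ : ℝ × ℝ → ℂ) (x y : ℝ) : ℂ :=
  (((2 * Real.pi) ^ 2)⁻¹ : ℝ) • ∫ p : ℝ × ℝ, propagatorIntegrand t φ x y p

/-- `[∂_x S(t) φ](x, y)`. -/
def dxPropagator (t : ℝ) (φ : ℝ × ℝ → ℂ) (x y : ℝ) : ℂ :=
  deriv (fun z : ℝ => propagator t φ z y) x

/-- The Duhamel term `∫_0^t [∂_x S(t-t') F(•,•,t')](x,y) dt'`, where `F s` is the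
function `F(•,•,s)` on the plane. -/
def duhamel (F : ℝ → ℝ × ℝ → ℂ) (t x y : ℝ) : ℂ :=
  ∫ s in (0 : ℝ)..t, dxPropagator (t - s) (F s) x y

/-- Every operation in the Duhamel term at `(t, x, y)` is meaningful: for almost every
`s ∈ (0,t)` the integral defining `S(t-s) F(s)` converges absolutely and `S(t-s) F(s)` is
differentiable in `x`, and the integral over `s` converges absolutely. -/
def DuhamelWellDefined (F : ℝ → ℝ × ℝ → ℂ) (t x y : ℝ) : Prop :=
  (∀ᵐ s : ℝ, s ∈ Ioo 0 t →
      Integrable (propagatorIntegrand (t - s) (F s) x y) ∧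
      DifferentiableAt ℝ (fun z : ℝ => propagator (t - s) (F s) z y) x) ∧
    IntervalIntegrable (fun s : ℝ => dxPropagator (t - s) (F s) x y) volume 0 t

/-- `g` is the weak derivative `∂_x f` on the whole plane. -/
def HasWeakDerivX (f g : ℝ × ℝ → ℂ) : Prop :=
  LocallyIntegrable f ∧ LocallyIntegrable g ∧
    ∀ ψ : ℝ × ℝ → ℝ, ContDiff ℝ (⊤ : ℕ∞) ψ → HasCompactSupport ψ →
      ∫ p, (fderiv ℝ ψ p (1, 0)) • f p = -∫ p, ψ p • g p

/-- The hypotheses on the forcing `F` (at the times `t > 0`): rightward pointwise decay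
`t^{-ν} ⟨x⟩^{-σ₁}` for `t < 1` and `⟨x⟩^{-σ₂}` for `t > s₀`, the weighted `L²` bound of `F` on
the left, the weighted `L¹` bound of `∂_x F` on the left, and the `L¹` bound of `∂_x F` on the
right, all with the constant `C₂`. -/
structure ForcingBounds (s₀ ν σ₁ σ₂ C₂ : ℝ) (F : ℝ → ℝ × ℝ → ℂ) : Prop where
  aestronglyMeasurable : AEStronglyMeasurable (fun q : ℝ × (ℝ × ℝ) => F q.1 q.2)
    ((volume.restrict (Ioi (0 : ℝ))).prod (volume : Measure (ℝ × ℝ)))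
  decay_early : ∀ᵐ t : ℝ, 0 < t → t < 1 →
    ∀ᵐ p : ℝ × ℝ, 0 < p.1 → ‖F t p‖ ≤ C₂ * (t ^ (-ν) * bracket p.1 ^ (-σ₁))
  decay_late : ∀ᵐ t : ℝ, s₀ < t →
    ∀ᵐ p : ℝ × ℝ, 0 < p.1 → ‖F t p‖ ≤ C₂ * bracket p.1 ^ (-σ₂)
  left_L2 : ∀ᵐ t : ℝ, 0 < t →
    eLpNorm (fun p : ℝ × ℝ => (bracket p.1)⁻¹ • F t p) 2
      (volume.restrict {p : ℝ × ℝ | p.1 < 0}) ≤ ENNReal.ofReal C₂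
  deriv_L1 : ∀ᵐ t : ℝ, 0 < t → ∃ G : ℝ × ℝ → ℂ, HasWeakDerivX (F t) G ∧
    eLpNorm (fun p : ℝ × ℝ => (bracket p.1)⁻¹ • G p) 1
      (volume.restrict {p : ℝ × ℝ | p.1 < 0}) ≤ ENNReal.ofReal C₂ ∧
    eLpNorm G 1 (volume.restrict {p : ℝ × ℝ | 0 < p.1}) ≤ ENNReal.ofReal C₂

/-- `σ̃ = min (σ - 9/4, (2/3) σ - 5/12)`. -/
def sigmaTilde (σ : ℝ) : ℝ := min (σ - 9 / 4) (2 / 3 * σ - 5 / 12)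

end ZK

end

/-! The kernel is explicit. Under ξ = c(u + v), η = √3 c(u − v) the symbol ξ³ + ξη² becomes 4c³(u³ +
v³), so with μ = t^(1/3) the fundamental solution is a multiple of μ⁻² times a product of two
Airy-type functions at (x ± √3 y)/μ (`kernelA_eq`). Such a function decays exponentially on the
right and is bounded on the left, and its derivative grows at most like |w|^(1/4). When X ≥ −|Y|,
one of X ± √3 Y is positive and comparable to |X| + |Y|. Hence the kernel and its x-derivative
decrease rapidly outside the left cone |Y| ≤ −X and are O(⟨X⟩^(1/4)) inside it (`IsAiryKernel`).

Let τ = t − s = μ³ be the elapsed time. One time slice of the forcing satisfies two bounds.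
Dispersive (`exists_norm_dxPropagator_le_dispersive`): put the derivative on F and use |A| ≲
τ^(−2/3); this gives τ^(−2/3). Decay (`exists_norm_dxPropagator_le_decay`): if the slice is
O(⟨x⟩^(−σ)) on the right, the result is τ^(−13/12) ⟨x⟩^(−(σ − 9/4)). Here 13/12 is a third of 3 +
1/4, from scaling and kernel growth, and 9/4 = 1/4 + 1 + 1, from kernel growth, the width of the
cone in y and the integration in x. The sources to the left are harmless because the flow is
observed in a moving frame. The kernel sees ℓ − x' with ℓ = x + τ ≥ μ³, and a distance L ≥ μ³
satisfies 1 + L ≤ (1 + L/μ)². Rapid decay at the scale μ is therefore rapid decay in the true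
distance, uniformly in τ, and it absorbs the weight ⟨x⟩⁻¹.

Write Xᵢ = ⟨x⟩^(−(σᵢ − 9/4)). The Duhamel integrand is at most a constant times τ^(−2/3), and also
at most a constant times s^(−ν) X₁ τ^(−13/12) for s < 1 or X₂ τ^(−13/12) for s > 1. The time
integral is cut at t/2, or at 1/2 when t > 1. Near s = 0 the competition between 1 and s^(−ν)
produces the power 1/ν; near s = t the competition between τ^(−2/3) and τ^(−13/12) produces the
power 4/5 (`integral_le_of_rpow_bounds`, `exists_norm_duhamel_le`). The two resulting rates and the
trivial rate t^(1/3) coincide where t^(ν + 5/12) = X₁; beyond that point the sign of ν − 5/4 decides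
which of the two dominates. The corollary follows by comparing exponents at the endpoints of the
range of t. -/

namespace ZK

/-! ### An Airy-type function -/

/-- The integrand `exp (i (4 u³ + w u))` on the line `u = v + i`. -/
noncomputable def airyExp (w v : ℝ) : ℂ :=
  Complex.exp (Complex.I * (4 * (v + Complex.I) ^ 3 + w * (v + Complex.I)))

/-- The integrand of the `n`-th derivative of the Airy-type function. -/
noncomputable def airyIntegrand (n : ℕ) (w v : ℝ) : ℂ :=
  (Complex.I * (v + Complex.I)) ^ n * airyExp w v

lemma norm_airyExp (w v : ℝ) : ‖airyExp w v‖ = Real.exp (4 - w - 12 * v ^ 2) := by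
  have h : Complex.I * (4 * ((v : ℂ) + Complex.I) ^ 3 + w * (v + Complex.I))
      = ((4 - w - 12 * v ^ 2 : ℝ) : ℂ) + ((4 * v ^ 3 - 12 * v + w * v : ℝ) : ℂ) * Complex.I := by
    push_cast
    have := Complex.I_sq
    linear_combination
      (12 * (v : ℂ) ^ 2 + w + 4 * Complex.I ^ 2 - 4 + 12 * v * Complex.I) * this
  rw [airyExp, Complex.norm_exp, h, Complex.add_re, Complex.ofReal_re, Complex.re_ofReal_mul,
    Complex.I_re, mul_zero, add_zero]

lemma norm_airyIntegrand_le (n : ℕ) (w v : ℝ) :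
    ‖airyIntegrand n w v‖ ≤ Real.exp ((n : ℝ) ^ 2 + 4 - w) * Real.exp (-1 * v ^ 2) := by
  have h1 : ‖Complex.I * ((v : ℂ) + Complex.I)‖ ≤ Real.exp |v| := by
    rw [norm_mul, Complex.norm_I, one_mul]
    calc ‖(v : ℂ) + Complex.I‖ ≤ ‖(v : ℂ)‖ + ‖Complex.I‖ := norm_add_le _ _
      _ = |v| + 1 := by simp
      _ ≤ Real.exp |v| := Real.add_one_le_exp _
  rw [airyIntegrand, norm_mul, norm_pow, norm_airyExp]
  calc _ ≤ Real.exp |v| ^ n * Real.exp (4 - w - 12 * v ^ 2) := by gcongr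
    _ = Real.exp (n * |v| + (4 - w - 12 * v ^ 2)) := by rw [← Real.exp_nat_mul, Real.exp_add]
    _ ≤ Real.exp ((n : ℝ) ^ 2 + 4 - w + -1 * v ^ 2) := by
        apply Real.exp_le_exp.2
        have : v ^ 2 = |v| ^ 2 := (sq_abs v).symm
        nlinarith [sq_nonneg ((n : ℝ) - |v|), sq_nonneg (n : ℝ), sq_nonneg |v|]
    _ = _ := by rw [Real.exp_add]

lemma continuous_airyIntegrand (n : ℕ) (w : ℝ) : Continuous (airyIntegrand n w) := by
  unfold airyIntegrand airyExp; fun_prop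

lemma integrable_airyIntegrand (n : ℕ) (w : ℝ) : Integrable (airyIntegrand n w) :=
  ((integrable_exp_neg_mul_sq (b := 1) one_pos).const_mul _).mono'
    (continuous_airyIntegrand n w).aestronglyMeasurable
    (ae_of_all _ (norm_airyIntegrand_le n w))

lemma conj_airyIntegrand (n : ℕ) (w v : ℝ) :
    (starRingEnd ℂ) (airyIntegrand n w v) = airyIntegrand n w (-v) := by
  simp only [airyIntegrand, airyExp, map_mul, map_pow, map_add, ← Complex.exp_conj,
    Complex.conj_I, Complex.conj_ofReal, map_ofNat, Complex.ofReal_neg]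
  congr 2
  · ring
  · ring

/-- The `n`-th derivative of the Airy-type function `∫ exp (i (4 u³ + w u)) du`. -/
noncomputable def airyD (n : ℕ) (w : ℝ) : ℝ := (∫ v, airyIntegrand n w v).re

/-- Conjugation acts on the integrand as v ↦ −v, so nothing is lost by taking the real part. -/
lemma ofReal_airyD (n : ℕ) (w : ℝ) : ((airyD n w : ℝ) : ℂ) = ∫ v, airyIntegrand n w v := by
  apply Complex.conj_eq_iff_re.1
  rw [← integral_conj]
  simp_rw [conj_airyIntegrand]
  exact integral_neg_eq_self (airyIntegrand n w) volume

lemma hasDerivAt_airyD (n : ℕ) (w : ℝ) : HasDerivAt (airyD n) (airyD (n + 1) w) w := by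
  have key := (hasDerivAt_integral_of_dominated_loc_of_deriv_le
    (μ := (volume : Measure ℝ)) (𝕜 := ℝ) (F := airyIntegrand n) (F' := airyIntegrand (n + 1))
    (x₀ := w) (s := Ioi (w - 1))
    (bound := fun v => Real.exp (((n + 1 : ℕ) : ℝ) ^ 2 + 4 - (w - 1)) * Real.exp (-1 * v ^ 2))
    (Ioi_mem_nhds (by linarith))
    (Eventually.of_forall fun x => (continuous_airyIntegrand n x).aestronglyMeasurable)
    (integrable_airyIntegrand n w) (continuous_airyIntegrand (n + 1) w).aestronglyMeasurable
    (ae_of_all _ fun v x hx => (norm_airyIntegrand_le (n + 1) x v).trans (by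
      have : w - 1 < x := hx
      gcongr))
    ((integrable_exp_neg_mul_sq (b := 1) one_pos).const_mul _)
    (ae_of_all _ fun v x _ => ?_)).2
  · have h2 := Complex.reCLM.hasFDerivAt.comp_hasDerivAt w key
    exact h2
  · have h0 : HasDerivAt (fun x : ℝ => (x : ℂ)) 1 x := Complex.ofRealCLM.hasDerivAt
    have h1 : HasDerivAt (fun x : ℝ => Complex.I * (4 * ((v : ℂ) + Complex.I) ^ 3
        + x * (v + Complex.I))) (Complex.I * (1 * (v + Complex.I))) x :=
      ((h0.mul_const _).const_add _).const_mul _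
    refine ((h1.cexp).const_mul ((Complex.I * (v + Complex.I)) ^ n)).congr_deriv ?_
    simp only [airyIntegrand, airyExp]
    ring

lemma contDiff_airyD (n : ℕ) : ContDiff ℝ (⊤ : ℕ∞) (airyD n) := by
  have hd : ∀ n, deriv (airyD n) = airyD (n + 1) := fun n => funext fun w =>
    (hasDerivAt_airyD n w).deriv
  have : ∀ (m n : ℕ), ContDiff ℝ m (airyD n) := by
    intro m
    induction m with
    | zero =>
      intro n
      exact contDiff_zero.2 (continuous_iff_continuousAt.2 fun w =>
        (hasDerivAt_airyD n w).continuousAt)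
    | succ m ih =>
      intro n
      push_cast
      refine contDiff_succ_iff_deriv.2 ⟨fun w => (hasDerivAt_airyD n w).differentiableAt,
        by simp, ?_⟩
      rw [hd]; exact ih _
  exact contDiff_infty.2 fun m => this m n

/-- The Airy equation: the total derivative i(12u² + w) exp(i(4u³ + wu)) integrates to zero along
the line. -/
lemma airyD_two (w : ℝ) : airyD 2 w = w / 12 * airyD 0 w := by
  have h0 : ∀ v : ℝ, HasDerivAt (airyExp w)
      (-12 * Complex.I * airyIntegrand 2 w v + Complex.I * w * airyIntegrand 0 w v) v := by
    intro v
    have h1 : HasDerivAt (fun x : ℝ => (x : ℂ)) 1 v := Complex.ofRealCLM.hasDerivAt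
    have h0 : HasDerivAt (fun x : ℝ => (x : ℂ) + Complex.I) 1 v := h1.add_const _
    refine ((((h0.pow 3).const_mul 4).add (h0.const_mul (w : ℂ))).const_mul
      Complex.I).cexp.congr_deriv ?_
    simp only [airyIntegrand, airyExp, Pi.add_apply, Pi.pow_apply]
    push_cast
    linear_combination (12 * Complex.I * (v + Complex.I) ^ 2 * Complex.exp (Complex.I *
      (4 * (v + Complex.I) ^ 3 + w * (v + Complex.I)))) * Complex.I_sq
  have hint : Integrable (airyExp w) := by
    have h := integrable_airyIntegrand 0 w
    have e : airyIntegrand 0 w = airyExp w := funext fun v => by simp [airyIntegrand]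
    rwa [e] at h
  have h1 := integral_eq_zero_of_hasDerivAt_of_integrable h0
    (((integrable_airyIntegrand 2 w).const_mul _).add
      ((integrable_airyIntegrand 0 w).const_mul _)) hint
  rw [integral_add ((integrable_airyIntegrand 2 w).const_mul _)
    ((integrable_airyIntegrand 0 w).const_mul _), integral_const_mul, integral_const_mul,
    ← ofReal_airyD, ← ofReal_airyD] at h1
  have h2 : Complex.I * ((-12 * airyD 2 w + w * airyD 0 w : ℝ) : ℂ) = 0 := by
    rw [← h1]; push_cast; ring
  have h3 : (-12 * airyD 2 w + w * airyD 0 w : ℝ) = 0 := by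
    simpa only [mul_eq_zero, Complex.I_ne_zero, false_or, Complex.ofReal_eq_zero] using h2
  linarith

/-! ### Growth and decay of the Airy-type function. -/

lemma exists_abs_airyD_le_exp (n : ℕ) : ∃ C, 0 < C ∧ ∀ w, |airyD n w| ≤ C * Real.exp (-w) := by
  refine ⟨Real.exp ((n : ℝ) ^ 2 + 4) * ∫ v : ℝ, Real.exp (-1 * v ^ 2), ?_, fun w => ?_⟩
  · rw [integral_gaussian]; positivity
  · calc |airyD n w| ≤ ‖∫ v, airyIntegrand n w v‖ := Complex.abs_re_le_norm _
      _ ≤ ∫ v : ℝ, Real.exp ((n : ℝ) ^ 2 + 4 - w) * Real.exp (-1 * v ^ 2) :=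
        norm_integral_le_of_norm_le ((integrable_exp_neg_mul_sq (b := 1) one_pos).const_mul _)
          (ae_of_all _ (norm_airyIntegrand_le n w))
      _ = _ := by
        rw [integral_const_mul, sub_eq_add_neg, Real.exp_add]; ring

/-- Energy estimates for the oscillator g'' = −(Z/12) g. A first decreasing energy bounds g and
gives g'² = O(Z). The adiabatic invariant (Z g²/12 + g'²)/√Z, corrected by a lower-order term, then
improves this to g'² = O(√Z). -/
lemma exists_airy_left_bounds : ∃ C, 0 < C ∧ ∀ Z : ℝ, 1 ≤ Z →
    |airyD 0 (-Z)| ≤ C ∧ airyD 1 (-Z) ^ 2 ≤ C * √Z := by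
  set g : ℝ → ℝ := fun Z => airyD 0 (-Z) with hg
  set g' : ℝ → ℝ := fun Z => -airyD 1 (-Z) with hg'
  have dg : ∀ Z, HasDerivAt g (g' Z) Z := fun Z => by
    have := (hasDerivAt_airyD 0 (-Z)).comp Z (hasDerivAt_neg Z)
    rw [mul_neg_one] at this
    exact this
  have dg' : ∀ Z, HasDerivAt g' (-(Z / 12) * g Z) Z := fun Z => by
    have := ((hasDerivAt_airyD 1 (-Z)).comp Z (hasDerivAt_neg Z)).neg
    rw [airyD_two] at this
    refine this.congr_deriv ?_
    simp only [hg]; ring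
  -- the first energy
  set E : ℝ → ℝ := fun Z => g Z ^ 2 + 12 * g' Z ^ 2 / Z with hE
  -- The equation cancels the cross terms; only the derivative of 1/Z survives.
  have dE : ∀ Z, 1 ≤ Z → HasDerivAt E (-12 * g' Z ^ 2 / Z ^ 2) Z := fun Z hZ => by
    have hZ0 : Z ≠ 0 := by positivity
    refine (((dg Z).pow 2).add
      ((((dg' Z).pow 2).const_mul 12).div (hasDerivAt_id Z) hZ0)).congr_deriv ?_
    simp only [Pi.pow_apply, id]
    field_simp
    ring
  have aE : AntitoneOn E (Ici 1) := by
    refine antitoneOn_of_deriv_nonpos (convex_Ici 1)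
      (fun Z hZ => (dE Z hZ).continuousAt.continuousWithinAt)
      (fun Z hZ => (dE Z (interior_subset hZ)).differentiableAt.differentiableWithinAt)
      fun Z hZ => ?_
    rw [(dE Z (interior_subset hZ)).deriv, neg_mul, neg_div, neg_nonpos]
    positivity
  set M : ℝ := E 1 with hM
  have hM0 : 0 ≤ M := by simp only [hM, hE]; positivity
  have bE : ∀ Z, 1 ≤ Z → g Z ^ 2 ≤ M ∧ g' Z ^ 2 ≤ M * Z := by
    intro Z hZ
    have h := aE (mem_Ici.2 le_rfl) (mem_Ici.2 hZ) hZ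
    have h0 : 0 < Z := by linarith
    have h1 : 0 ≤ 12 * g' Z ^ 2 / Z := by positivity
    have h2 : g Z ^ 2 + 12 * g' Z ^ 2 / Z ≤ M := h
    refine ⟨by linarith, ?_⟩
    have h3 : 12 * g' Z ^ 2 / Z ≤ M := by nlinarith [sq_nonneg (g Z)]
    rw [div_le_iff₀ h0] at h3
    nlinarith [sq_nonneg (g' Z)]
  have bgg : ∀ Z, 1 ≤ Z → |g Z * g' Z| ≤ M * √Z := by
    intro Z hZ
    obtain ⟨h1, h2⟩ := bE Z hZ
    apply abs_le_of_sq_le_sq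
    · rw [mul_pow, mul_pow, Real.sq_sqrt (by linarith)]
      nlinarith [sq_nonneg (g Z), sq_nonneg (g' Z), mul_le_mul h1 h2 (sq_nonneg _) hM0]
    · positivity
  -- the corrected energy
  set K : ℝ → ℝ := fun Z => (Z / 12 * g Z ^ 2 + g' Z ^ 2 + g Z * g' Z / (2 * Z)) / √Z + M / Z
    with hK
  -- The correction g g'/(2Z) cancels the terms g²/(24√Z) − g'²/(2Z^(3/2)) left by the uncorrected
  -- invariant. By `bgg` the remainder is at most (3/4) M/Z², which the derivative of M/Z outweighs.
  have dK : ∀ Z, 1 ≤ Z →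
      HasDerivAt K (-(3 / 4) * (g Z * g' Z) / (Z ^ 2 * √Z) - M / Z ^ 2) Z := fun Z hZ => by
    have hZ0 : 0 < Z := by linarith
    have hs : √Z ≠ 0 := (Real.sqrt_pos.2 hZ0).ne'
    have e1 := ((((hasDerivAt_id Z).div_const 12).mul ((dg Z).pow 2)).add ((dg' Z).pow 2)).add
      (((dg Z).mul (dg' Z)).div ((hasDerivAt_id Z).const_mul 2) (by simpa using hZ0.ne'))
    have e2 := (e1.div (Real.hasDerivAt_sqrt hZ0.ne') hs).add
      ((hasDerivAt_const Z M).div (hasDerivAt_id Z) hZ0.ne')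
    refine e2.congr_deriv ?_
    simp only [Pi.pow_apply, id, Pi.add_apply, Pi.mul_apply, Pi.div_apply]
    rw [← sub_eq_zero]
    have hq : Z = √Z ^ 2 := (Real.sq_sqrt hZ0.le).symm
    set s := √Z
    rw [hq]
    field_simp
    ring
  have aK : AntitoneOn K (Ici 1) := by
    refine antitoneOn_of_deriv_nonpos (convex_Ici 1)
      (fun Z hZ => (dK Z hZ).continuousAt.continuousWithinAt)
      (fun Z hZ => (dK Z (interior_subset hZ)).differentiableAt.differentiableWithinAt)
      fun Z hZ => ?_
    have hZ : 1 ≤ Z := interior_subset hZ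
    rw [(dK Z hZ).deriv]
    have hZ0 : 0 < Z := by linarith
    have hs : 0 < √Z := Real.sqrt_pos.2 hZ0
    have := neg_le_of_abs_le (bgg Z hZ)
    rw [sub_nonpos, div_le_div_iff₀ (by positivity) (by positivity)]
    have h4 : -(3 / 4) * (g Z * g' Z) ≤ M * √Z := by nlinarith [mul_nonneg hM0 hs.le]
    nlinarith [mul_le_mul_of_nonneg_right h4 (sq_nonneg Z)]
  refine ⟨M + 1 + (|K 1| + M), by positivity, fun Z hZ => ⟨?_, ?_⟩⟩
  · have h := (bE Z hZ).1
    have : |g Z| ≤ M + 1 := by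
      apply abs_le_of_sq_le_sq <;> nlinarith
    have h2 : |airyD 0 (-Z)| = |g Z| := rfl
    rw [h2]; linarith [abs_nonneg (K 1)]
  · have hZ0 : 0 < Z := by linarith
    have hs : 1 ≤ √Z := Real.one_le_sqrt.2 hZ
    have h := aK (mem_Ici.2 le_rfl) (mem_Ici.2 hZ) hZ
    have h1 : (Z / 12 * g Z ^ 2 + g' Z ^ 2 + g Z * g' Z / (2 * Z)) / √Z ≤ |K 1| := by
      have h2 : (Z / 12 * g Z ^ 2 + g' Z ^ 2 + g Z * g' Z / (2 * Z)) / √Z + M / Z ≤ |K 1| :=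
        h.trans (le_abs_self _)
      have : 0 ≤ M / Z := by positivity
      linarith
    rw [div_le_iff₀ (by positivity)] at h1
    have h5 : -(M * √Z) ≤ g Z * g' Z / (2 * Z) := by
      rw [le_div_iff₀ (by positivity)]
      have := neg_le_of_abs_le (bgg Z hZ)
      nlinarith [mul_nonneg hM0 (zero_le_one.trans hs)]
    have h6 : 0 ≤ Z / 12 * g Z ^ 2 := by positivity
    have h7 : airyD 1 (-Z) ^ 2 = g' Z ^ 2 := by simp [hg']
    rw [h7]
    nlinarith [abs_nonneg (K 1)]

/-- The Airy-type function is bounded, and its derivative is `O(⟨w⟩^{1/4})`. -/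
lemma exists_airy_bounds : ∃ C, 0 < C ∧ ∀ w : ℝ,
    |airyD 0 w| ≤ C ∧ |airyD 1 w| ≤ C * (1 + |w|) ^ (1 / 4 : ℝ) := by
  obtain ⟨C, hC, hl⟩ := exists_airy_left_bounds
  obtain ⟨C0, hC0, h0⟩ := exists_abs_airyD_le_exp 0
  obtain ⟨C1, hC1, h1⟩ := exists_abs_airyD_le_exp 1
  refine ⟨C + 1 + C0 * Real.exp 1 + C1 * Real.exp 1, by positivity, fun w => ?_⟩
  have hone : (1 : ℝ) ≤ (1 + |w|) ^ (1 / 4 : ℝ) :=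
    Real.one_le_rpow (by linarith [abs_nonneg w]) (by norm_num)
  have p0 : 0 < C0 * Real.exp 1 := by positivity
  have p1 : 0 < C1 * Real.exp 1 := by positivity
  rcases le_total (-1) w with hw | hw
  · have he : Real.exp (-w) ≤ Real.exp 1 := Real.exp_le_exp.2 (by linarith)
    have a0 : |airyD 0 w| ≤ C0 * Real.exp 1 := (h0 w).trans (by gcongr)
    have a1 : |airyD 1 w| ≤ C1 * Real.exp 1 := (h1 w).trans (by gcongr)
    exact ⟨by linarith, by nlinarith⟩
  · obtain ⟨b0, b1⟩ := hl (-w) (by linarith)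
    rw [neg_neg] at b0 b1
    refine ⟨by linarith, ?_⟩
    have habs : |w| = -w := abs_of_nonpos (by linarith)
    have hpos : (0 : ℝ) < 1 + |w| := by positivity
    have hsq : √(-w) ≤ ((1 + |w|) ^ (1 / 4 : ℝ)) ^ 2 := by
      rw [← Real.rpow_natCast, ← Real.rpow_mul hpos.le]
      norm_num
      rw [← Real.sqrt_eq_rpow]
      exact Real.sqrt_le_sqrt (by rw [habs]; linarith)
    have h2 : |airyD 1 w| ≤ (C + 1) * (1 + |w|) ^ (1 / 4 : ℝ) := by
      apply abs_le_of_sq_le_sq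
      · rw [mul_pow]
        calc _ ≤ C * √(-w) := b1
          _ ≤ (C + 1) ^ 2 * ((1 + |w|) ^ (1 / 4 : ℝ)) ^ 2 := by
            apply mul_le_mul _ hsq (by positivity) (by positivity)
            nlinarith
      · positivity
    nlinarith

lemma exists_airy_right_decay (N : ℕ) : ∃ C, 0 < C ∧ ∀ w : ℝ, 0 ≤ w →
    |airyD 0 w| ≤ C / (1 + w) ^ N ∧ |airyD 1 w| ≤ C / (1 + w) ^ N := by
  obtain ⟨C0, hC0, h0⟩ := exists_abs_airyD_le_exp 0
  obtain ⟨C1, hC1, h1⟩ := exists_abs_airyD_le_exp 1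
  have key : ∀ w : ℝ, 0 ≤ w → Real.exp (-w) ≤ N.factorial * Real.exp 1 / (1 + w) ^ N := by
    intro w hw
    have := Real.pow_div_factorial_le_exp (1 + w) (by linarith) N
    rw [div_le_iff₀ (by positivity)] at this
    rw [le_div_iff₀ (by positivity), Real.exp_neg, inv_mul_le_iff₀ (by positivity)]
    rw [Real.exp_add] at this
    linarith
  refine ⟨(C0 + C1) * (N.factorial * Real.exp 1), by positivity, fun w hw => ⟨?_, ?_⟩⟩
  · calc _ ≤ C0 * Real.exp (-w) := h0 w
      _ ≤ (C0 + C1) * (N.factorial * Real.exp 1 / (1 + w) ^ N) := by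
        gcongr; linarith; exact key w hw
      _ = _ := by ring
  · calc _ ≤ C1 * Real.exp (-w) := h1 w
      _ ≤ (C0 + C1) * (N.factorial * Real.exp 1 / (1 + w) ^ N) := by
        gcongr; linarith; exact key w hw
      _ = _ := by ring

/-! ### The fundamental solution as a product of Airy-type functions -/

/-- Cauchy's theorem on the rectangles [−n, n] × [0, h]; the bound `b` makes the vertical sides
vanish in the limit. -/
lemma integral_eq_integral_add_mul_I {G : ℂ → ℂ} (hG : Differentiable ℂ G) {h : ℝ} (hh : 0 ≤ h)
    {b : ℝ → ℝ} (hb : ∀ ξ : ℝ, ∀ y ∈ Icc 0 h, ‖G (ξ + y * Complex.I)‖ ≤ b ξ)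
    (hbi : Integrable b) (hbt : Tendsto b atTop (𝓝 0)) (hbb : Tendsto b atBot (𝓝 0)) :
    ∫ ξ : ℝ, G ξ = ∫ ξ : ℝ, G (ξ + h * Complex.I) := by
  have hGc := hG.continuous
  have i0 : Integrable fun ξ : ℝ => G ξ := by
    refine hbi.mono' (by fun_prop) (ae_of_all _ fun ξ => ?_)
    simpa using hb ξ 0 ⟨le_rfl, hh⟩
  have ih : Integrable fun ξ : ℝ => G (ξ + h * Complex.I) :=
    hbi.mono' (by fun_prop) (ae_of_all _ fun ξ => hb ξ h ⟨hh, le_rfl⟩)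
  have vert : ∀ u : ℕ → ℝ, Tendsto (fun n => b (u n)) atTop (𝓝 0) →
      Tendsto (fun n => Complex.I • ∫ y in (0 : ℝ)..h, G ((u n : ℝ) + y * Complex.I))
        atTop (𝓝 0) := by
    intro u hu
    have : Tendsto (fun n => ∫ y in (0 : ℝ)..h, G ((u n : ℝ) + y * Complex.I)) atTop (𝓝 0) := by
      refine squeeze_zero_norm (fun n => ?_) (by simpa only [zero_mul] using hu.mul_const |h - 0|)
      refine intervalIntegral.norm_integral_le_of_norm_le_const fun y hy => hb _ y ?_
      rw [uIoc_of_le hh] at hy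
      exact ⟨hy.1.le, hy.2⟩
    simpa using this.const_smul Complex.I
  have hn : Tendsto (fun n : ℕ => (n : ℝ)) atTop atTop := tendsto_natCast_atTop_atTop
  have hn' : Tendsto (fun n : ℕ => -(n : ℝ)) atTop atBot := tendsto_neg_atTop_atBot.comp hn
  have t0 := intervalIntegral_tendsto_integral i0 hn' hn
  have th := intervalIntegral_tendsto_integral ih hn' hn
  have v1 := vert (fun n => (n : ℝ)) (hbt.comp hn)
  have v2 := vert (fun n => -(n : ℝ)) (hbb.comp hn')
  have lim := ((t0.sub th).add v1).sub v2
  have zero : ∀ n : ℕ, (((∫ ξ in (-(n : ℝ))..n, G ξ) - ∫ ξ in (-(n : ℝ))..n,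
      G (ξ + h * Complex.I)) + Complex.I • ∫ y in (0 : ℝ)..h, G ((n : ℝ) + y * Complex.I))
      - Complex.I • (∫ y in (0 : ℝ)..h, G ((-(n : ℝ) : ℝ) + y * Complex.I)) = 0 := by
    intro n
    have := Complex.integral_boundary_rect_eq_zero_of_differentiableOn G ((-(n : ℝ) : ℝ) : ℂ)
      ((n : ℝ) + h * Complex.I) hG.differentiableOn
    simpa using this
  have h0 := tendsto_nhds_unique (lim.congr zero) tendsto_const_nhds
  rw [add_zero, sub_zero, sub_eq_zero] at h0
  exact h0

/-- The integrand of the fundamental solution at complex `ξ`, with a Gaussian factor. -/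
noncomputable def zkExp (t x y ε : ℝ) (ζ : ℂ) (η : ℝ) : ℂ :=
  Complex.exp (Complex.I * (t * ζ ^ 3 + t * ζ * η ^ 2 + x * ζ + y * η) - ε * (ζ ^ 2 + η ^ 2))

lemma norm_zkExp (t x y ε ξ h η : ℝ) :
    ‖zkExp t x y ε (ξ + h * Complex.I) η‖ =
      Real.exp (t * h ^ 3 - x * h + ε * h ^ 2 - (3 * t * h + ε) * ξ ^ 2 -
        (t * h + ε) * η ^ 2) := by
  have e : Complex.I * (t * ((ξ : ℂ) + h * Complex.I) ^ 3 + t * (ξ + h * Complex.I) * η ^ 2 +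
      x * (ξ + h * Complex.I) + y * η) - ε * ((ξ + h * Complex.I) ^ 2 + η ^ 2)
      = ((t * h ^ 3 - x * h + ε * h ^ 2 - (3 * t * h + ε) * ξ ^ 2 - (t * h + ε) * η ^ 2 : ℝ) : ℂ)
        + ((t * ξ ^ 3 - 3 * t * ξ * h ^ 2 + t * ξ * η ^ 2 + x * ξ + y * η
          - 2 * ε * ξ * h : ℝ) : ℂ) * Complex.I := by
    push_cast
    linear_combination (3 * t * ξ ^ 2 * h + 3 * t * ξ * h ^ 2 * Complex.I
      + t * h ^ 3 * (Complex.I ^ 2 - 1) + t * h * η ^ 2 + x * h - ε * h ^ 2 : ℂ) * Complex.I_sq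
  rw [zkExp, Complex.norm_exp, e, Complex.add_re, Complex.ofReal_re, Complex.re_ofReal_mul,
    Complex.I_re, mul_zero, add_zero]

lemma continuous_zkExp (t x y ε h : ℝ) :
    Continuous fun q : ℝ × ℝ => zkExp t x y ε (q.1 + h * Complex.I) q.2 := by
  unfold zkExp; fun_prop

lemma integrable_exp_sub_sq_sub_sq (c : ℝ) {a b : ℝ} (ha : 0 < a) (hb : 0 < b) :
    Integrable fun q : ℝ × ℝ => Real.exp (c - a * q.1 ^ 2 - b * q.2 ^ 2) := by
  have := ((integrable_exp_neg_mul_sq ha).mul_prod (integrable_exp_neg_mul_sq hb)).const_mul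
    (Real.exp c)
  refine this.congr (ae_of_all _ fun q => ?_)
  simp only [← Real.exp_add]
  congr 1; ring

lemma integrable_zkExp {t h ε : ℝ} (x y : ℝ) (ht : 0 ≤ t) (hh : 0 ≤ h)
    (hpos : 0 < t * h + ε) :
    Integrable fun q : ℝ × ℝ => zkExp t x y ε (q.1 + h * Complex.I) q.2 := by
  have : 0 ≤ t * h := by positivity
  refine (integrable_exp_sub_sq_sub_sq (t * h ^ 3 - x * h + ε * h ^ 2) (a := 3 * t * h + ε)
    (b := t * h + ε) (by nlinarith) hpos).mono'
    (continuous_zkExp t x y ε h).aestronglyMeasurable (ae_of_all _ fun q => ?_)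
  rw [norm_zkExp]

lemma integral_zkExp_eq_shift {t h ε : ℝ} (x y : ℝ) (ht : 0 ≤ t) (hh : 0 ≤ h) (hε : 0 < ε) :
    ∫ q : ℝ × ℝ, zkExp t x y ε q.1 q.2 =
      ∫ q : ℝ × ℝ, zkExp t x y ε (q.1 + h * Complex.I) q.2 := by
  have hth : 0 ≤ t * h := by positivity
  have i0 := integrable_zkExp x y ht le_rfl (by linarith : 0 < t * 0 + ε)
  simp only [Complex.ofReal_zero, zero_mul, add_zero] at i0
  have ih := integrable_zkExp x y ht hh (by linarith)
  rw [Measure.volume_eq_prod] at i0 ih ⊢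
  rw [integral_prod_symm _ i0, integral_prod_symm _ ih]
  congr 1
  funext η
  refine integral_eq_integral_add_mul_I (G := fun ζ => zkExp t x y ε ζ η)
    (b := fun ξ => Real.exp (t * h ^ 3 + |x| * h + ε * h ^ 2) * Real.exp (-ε * ξ ^ 2)) ?_ hh ?_
    ((integrable_exp_neg_mul_sq hε).const_mul _) ?_ ?_
  · unfold zkExp; fun_prop
  · intro ξ u hu
    rw [norm_zkExp, ← Real.exp_add]
    apply Real.exp_le_exp.2
    have h1 : t * u ^ 3 ≤ t * h ^ 3 := by
      have := hu.1; have := hu.2; gcongr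
    have h2 : -x * u ≤ |x| * h :=
      (mul_le_mul_of_nonneg_right (neg_le_abs x) hu.1).trans
        (mul_le_mul_of_nonneg_left hu.2 (abs_nonneg x))
    have h3 : ε * u ^ 2 ≤ ε * h ^ 2 := by
      have := hu.1; have := hu.2; gcongr
    have h4 : 0 ≤ t * u := mul_nonneg ht hu.1
    nlinarith [mul_nonneg h4 (sq_nonneg ξ), mul_nonneg h4 (sq_nonneg η),
      mul_nonneg hε.le (sq_nonneg η)]
  all_goals
    rw [show (0 : ℝ) = Real.exp (t * h ^ 3 + |x| * h + ε * h ^ 2) * 0 by ring]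
    refine Tendsto.const_mul _ (Real.tendsto_exp_atBot.comp ?_)
    simp only [neg_mul]
    refine tendsto_neg_atTop_atBot.comp (Tendsto.const_mul_atTop hε ?_)
  · exact tendsto_pow_atTop two_ne_zero
  · have h := (tendsto_pow_atTop (α := ℝ) two_ne_zero).comp tendsto_neg_atBot_atTop
    exact h.congr fun z => by simp

/-- On the line Im ξ = h the phase itself supplies the Gaussian exp(−3thξ² − thη²). It dominates
uniformly in ε, so the regularization can be removed. -/
lemma tendsto_integral_zkExp {t h : ℝ} (x y : ℝ) (ht : 0 < t) (hh : 0 < h) :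
    Tendsto (fun ε => ∫ q : ℝ × ℝ, zkExp t x y ε q.1 q.2) (𝓝[>] 0)
      (𝓝 (∫ q : ℝ × ℝ, zkExp t x y 0 (q.1 + h * Complex.I) q.2)) := by
  have hth : 0 < t * h := by positivity
  have h1 : Tendsto (fun ε => ∫ q : ℝ × ℝ, zkExp t x y ε (q.1 + h * Complex.I) q.2) (𝓝[>] 0)
      (𝓝 (∫ q : ℝ × ℝ, zkExp t x y 0 (q.1 + h * Complex.I) q.2)) := by
    refine tendsto_integral_filter_of_dominated_convergence
      (fun q => Real.exp (t * h ^ 3 - x * h + h ^ 2 - 3 * t * h * q.1 ^ 2 - t * h * q.2 ^ 2))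
      (Eventually.of_forall fun ε => (continuous_zkExp t x y ε h).aestronglyMeasurable) ?_
      (integrable_exp_sub_sq_sub_sq _ (by positivity) hth) (ae_of_all _ fun q => ?_)
    · filter_upwards [Ioo_mem_nhdsGT (zero_lt_one' ℝ)] with ε hε
      refine ae_of_all _ fun q => ?_
      rw [norm_zkExp]
      apply Real.exp_le_exp.2
      have := hε.1
      nlinarith [mul_nonneg this.le (sq_nonneg q.1), mul_nonneg this.le (sq_nonneg q.2),
        mul_le_mul_of_nonneg_right hε.2.le (sq_nonneg h)]
    · have : Continuous fun ε : ℝ => zkExp t x y ε (q.1 + h * Complex.I) q.2 := by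
        unfold zkExp; fun_prop
      exact this.continuousAt.mono_left nhdsWithin_le_nhds
  refine h1.congr' ?_
  filter_upwards [self_mem_nhdsWithin] with ε hε
  exact (integral_zkExp_eq_shift x y ht.le hh.le hε).symm

lemma kernelA_eq_integral {t h : ℝ} (x y : ℝ) (ht : 0 < t) (hh : 0 < h) :
    kernelA x y t = ∫ q : ℝ × ℝ, zkExp t x y 0 (q.1 + h * Complex.I) q.2 := by
  refine Tendsto.limUnder_eq ((tendsto_integral_zkExp x y ht hh).congr fun ε => ?_)
  congr 1
  funext q
  rw [Complex.ofReal_exp, ← Complex.exp_add, zkExp]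
  congr 1
  push_cast
  ring

/-- This change of variables removes the mixed terms of ξ³ + ξη², since (u + v)³ + 3(u + v)(u − v)²
= 4(u³ + v³). The factor 2√3c² is the absolute determinant. -/
lemma integral_comp_linear (g : ℝ × ℝ → ℂ) (hg : Continuous g) {c : ℝ} (hc : 0 < c) :
    ∫ q : ℝ × ℝ, g q =
      ((2 * √3 * c ^ 2 : ℝ) : ℂ) *
        ∫ q : ℝ × ℝ, g (c * (q.1 + q.2), √3 * c * (q.1 - q.2)) := by
  set L := Matrix.toLin (Module.Basis.finTwoProd ℝ) (Module.Basis.finTwoProd ℝ)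
    !![c, c; √3 * c, -(√3 * c)] with hL
  have hdet : LinearMap.det L = -(2 * √3 * c ^ 2) := by
    rw [hL, LinearMap.det_toLin, Matrix.det_fin_two_of]; ring
  have hpos : 0 < 2 * √3 * c ^ 2 := by positivity
  have hmap := Measure.map_linearMap_addHaar_eq_smul_addHaar (volume : Measure (ℝ × ℝ)) (f := L)
    (by rw [hdet]; exact neg_ne_zero.2 hpos.ne')
  have happ : ∀ q : ℝ × ℝ, L q = (c * (q.1 + q.2), √3 * c * (q.1 - q.2)) := by
    intro q
    rw [hL, Matrix.toLin_finTwoProd_apply]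
    ext <;> simp <;> ring
  have hLc : Continuous L := L.continuous_of_finiteDimensional
  have h1 : ∫ q, g q ∂(Measure.map L volume) = ∫ q, g (L q) :=
    integral_map hLc.aemeasurable hg.aestronglyMeasurable
  rw [hmap, integral_smul_measure, hdet, ENNReal.toReal_ofReal (abs_nonneg _), abs_inv, abs_neg,
    abs_of_pos hpos] at h1
  simp_rw [happ] at h1
  rw [← h1, Complex.real_smul, ← mul_assoc, ← Complex.ofReal_mul, mul_inv_cancel₀ hpos.ne',
    Complex.ofReal_one, one_mul]

/-- The fundamental solution is a product of two Airy-type functions. -/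
lemma kernelA_eq (x y : ℝ) {μ : ℝ} (hμ : 0 < μ) :
    kernelA x y (μ ^ 3) = ((2 * √3 / μ ^ 2 * (airyD 0 ((x + √3 * y) / μ) *
      airyD 0 ((x - √3 * y) / μ)) : ℝ) : ℂ) := by
  -- Height 2/μ for ξ = (u + v)/μ puts u and v both on the line Im = 1, while η = √3(u − v)/μ stays
  -- real.
  have h2 : (0 : ℝ) < 2 / μ := by positivity
  rw [kernelA_eq_integral x y (pow_pos hμ 3) h2,
    integral_comp_linear _ (continuous_zkExp _ _ _ _ _) (inv_pos.2 hμ)]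
  push_cast
  rw [ofReal_airyD, ofReal_airyD, ← integral_prod_mul, ← Measure.volume_eq_prod,
    div_eq_mul_inv, inv_pow]
  congr 2
  funext q
  simp only [zkExp, airyIntegrand, airyExp, pow_zero, one_mul]
  rw [← Complex.exp_add]
  congr 1
  have hm : (μ : ℂ) ≠ 0 := by exact_mod_cast hμ.ne'
  have hs : ((√3 : ℝ) : ℂ) ^ 2 = 3 := by
    rw [← Complex.ofReal_pow, Real.sq_sqrt (by norm_num)]; norm_num
  push_cast
  field_simp
  ring_nf
  rw [hs]
  ring

/-! ### Pointwise bounds for the kernel in self-similar variables -/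

/-- Rapid decay on the right, and growth like `⟨X⟩^{1/4}` with localization to `|Y| ≲ ⟨X⟩` on the
left. -/
structure IsAiryKernel (κ : ℝ → ℝ → ℝ) : Prop where
  continuous : Continuous fun q : ℝ × ℝ => κ q.1 q.2
  right : ∀ N : ℕ, ∃ C, 0 < C ∧ ∀ X Y, 0 ≤ X → |κ X Y| ≤ C / (1 + X + |Y|) ^ N
  left : ∃ C, 0 < C ∧ ∀ X Y, X ≤ 0 →
    |κ X Y| ≤ C * (1 + |X|) ^ (1 / 4 : ℝ) * ((1 + |X|) / (1 + |X| + |Y|)) ^ 2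

lemma IsAiryKernel.add {κ κ' : ℝ → ℝ → ℝ} (h : IsAiryKernel κ) (h' : IsAiryKernel κ') :
    IsAiryKernel fun X Y => κ X Y + κ' X Y := by
  refine ⟨h.continuous.add h'.continuous, fun N => ?_, ?_⟩
  · obtain ⟨C, hC, hb⟩ := h.right N
    obtain ⟨C', hC', hb'⟩ := h'.right N
    refine ⟨C + C', by positivity, fun X Y hX => (abs_add_le _ _).trans ?_⟩
    rw [add_div]
    exact add_le_add (hb X Y hX) (hb' X Y hX)
  · obtain ⟨C, hC, hb⟩ := h.left
    obtain ⟨C', hC', hb'⟩ := h'.left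
    refine ⟨C + C', by positivity, fun X Y hX => (abs_add_le _ _).trans ?_⟩
    rw [add_mul, add_mul]
    exact add_le_add (hb X Y hX) (hb' X Y hX)

lemma sqrt_three_mem : 1.7 ≤ √3 ∧ √3 ≤ 1.8 :=
  ⟨Real.le_sqrt_of_sq_le (by norm_num), Real.sqrt_le_iff.2 (by norm_num)⟩

lemma rpow_quarter_le_self {z : ℝ} (hz : 1 ≤ z) : z ^ (1 / 4 : ℝ) ≤ z := by
  simpa using Real.rpow_le_rpow_of_exponent_le hz (by norm_num : (1 / 4 : ℝ) ≤ 1)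

/-- In this region X + √3Y is nonnegative and 1 + X + √3Y ≥ (1 + |X| + Y)/3. So `u` decays to any
order, and one extra power pays for the growth of `v`. -/
lemma exists_cone_bound {u v : ℝ → ℝ}
    (du : ∀ N : ℕ, ∃ C, 0 < C ∧ ∀ w, 0 ≤ w → |u w| ≤ C / (1 + w) ^ N)
    (hv : ∃ C, 0 < C ∧ ∀ w, |v w| ≤ C * (1 + |w|) ^ (1 / 4 : ℝ)) (N : ℕ) :
    ∃ C, 0 < C ∧ ∀ X Y, 0 ≤ Y → -Y ≤ X →
      |u (X + √3 * Y) * v (X - √3 * Y)| ≤ C / (1 + |X| + |Y|) ^ N := by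
  obtain ⟨C, hC, hu⟩ := du (N + 1)
  obtain ⟨D, hD, hv⟩ := hv
  obtain ⟨s1, s2⟩ := sqrt_three_mem
  refine ⟨C * D * 3 ^ (N + 1) * 2, by positivity, fun X Y hY hX => ?_⟩
  rw [abs_of_nonneg hY]
  have hp : (1 + |X| + Y) / 3 ≤ 1 + (X + √3 * Y) := by
    rcases abs_cases X with ⟨h, _⟩ | ⟨h, _⟩ <;> rw [h] <;> nlinarith
  have hp0 : 0 ≤ X + √3 * Y := by nlinarith
  have hq : 1 + |X - √3 * Y| ≤ 2 * (1 + |X| + Y) := by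
    have h1 := abs_sub X (√3 * Y)
    rw [abs_of_nonneg (by positivity : 0 ≤ √3 * Y)] at h1
    have := abs_nonneg X
    nlinarith
  have hS : 0 < 1 + |X| + Y := by positivity
  rw [abs_mul]
  have b1 : |u (X + √3 * Y)| ≤ C * 3 ^ (N + 1) / (1 + |X| + Y) ^ (N + 1) := by
    refine (hu _ hp0).trans ?_
    rw [mul_div_assoc, ← div_pow, div_eq_mul_inv]
    gcongr
    rw [← inv_pow]
    gcongr
    rw [inv_le_comm₀ (by positivity) (by positivity), inv_div]
    exact hp
  have b2 : |v (X - √3 * Y)| ≤ D * (2 * (1 + |X| + Y)) := by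
    refine (hv _).trans ?_
    gcongr
    exact (rpow_quarter_le_self (by linarith [abs_nonneg (X - √3 * Y)])).trans hq
  calc _ ≤ C * 3 ^ (N + 1) / (1 + |X| + Y) ^ (N + 1) * (D * (2 * (1 + |X| + Y))) := by gcongr
    _ = _ := by rw [pow_succ (1 + |X| + Y)]; field_simp

/-- For X ≥ −|Y| the cone bound applies to `u` or to `v`, according to the sign of Y. In the
remaining cone both arguments are O(|X|), and `huv` ensures that the product grows like a single 1/4
power rather than two. -/
lemma isAiryKernel_mul {u v : ℝ → ℝ} (cu : Continuous u) (cv : Continuous v)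
    (du : ∀ N : ℕ, ∃ C, 0 < C ∧ ∀ w, 0 ≤ w → |u w| ≤ C / (1 + w) ^ N)
    (dv : ∀ N : ℕ, ∃ C, 0 < C ∧ ∀ w, 0 ≤ w → |v w| ≤ C / (1 + w) ^ N)
    (hu : ∃ C, 0 < C ∧ ∀ w, |u w| ≤ C * (1 + |w|) ^ (1 / 4 : ℝ))
    (hv : ∃ C, 0 < C ∧ ∀ w, |v w| ≤ C * (1 + |w|) ^ (1 / 4 : ℝ))
    (huv : ∃ C, 0 < C ∧ ∀ w w', |u w * v w'| ≤
      C * ((1 + |w|) ^ (1 / 4 : ℝ) + (1 + |w'|) ^ (1 / 4 : ℝ))) :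
    IsAiryKernel fun X Y => u (X + √3 * Y) * v (X - √3 * Y) := by
  have cone : ∀ N : ℕ, ∃ C, 0 < C ∧ ∀ X Y, -|Y| ≤ X →
      |u (X + √3 * Y) * v (X - √3 * Y)| ≤ C / (1 + |X| + |Y|) ^ N := by
    intro N
    obtain ⟨C, hC, h⟩ := exists_cone_bound du hv N
    obtain ⟨C', hC', h'⟩ := exists_cone_bound dv hu N
    refine ⟨C + C', by positivity, fun X Y hXY => ?_⟩
    rw [add_div]
    have p1 : 0 ≤ C / (1 + |X| + |Y|) ^ N := by positivity
    have p2 : 0 ≤ C' / (1 + |X| + |Y|) ^ N := by positivity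
    rcases abs_cases Y with ⟨hY, hY0⟩ | ⟨hY, hY0⟩
    · have := h X Y hY0 (by rwa [hY] at hXY)
      linarith
    · have := h' X (-Y) (by linarith) (by rwa [hY] at hXY)
      rw [mul_neg, sub_neg_eq_add, ← sub_eq_add_neg, abs_neg, mul_comm] at this
      linarith
  refine ⟨by fun_prop, fun N => ?_, ?_⟩
  · obtain ⟨C, hC, h⟩ := cone N
    refine ⟨C, hC, fun X Y hX => ?_⟩
    have := h X Y (by linarith [abs_nonneg Y])
    rwa [abs_of_nonneg hX] at this
  · obtain ⟨C, hC, h⟩ := cone 2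
    obtain ⟨D, hD, h'⟩ := huv
    obtain ⟨s1, s2⟩ := sqrt_three_mem
    refine ⟨C + D * 24, by positivity, fun X Y hX => ?_⟩
    have hone : 1 ≤ (1 + |X|) ^ (1 / 4 : ℝ) :=
      Real.one_le_rpow (by linarith [abs_nonneg X]) (by norm_num)
    rcases le_total |Y| |X| with hXY | hXY
    -- In the cone the localization factor is at least 1/4, and each 1/4 power costs a factor 3;
    -- hence 24 = 4(3 + 3).
    · have hr : 1 / 2 ≤ (1 + |X|) / (1 + |X| + |Y|) := by
        rw [div_le_div_iff₀ (by norm_num) (by positivity)]; linarith [abs_nonneg X]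
      have hr2 : 1 / 4 ≤ ((1 + |X|) / (1 + |X| + |Y|)) ^ 2 := by nlinarith
      have q : ∀ w, |w| ≤ |X| + √3 * |Y| → (1 + |w|) ^ (1 / 4 : ℝ) ≤
          3 * (1 + |X|) ^ (1 / 4 : ℝ) := by
        intro w hw
        calc (1 + |w|) ^ (1 / 4 : ℝ) ≤ (3 * (1 + |X|)) ^ (1 / 4 : ℝ) := by
              gcongr; nlinarith [abs_nonneg X]
          _ = 3 ^ (1 / 4 : ℝ) * (1 + |X|) ^ (1 / 4 : ℝ) := by
              rw [Real.mul_rpow (by norm_num) (by positivity)]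
          _ ≤ _ := by gcongr; exact rpow_quarter_le_self (by norm_num)
      have a : |√3 * Y| = √3 * |Y| := by rw [abs_mul, abs_of_nonneg (Real.sqrt_nonneg 3)]
      have q1 := q (X + √3 * Y) ((abs_add_le _ _).trans_eq (by rw [a]))
      have q2 := q (X - √3 * Y) ((abs_sub _ _).trans_eq (by rw [a]))
      calc _ ≤ D * (3 * (1 + |X|) ^ (1 / 4 : ℝ) + 3 * (1 + |X|) ^ (1 / 4 : ℝ)) :=
            (h' _ _).trans (by gcongr)
        _ = D * 24 * (1 + |X|) ^ (1 / 4 : ℝ) * (1 / 4) := by ring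
        _ ≤ (C + D * 24) * (1 + |X|) ^ (1 / 4 : ℝ) * ((1 + |X|) / (1 + |X| + |Y|)) ^ 2 := by
            gcongr; linarith
    · calc _ ≤ C / (1 + |X| + |Y|) ^ 2 :=
            h X Y (by rw [abs_of_nonpos hX] at hXY; linarith)
        _ = C * 1 * (1 / (1 + |X| + |Y|)) ^ 2 := by rw [one_div, inv_pow]; ring
        _ ≤ _ := by gcongr <;> linarith [abs_nonneg X, mul_pos hD (by norm_num : (0 : ℝ) < 24)]

/-- The fundamental solution in self-similar variables. -/
noncomputable def ker0 (X Y : ℝ) : ℝ := airyD 0 (X + √3 * Y) * airyD 0 (X - √3 * Y)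

/-- The `x`-derivative of the fundamental solution in self-similar variables. -/
noncomputable def ker1 (X Y : ℝ) : ℝ :=
  airyD 1 (X + √3 * Y) * airyD 0 (X - √3 * Y) + airyD 0 (X + √3 * Y) * airyD 1 (X - √3 * Y)

lemma exists_abs_ker0_le : ∃ C, 0 < C ∧ ∀ X Y, |ker0 X Y| ≤ C := by
  obtain ⟨C, hC, h⟩ := exists_airy_bounds
  refine ⟨C * C, by positivity, fun X Y => ?_⟩
  rw [ker0, abs_mul]
  exact mul_le_mul (h _).1 (h _).1 (abs_nonneg _) hC.le

lemma isAiryKernel_airyD :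
    IsAiryKernel (fun X Y => airyD 0 (X + √3 * Y) * airyD 0 (X - √3 * Y)) ∧
    IsAiryKernel (fun X Y => airyD 1 (X + √3 * Y) * airyD 0 (X - √3 * Y)) ∧
    IsAiryKernel (fun X Y => airyD 0 (X + √3 * Y) * airyD 1 (X - √3 * Y)) := by
  have c0 := (contDiff_airyD 0).continuous
  have c1 := (contDiff_airyD 1).continuous
  have d0 : ∀ N : ℕ, ∃ C, 0 < C ∧ ∀ w, 0 ≤ w → |airyD 0 w| ≤ C / (1 + w) ^ N := fun N => by
    obtain ⟨C, hC, h⟩ := exists_airy_right_decay N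
    exact ⟨C, hC, fun w hw => (h w hw).1⟩
  have d1 : ∀ N : ℕ, ∃ C, 0 < C ∧ ∀ w, 0 ≤ w → |airyD 1 w| ≤ C / (1 + w) ^ N := fun N => by
    obtain ⟨C, hC, h⟩ := exists_airy_right_decay N
    exact ⟨C, hC, fun w hw => (h w hw).2⟩
  obtain ⟨C, hC, h⟩ := exists_airy_bounds
  have hq : ∀ w : ℝ, 1 ≤ (1 + |w|) ^ (1 / 4 : ℝ) := fun w =>
    Real.one_le_rpow (by linarith [abs_nonneg w]) (by norm_num)
  have q0 : ∀ w, |airyD 0 w| ≤ C * (1 + |w|) ^ (1 / 4 : ℝ) := fun w =>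
    (h w).1.trans (le_mul_of_one_le_right hC.le (hq w))
  have q1 : ∀ w, |airyD 1 w| ≤ C * (1 + |w|) ^ (1 / 4 : ℝ) := fun w => (h w).2
  refine ⟨isAiryKernel_mul c0 c0 d0 d0 ⟨C, hC, q0⟩ ⟨C, hC, q0⟩ ⟨C * C, by positivity, ?_⟩,
    isAiryKernel_mul c1 c0 d1 d0 ⟨C, hC, q1⟩ ⟨C, hC, q0⟩ ⟨C * C, by positivity, ?_⟩,
    isAiryKernel_mul c0 c1 d0 d1 ⟨C, hC, q0⟩ ⟨C, hC, q1⟩ ⟨C * C, by positivity, ?_⟩⟩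
  · intro w w'
    rw [abs_mul]
    calc _ ≤ C * (1 + |w|) ^ (1 / 4 : ℝ) * C :=
          mul_le_mul (q0 w) (h w').1 (abs_nonneg _) (by positivity)
      _ = C * C * ((1 + |w|) ^ (1 / 4 : ℝ) + 0) := by ring
      _ ≤ _ := by gcongr; positivity
  · intro w w'
    rw [abs_mul]
    calc _ ≤ C * (1 + |w|) ^ (1 / 4 : ℝ) * C :=
          mul_le_mul (q1 w) (h w').1 (abs_nonneg _) (by positivity)
      _ = C * C * ((1 + |w|) ^ (1 / 4 : ℝ) + 0) := by ring
      _ ≤ _ := by gcongr; positivity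
  · intro w w'
    rw [abs_mul]
    calc _ ≤ C * (C * (1 + |w'|) ^ (1 / 4 : ℝ)) :=
          mul_le_mul (h w).1 (q1 w') (abs_nonneg _) (by positivity)
      _ = C * C * (0 + (1 + |w'|) ^ (1 / 4 : ℝ)) := by ring
      _ ≤ _ := by gcongr; positivity

lemma isAiryKernel_ker0 : IsAiryKernel ker0 := isAiryKernel_airyD.1

lemma isAiryKernel_ker1 : IsAiryKernel ker1 := isAiryKernel_airyD.2.1.add isAiryKernel_airyD.2.2

/-! ### Integration by parts against a kernel without compact support -/

/-- The weak derivative is tested on `k` times the cutoff χ(p/(n + 1)). The term with the derivative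
of the cutoff carries a factor 1/(n + 1) and vanishes in the limit, by dominated convergence with `k
• φ` integrable. -/
lemma HasWeakDerivX.integral_smul_eq_neg {k kx : ℝ × ℝ → ℝ} {φ G : ℝ × ℝ → ℂ}
    (hw : HasWeakDerivX φ G) (hk : ContDiff ℝ (⊤ : ℕ∞) k) (hkx : ∀ p, fderiv ℝ k p (1, 0) = kx p)
    (h1 : Integrable fun p => k p • φ p) (h2 : Integrable fun p => kx p • φ p)
    (h3 : Integrable fun p => k p • G p) :
    ∫ p, kx p • φ p = -∫ p, k p • G p := by
  let χ : ContDiffBump (0 : ℝ × ℝ) := ⟨1, 2, one_pos, one_lt_two⟩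
  have hχ : ContDiff ℝ (⊤ : ℕ∞) (χ : ℝ × ℝ → ℝ) := χ.contDiff
  have hχs : HasCompactSupport (χ : ℝ × ℝ → ℝ) := χ.hasCompactSupport
  have hχ' : Continuous (fderiv ℝ (χ : ℝ × ℝ → ℝ)) := hχ.continuous_fderiv (by simp)
  obtain ⟨B, hB⟩ := hχ'.bounded_above_of_compact_support (hχs.fderiv ℝ)
  have hB0 : 0 ≤ B := (norm_nonneg _).trans (hB 0)
  set c : ℕ → ℝ := fun n => 1 / ((n : ℝ) + 1) with hc
  have hcpos : ∀ n, 0 < c n := fun n => by simp only [hc]; positivity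
  have hcle : ∀ n, c n ≤ 1 := fun n => by
    simp only [hc]; rw [div_le_one (by positivity)]; linarith [(n.cast_nonneg : (0 : ℝ) ≤ n)]
  have hc0 : Tendsto c atTop (𝓝 0) := tendsto_one_div_add_atTop_nhds_zero_nat
  set ψ : ℕ → ℝ × ℝ → ℝ := fun n p => k p * χ (c n • p) with hψ
  have hsm : ∀ n, ContDiff ℝ (⊤ : ℕ∞) fun p : ℝ × ℝ => χ (c n • p) := fun n =>
    hχ.comp (contDiff_const_smul (c n))
  have hψs : ∀ n, ContDiff ℝ (⊤ : ℕ∞) (ψ n) := fun n => hk.mul (hsm n)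
  have hψc : ∀ n, HasCompactSupport (ψ n) := fun n =>
    (hχs.comp_smul (hcpos n).ne').mul_left
  have hd : ∀ n p, fderiv ℝ (ψ n) p (1, 0) =
      kx p * χ (c n • p) + k p * (c n * fderiv ℝ χ (c n • p) (1, 0)) := by
    intro n p
    have d1 : HasFDerivAt k (fderiv ℝ k p) p :=
      (hk.differentiable (by simp)).differentiableAt.hasFDerivAt
    have d2 : HasFDerivAt (fun p : ℝ × ℝ => χ (c n • p))
        ((fderiv ℝ χ (c n • p)).comp (c n • ContinuousLinearMap.id ℝ (ℝ × ℝ))) p :=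
      HasFDerivAt.comp (g := (χ : ℝ × ℝ → ℝ)) (f := fun p : ℝ × ℝ => c n • p) p
        (hχ.differentiable (by simp)).differentiableAt.hasFDerivAt
        ((hasFDerivAt_id p).const_smul (c n))
    have d3 : HasFDerivAt (ψ n) _ p := d1.mul d2
    rw [d3.fderiv]
    simp only [add_apply, smul_apply,
      ContinuousLinearMap.comp_apply, ContinuousLinearMap.id_apply, map_smul, smul_eq_mul, hkx]
    ring
  have hχlim : ∀ p : ℝ × ℝ, Tendsto (fun n => χ (c n • p)) atTop (𝓝 1) := by
    intro p
    have h0 : Tendsto (fun n => c n • p) atTop (𝓝 0) := by simpa using hc0.smul_const p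
    have := (χ.continuous.tendsto 0).comp h0
    rwa [χ.one_of_mem_closedBall (by simp [χ.rIn_pos.le])] at this
  have lim1 : Tendsto (fun n => ∫ p, (fderiv ℝ (ψ n) p (1, 0)) • φ p) atTop
      (𝓝 (∫ p, kx p • φ p)) := by
    refine tendsto_integral_of_dominated_convergence
      (fun p => ‖kx p • φ p‖ + B * ‖k p • φ p‖) (fun n => ?_) (h2.norm.add (h1.norm.const_mul B))
      (fun n => ae_of_all _ fun p => ?_) (ae_of_all _ fun p => ?_)
    · have : Continuous fun p => fderiv ℝ (ψ n) p (1, 0) :=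
        ((hψs n).continuous_fderiv (by simp)).clm_apply continuous_const
      exact this.aestronglyMeasurable.smul hw.1.aestronglyMeasurable
    · rw [hd, add_smul, mul_smul, mul_smul]
      refine (norm_add_le _ _).trans (add_le_add ?_ ?_)
      · rw [smul_comm, norm_smul, Real.norm_eq_abs, abs_of_nonneg χ.nonneg]
        exact mul_le_of_le_one_left (norm_nonneg _) χ.le_one
      · rw [smul_comm, norm_smul]
        gcongr
        rw [norm_mul, Real.norm_eq_abs, abs_of_pos (hcpos n)]
        have hle : ‖fderiv ℝ χ (c n • p) (1, 0)‖ ≤ B := by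
          refine ((fderiv ℝ χ (c n • p)).le_opNorm _).trans ?_
          have : ‖((1 : ℝ), (0 : ℝ))‖ = 1 := by simp [Prod.norm_def]
          rw [this, mul_one]
          exact hB _
        calc _ ≤ 1 * B := mul_le_mul (hcle n) hle (norm_nonneg _) zero_le_one
          _ = B := one_mul B
    · have t2 : Tendsto (fun n => fderiv ℝ (ψ n) p (1, 0)) atTop (𝓝 (kx p)) := by
        simp_rw [hd]
        have t3 : Tendsto (fun n => c n * fderiv ℝ χ (c n • p) (1, 0)) atTop (𝓝 0) := by
          refine squeeze_zero_norm (a := fun n => c n * (B * ‖((1 : ℝ), (0 : ℝ))‖))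
            (fun n => ?_) (by simpa using hc0.mul_const (B * ‖((1 : ℝ), (0 : ℝ))‖))
          rw [norm_mul, Real.norm_eq_abs, abs_of_pos (hcpos n)]
          exact mul_le_mul_of_nonneg_left
            ((fderiv ℝ χ (c n • p)).le_of_opNorm_le (hB _) _) (hcpos n).le
        simpa using ((hχlim p).const_mul (kx p)).add (t3.const_mul (k p))
      exact t2.smul_const _
  have lim2 : Tendsto (fun n => -∫ p, ψ n p • G p) atTop (𝓝 (-∫ p, k p • G p)) := by
    refine (tendsto_integral_of_dominated_convergence (fun p => ‖k p • G p‖)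
      (fun n => ?_) h3.norm (fun n => ae_of_all _ fun p => ?_) (ae_of_all _ fun p => ?_)).neg
    · exact (hψs n).continuous.aestronglyMeasurable.smul hw.2.1.aestronglyMeasurable
    · simp only [hψ]
      rw [mul_comm, mul_smul, norm_smul, Real.norm_eq_abs, abs_of_nonneg χ.nonneg]
      exact mul_le_of_le_one_left (norm_nonneg _) χ.le_one
    · have := ((hχlim p).const_mul (k p)).smul_const (G p)
      rwa [mul_one] at this
  exact tendsto_nhds_unique lim1
    (lim2.congr fun n => (hw.2.2 (ψ n) (hψs n) (hψc n)).symm)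

section

/-! ### Weights and majorants -/

lemma integral_Ioi_one_add_rpow {r ℓ : ℝ} (hr : r < -1) (hℓ : 0 ≤ ℓ) :
    ∫ a in Ioi ℓ, (1 + a) ^ r = (1 + ℓ) ^ (r + 1) / (-(r + 1)) := by
  have hd (t : ℝ) (ht : t ∈ Ici ℓ) :
      HasDerivAt (fun t => (1 + t) ^ (r + 1) / (r + 1)) ((1 + t) ^ r) t := by
    have ht : 0 < 1 + t := by linarith [mem_Ici.1 ht]
    refine ((((hasDerivAt_id t).const_add 1).rpow_const (Or.inl ht.ne')).div_const
      (r + 1)).congr_deriv ?_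
    rw [add_sub_cancel_right, one_mul, mul_comm, mul_div_assoc,
      div_self (by linarith : r + 1 ≠ 0), mul_one]
    rfl
  have ht : Tendsto (fun t : ℝ => (1 + t) ^ (r + 1) / (r + 1)) atTop (𝓝 (0 / (r + 1))) := by
    apply Tendsto.div_const
    have := (tendsto_rpow_neg_atTop (y := -(r + 1)) (by linarith)).comp
      (tendsto_atTop_add_const_left atTop (1 : ℝ) tendsto_id)
    simpa only [neg_neg, Function.comp_def, id] using this
  have hi : IntegrableOn (fun a : ℝ => (1 + a) ^ r) (Ioi ℓ) := by
    simpa only [add_comm] using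
      integrableOn_add_rpow_Ioi_of_lt (m := 1) hr (by linarith : -1 < ℓ)
  rw [integral_Ioi_of_hasDerivAt_of_tendsto' hd hi ht, zero_div, zero_sub, div_neg]

lemma lintegral_Ioi_one_add_rpow {r ℓ : ℝ} (hr : r < -1) (hℓ : 0 ≤ ℓ) :
    ∫⁻ a in Ioi ℓ, ENNReal.ofReal ((1 + a) ^ r) =
      ENNReal.ofReal ((1 + ℓ) ^ (r + 1) / (-(r + 1))) := by
  have hi : IntegrableOn (fun a : ℝ => (1 + a) ^ r) (Ioi ℓ) := by
    simpa only [add_comm] using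
      integrableOn_add_rpow_Ioi_of_lt (m := 1) hr (by linarith : -1 < ℓ)
  rw [← integral_Ioi_one_add_rpow hr hℓ, ofReal_integral_eq_lintegral_ofReal hi]
  filter_upwards [ae_restrict_mem measurableSet_Ioi] with a ha
  have : 0 ≤ 1 + a := by linarith [mem_Ioi.1 ha]
  exact Real.rpow_nonneg this r

/-- The weight `(1 + r²)⁻¹`. -/
noncomputable def bump (r : ℝ) : ℝ := (1 + r ^ 2)⁻¹

lemma bump_pos (r : ℝ) : 0 < bump r := by unfold bump; positivity

lemma bump_le_one (r : ℝ) : bump r ≤ 1 := by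
  unfold bump; exact inv_le_one_of_one_le₀ (by nlinarith [sq_nonneg r])

@[fun_prop]
lemma continuous_bump : Continuous bump := by
  unfold bump
  exact Continuous.inv₀ (by fun_prop) fun r => by positivity

lemma lintegral_bump (y : ℝ) {c : ℝ} (hc : 0 < c) :
    ∫⁻ b, ENNReal.ofReal (bump ((y - b) / c)) = ENNReal.ofReal (c * Real.pi) := by
  have hi : Integrable bump := integrable_inv_one_add_sq
  have e1 : ∫ b, bump ((y - b) / c) = c * Real.pi := by
    rw [integral_sub_left_eq_self (fun z => bump (z / c)) volume y,
      Measure.integral_comp_div bump c, abs_of_pos hc, smul_eq_mul]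
    exact congrArg _ integral_univ_inv_one_add_sq
  have i1 : Integrable fun b => bump ((y - b) / c) :=
    (hi.comp_div hc.ne').comp_sub_left y
  rw [← e1, ofReal_integral_eq_lintegral_ofReal i1 (ae_of_all _ fun _ => (bump_pos _).le)]

lemma inv_one_add_sq_le_bump {r : ℝ} (hr : 0 ≤ r) : ((1 + r) ^ 2)⁻¹ ≤ bump r := by
  unfold bump; gcongr; nlinarith

/-- Majorant of the kernel for sources on the left. -/
noncomputable def majL (y : ℝ) (p : ℝ × ℝ) : ℝ := (1 + |p.1|)⁻¹ * bump p.1 * bump (y - p.2)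

/-- Majorant of the kernel for sources on the right. -/
noncomputable def majR (y : ℝ) (p : ℝ × ℝ) : ℝ :=
  (1 + p.1) ^ (1 / 4 : ℝ) * bump ((y - p.2) / (1 + p.1))

/-- Right decay and left weighted `L²` bound of a function on the plane. -/
structure SliceBounds (D σ : ℝ) (φ : ℝ × ℝ → ℂ) : Prop where
  aesm : AEStronglyMeasurable φ
  decay : ∀ᵐ p : ℝ × ℝ, 0 < p.1 → ‖φ p‖ ≤ D * (1 + p.1) ^ (-σ)
  left_L2 : eLpNorm (fun p : ℝ × ℝ => (bracket p.1)⁻¹ • φ p) 2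
      (volume.restrict {p : ℝ × ℝ | p.1 < 0}) ≤ ENNReal.ofReal D

lemma one_le_bracket (x : ℝ) : 1 ≤ bracket x := by
  unfold bracket; exact Real.one_le_sqrt.2 (by nlinarith [sq_nonneg x])

lemma bracket_pos (x : ℝ) : 0 < bracket x := one_pos.trans_le (one_le_bracket x)

lemma bracket_le (x : ℝ) : bracket x ≤ 1 + |x| := by
  unfold bracket
  refine Real.sqrt_le_iff.2 ⟨by positivity, ?_⟩
  nlinarith [abs_nonneg x, sq_abs x]

lemma le_two_mul_bracket (x : ℝ) : 1 + |x| ≤ 2 * bracket x := by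
  have h1 := one_le_bracket x
  have : |x| ≤ bracket x := by
    unfold bracket; exact Real.abs_le_sqrt (by linarith)
  linarith

@[fun_prop]
lemma continuous_bracket : Continuous bracket := by unfold bracket; fun_prop

lemma measurable_majL (y : ℝ) : Measurable (majL y) := by
  unfold majL
  have := continuous_bump.measurable
  fun_prop

lemma measurable_majR (y : ℝ) : Measurable (majR y) := by
  unfold majR
  have := continuous_bump.measurable
  fun_prop

lemma lintegral_bump_prod (s y : ℝ) {c d : ℝ} (hc : 0 < c) (hd : 0 < d) :
    ∫⁻ p : ℝ × ℝ, ENNReal.ofReal (bump ((s - p.1) / c) * bump ((y - p.2) / d)) =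
      ENNReal.ofReal (c * d * Real.pi ^ 2) := by
  simp_rw [ENNReal.ofReal_mul (bump_pos _).le]
  have := continuous_bump.measurable
  rw [Measure.volume_eq_prod, lintegral_prod_mul (f := fun a => ENNReal.ofReal (bump ((s - a) / c)))
    (g := fun b => ENNReal.ofReal (bump ((y - b) / d))) (by fun_prop) (by fun_prop),
    lintegral_bump s hc, lintegral_bump y hd, ← ENNReal.ofReal_mul (by positivity)]
  congr 1; ring

variable {D σ : ℝ} {φ : ℝ × ℝ → ℂ}

/-- Cauchy–Schwarz: the factor (1 + |x|)⁻¹ of `majL` supplies the weight of the L² hypothesis, and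
the two bumps form the other L² function. -/
lemma SliceBounds.lintegral_left (h : SliceBounds D σ φ) (y : ℝ) :
    ∫⁻ p in {p : ℝ × ℝ | p.1 < 0}, ENNReal.ofReal (majL y p) * ‖φ p‖ₑ ≤
      ENNReal.ofReal (Real.pi * D) := by
  set ν := (volume : Measure (ℝ × ℝ)).restrict {p : ℝ × ℝ | p.1 < 0}
  set f : ℝ × ℝ → ENNReal := fun p => ENNReal.ofReal (bump p.1 * bump (y - p.2)) with hf
  set g : ℝ × ℝ → ENNReal := fun p => ‖(bracket p.1)⁻¹ • φ p‖ₑ with hg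
  have hfm : AEMeasurable f ν := by
    have := continuous_bump.measurable
    fun_prop
  have hgm : AEMeasurable g ν := by
    have hc : Continuous fun p : ℝ × ℝ => (bracket p.1)⁻¹ :=
      (continuous_bracket.comp continuous_fst).inv₀ fun p => (bracket_pos _).ne'
    exact (hc.aestronglyMeasurable.smul h.aesm.restrict).enorm
  have h1 : ∀ p, ENNReal.ofReal (majL y p) * ‖φ p‖ₑ ≤ f p * g p := by
    intro p
    simp only [hf, hg]
    rw [enorm_smul, Real.enorm_eq_ofReal (inv_nonneg.2 (bracket_pos _).le), ← mul_assoc,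
      ← ENNReal.ofReal_mul (mul_pos (bump_pos _) (bump_pos _)).le]
    gcongr
    have := (bump_pos p.1).le
    have := (bump_pos (y - p.2)).le
    calc majL y p = bump p.1 * bump (y - p.2) * (1 + |p.1|)⁻¹ := by unfold majL; ring
      _ ≤ _ := by
        gcongr
        · exact bracket_pos _
        · exact bracket_le _
  have h2 : ∫⁻ p, f p ^ (2 : ℝ) ∂ν ≤ ENNReal.ofReal (Real.pi ^ 2) := by
    calc ∫⁻ p, f p ^ (2 : ℝ) ∂ν ≤ ∫⁻ p, f p := by
          refine (lintegral_mono fun p => ?_).trans (setLIntegral_le_lintegral _ _)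
          have : f p ≤ 1 := by
            simp only [hf]
            rw [ENNReal.ofReal_le_one]
            exact mul_le_one₀ (bump_le_one _) (bump_pos _).le (bump_le_one _)
          calc f p ^ (2 : ℝ) ≤ f p ^ (1 : ℝ) :=
                ENNReal.rpow_le_rpow_of_exponent_ge this (by norm_num)
            _ = f p := ENNReal.rpow_one _
      _ = ENNReal.ofReal (Real.pi ^ 2) := by
          have h := lintegral_bump_prod 0 y one_pos one_pos
          simp only [div_one, zero_sub, one_mul] at h
          rw [← h]
          congr 1
          funext p
          simp only [hf, bump, neg_sq]
  calc ∫⁻ p, ENNReal.ofReal (majL y p) * ‖φ p‖ₑ ∂ν ≤ ∫⁻ p, (f * g) p ∂ν := lintegral_mono h1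
    _ ≤ (∫⁻ p, f p ^ (2 : ℝ) ∂ν) ^ (1 / 2 : ℝ) * (∫⁻ p, g p ^ (2 : ℝ) ∂ν) ^ (1 / 2 : ℝ) :=
        ENNReal.lintegral_mul_le_Lp_mul_Lq ν Real.HolderConjugate.two_two hfm hgm
    _ ≤ ENNReal.ofReal (Real.pi ^ 2) ^ (1 / 2 : ℝ) * ENNReal.ofReal D := by
        gcongr
        have := h.left_L2
        rw [eLpNorm_eq_lintegral_rpow_enorm_toReal two_ne_zero ENNReal.ofNat_ne_top] at this
        simpa only [ENNReal.toReal_ofNat] using this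
    _ = ENNReal.ofReal (Real.pi * D) := by
        rw [ENNReal.ofReal_rpow_of_nonneg (by positivity) (by norm_num), ← Real.sqrt_eq_rpow,
          Real.sqrt_sq Real.pi_pos.le, ← ENNReal.ofReal_mul Real.pi_pos.le]

lemma SliceBounds.enorm_le (h : SliceBounds D σ φ) :
    ∀ᵐ p : ℝ × ℝ, 0 < p.1 → ‖φ p‖ₑ ≤ ENNReal.ofReal (D * (1 + p.1) ^ (-σ)) := by
  filter_upwards [h.decay] with p hp h0
  rw [← ofReal_norm]
  exact ENNReal.ofReal_le_ofReal (hp h0)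

/-- Integrating the bump in y costs a width 1 + a, so (1 + a)^(5/4 − σ) remains to be integrated
over a > ℓ. This is where σ > 9/4 is needed. -/
lemma SliceBounds.lintegral_right (h : SliceBounds D σ φ) (hD : 0 ≤ D) (hσ : 9 / 4 < σ) {ℓ : ℝ}
    (hℓ : 0 ≤ ℓ) (y : ℝ) :
    ∫⁻ p in {p : ℝ × ℝ | ℓ < p.1}, ENNReal.ofReal (majR y p) * ‖φ p‖ₑ ≤
      ENNReal.ofReal (D * Real.pi * ((1 + ℓ) ^ (9 / 4 - σ) / (σ - 9 / 4))) := by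
  have hset : {p : ℝ × ℝ | ℓ < p.1} = Ioi ℓ ×ˢ univ := by ext p; simp
  have hms : MeasurableSet {p : ℝ × ℝ | ℓ < p.1} := measurableSet_lt measurable_const measurable_fst
  have hbm := continuous_bump.measurable
  calc ∫⁻ p in {p : ℝ × ℝ | ℓ < p.1}, ENNReal.ofReal (majR y p) * ‖φ p‖ₑ
      ≤ ∫⁻ p in {p : ℝ × ℝ | ℓ < p.1}, ENNReal.ofReal
        (D * (1 + p.1) ^ (1 / 4 - σ)) * ENNReal.ofReal (bump ((y - p.2) / (1 + p.1))) := by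
        refine lintegral_mono_ae ?_
        filter_upwards [ae_restrict_mem hms, ae_restrict_of_ae h.enorm_le] with p hp h1
        have hp : ℓ < p.1 := hp
        have hpos : 0 < 1 + p.1 := by linarith
        refine (mul_le_mul_right (h1 (by linarith)) _).trans_eq ?_
        rw [← ENNReal.ofReal_mul' (by positivity), ← ENNReal.ofReal_mul' (bump_pos _).le]
        congr 1
        rw [majR, sub_eq_add_neg (1 / 4 : ℝ), Real.rpow_add hpos]
        ring
    _ = ∫⁻ a in Ioi ℓ, ENNReal.ofReal (D * Real.pi) * ENNReal.ofReal ((1 + a) ^ (5 / 4 - σ)) := by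
        rw [hset, Measure.volume_eq_prod, ← Measure.prod_restrict, Measure.restrict_univ,
          lintegral_prod _ (by fun_prop)]
        refine setLIntegral_congr_fun measurableSet_Ioi fun a ha => ?_
        have hpos : 0 < 1 + a := by linarith [mem_Ioi.1 ha]
        simp only
        rw [lintegral_const_mul _ (by fun_prop), lintegral_bump y hpos,
          ← ENNReal.ofReal_mul (by positivity), ← ENNReal.ofReal_mul (by positivity)]
        congr 1
        rw [show 5 / 4 - σ = (1 / 4 - σ) + 1 by ring, Real.rpow_add_one hpos.ne']
        ring
    _ = _ := by
        rw [lintegral_const_mul _ (by fun_prop), lintegral_Ioi_one_add_rpow (by linarith) hℓ,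
          ← ENNReal.ofReal_mul (by positivity)]
        congr 2
        rw [show 5 / 4 - σ + 1 = 9 / 4 - σ by ring, neg_sub]

end

section

/-! ### Bounds for convolution with an Airy kernel -/

/-- Converts decay in the rescaled distance L/μ into decay in L with constants independent of the
time μ³. -/
lemma one_add_le_sq_of_cube_le {μ L : ℝ} (hμ : 0 < μ) (hL : μ ^ 3 ≤ L) :
    1 + L ≤ (1 + L / μ) ^ 2 := by
  have hL0 : 0 < L := (pow_pos hμ 3).trans_le hL
  have h1 : (1 + L / μ) ^ 2 = 1 + 2 * (L / μ) + (L / μ) ^ 2 := by ring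
  have h0 : 0 < L / μ := by positivity
  rw [h1]
  rcases le_total μ 1 with h | h
  · have : L ≤ L / μ := by rw [le_div_iff₀ hμ]; nlinarith
    nlinarith
  · have : L ≤ (L / μ) ^ 2 := by
      rw [div_pow, le_div_iff₀ (by positivity), sq L]
      have : μ ^ 2 ≤ L := le_trans (pow_le_pow_right₀ h (by norm_num)) hL
      nlinarith
    nlinarith

lemma le_one_add_of_cube_le {μ ℓ : ℝ} (hμ : 0 < μ) (hL : μ ^ 3 ≤ ℓ) : μ ≤ 1 + ℓ := by
  nlinarith [sq_nonneg (μ - 1), mul_nonneg hμ.le (sq_nonneg (μ - 1))]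

variable {κ : ℝ → ℝ → ℝ}

/-- For a source on the left the distance L = ℓ − x' + |y − y'| is at least μ³, so 2(n + 5) powers
of 1 + L/μ give n + 5 powers of 1 + L. Of these, n go to ℓ, one to the weight and two to each bump.
-/
lemma IsAiryKernel.exists_le_majL (hκ : IsAiryKernel κ) (n : ℕ) :
    ∃ C, 0 < C ∧ ∀ μ ℓ y : ℝ, ∀ p : ℝ × ℝ, 0 < μ → μ ^ 3 ≤ ℓ → p.1 < 0 →
      |κ ((ℓ - p.1) / μ) ((y - p.2) / μ)| ≤ C / (1 + ℓ) ^ n * majL y p := by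
  obtain ⟨C, hC, h⟩ := hκ.right (2 * (n + 5))
  refine ⟨C, hC, fun μ ℓ y p hμ hℓ hp => ?_⟩
  have hℓ0 : 0 < ℓ := (pow_pos hμ 3).trans_le hℓ
  have hb := h ((ℓ - p.1) / μ) ((y - p.2) / μ) (div_nonneg (by linarith) hμ.le)
  set L := ℓ - p.1 + |y - p.2| with hLdef
  have ha : |p.1| = -p.1 := abs_of_neg hp
  have hL : μ ^ 3 ≤ L := by linarith [abs_nonneg (y - p.2)]
  have hsq := one_add_le_sq_of_cube_le hμ hL
  have hy0 := abs_nonneg (y - p.2)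
  have e : 1 + (ℓ - p.1) / μ + |(y - p.2) / μ| = 1 + L / μ := by
    rw [abs_div, abs_of_pos hμ, hLdef]; ring
  rw [e, pow_mul] at hb
  refine hb.trans ?_
  have key : (1 + ℓ) ^ n * ((1 + |p.1|) * (1 + p.1 ^ 2) * (1 + (y - p.2) ^ 2)) ≤
      ((1 + L / μ) ^ 2) ^ (n + 5) := by
    have h1 : 1 + ℓ ≤ 1 + L := by linarith
    have h2 : 1 + |p.1| ≤ 1 + L := by rw [ha]; linarith
    have h3 : 1 + p.1 ^ 2 ≤ (1 + L) ^ 2 := by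
      rw [← sq_abs]; nlinarith [abs_nonneg p.1]
    have h4 : 1 + (y - p.2) ^ 2 ≤ (1 + L) ^ 2 := by
      rw [← sq_abs]; nlinarith [abs_nonneg p.1]
    have hL1 : 0 ≤ 1 + L := by linarith [abs_nonneg p.1]
    calc _ ≤ (1 + L) ^ n * ((1 + L) * (1 + L) ^ 2 * (1 + L) ^ 2) := by gcongr
      _ = (1 + L) ^ (n + 5) := by ring
      _ ≤ _ := by gcongr
  calc C / ((1 + L / μ) ^ 2) ^ (n + 5)
      ≤ C / ((1 + ℓ) ^ n * ((1 + |p.1|) * (1 + p.1 ^ 2) * (1 + (y - p.2) ^ 2))) := by gcongr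
    _ = _ := by
      unfold majL bump
      field_simp

/-- Since μ ≤ 1 + ℓ, the rescaled distance satisfies 1 + (x' − ℓ)/μ ≤ (1 + x')/μ. Its 1/4 power
produces μ^(−1/4), and the localization to the cone becomes a bump of width 1 + x'. -/
lemma IsAiryKernel.exists_le_majR (hκ : IsAiryKernel κ) :
    ∃ C, 0 < C ∧ ∀ μ ℓ y : ℝ, ∀ p : ℝ × ℝ, 0 < μ → μ ^ 3 ≤ ℓ → ℓ ≤ p.1 →
      |κ ((ℓ - p.1) / μ) ((y - p.2) / μ)| ≤ C * μ ^ (-(1 / 4) : ℝ) * majR y p := by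
  obtain ⟨C, hC, h⟩ := hκ.left
  refine ⟨C, hC, fun μ ℓ y p hμ hℓ hp => ?_⟩
  have hℓ0 : 0 < ℓ := (pow_pos hμ 3).trans_le hℓ
  have hb := h ((ℓ - p.1) / μ) ((y - p.2) / μ) (div_nonpos_of_nonpos_of_nonneg (by linarith) hμ.le)
  refine hb.trans ?_
  have ha : |(ℓ - p.1) / μ| = (p.1 - ℓ) / μ := by
    rw [abs_div, abs_of_pos hμ, abs_of_nonpos (by linarith)]; ring
  have hm := le_one_add_of_cube_le hμ hℓ
  have hs : 0 < 1 + p.1 := by linarith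
  have hX : 1 + (p.1 - ℓ) / μ ≤ (1 + p.1) / μ := by
    rw [le_div_iff₀ hμ, add_mul, div_mul_cancel₀ _ hμ.ne']; linarith
  have hX0 : 0 < 1 + (p.1 - ℓ) / μ := by
    have : 0 ≤ (p.1 - ℓ) / μ := div_nonneg (by linarith) hμ.le
    linarith
  rw [ha, abs_div, abs_of_pos hμ]
  set X := 1 + (p.1 - ℓ) / μ
  have r1 : X ^ (1 / 4 : ℝ) ≤ μ ^ (-(1 / 4) : ℝ) * (1 + p.1) ^ (1 / 4 : ℝ) := by
    calc X ^ (1 / 4 : ℝ) ≤ ((1 + p.1) / μ) ^ (1 / 4 : ℝ) := by gcongr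
      _ = _ := by
        rw [Real.div_rpow hs.le hμ.le, Real.rpow_neg hμ.le]; ring
  have r2 : (X / (X + |y - p.2| / μ)) ^ 2 ≤ bump ((y - p.2) / (1 + p.1)) := by
    have h0 := abs_nonneg (y - p.2)
    have h1 : X / (X + |y - p.2| / μ) ≤ (1 + |y - p.2| / (1 + p.1))⁻¹ := by
      rw [← one_div, div_le_div_iff₀ (by positivity) (by positivity), one_mul, mul_add, mul_one]
      gcongr
      rw [← mul_div_assoc, div_le_div_iff₀ hs hμ, mul_assoc, mul_comm]
      have := (le_div_iff₀ hμ).1 hX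
      nlinarith
    calc _ ≤ ((1 + |y - p.2| / (1 + p.1))⁻¹) ^ 2 := by gcongr
      _ ≤ bump (|y - p.2| / (1 + p.1)) := by
        rw [inv_pow]; exact inv_one_add_sq_le_bump (by positivity)
      _ = _ := by simp only [bump, div_pow, sq_abs]
  calc _ ≤ C * (μ ^ (-(1 / 4) : ℝ) * (1 + p.1) ^ (1 / 4 : ℝ)) *
        bump ((y - p.2) / (1 + p.1)) := by gcongr
    _ = _ := by unfold majR; ring

lemma IsAiryKernel.exists_le_bump (hκ : IsAiryKernel κ) (n : ℕ) :
    ∃ C, 0 < C ∧ ∀ μ ℓ y : ℝ, ∀ p : ℝ × ℝ, 0 < μ → p.1 ≤ ℓ →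
      |κ ((ℓ - p.1) / μ) ((y - p.2) / μ)| ≤ C / (1 + (ℓ - p.1) / μ) ^ n *
        (bump ((ℓ - p.1) / μ) * bump ((y - p.2) / μ)) := by
  obtain ⟨C, hC, h⟩ := hκ.right (n + 4)
  refine ⟨C, hC, fun μ ℓ y p hμ hp => ?_⟩
  have hX : 0 ≤ (ℓ - p.1) / μ := div_nonneg (by linarith) hμ.le
  refine (h ((ℓ - p.1) / μ) ((y - p.2) / μ) hX).trans ?_
  set X := (ℓ - p.1) / μ
  set Y := (y - p.2) / μ
  have hY := abs_nonneg Y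
  calc C / (1 + X + |Y|) ^ (n + 4)
      ≤ C / ((1 + X) ^ n * ((1 + X ^ 2) * (1 + Y ^ 2))) := by
        rw [pow_add]
        have h1 : 1 + X ≤ 1 + X + |Y| := by linarith
        have h2 : (1 + X ^ 2) * (1 + Y ^ 2) ≤ (1 + X + |Y|) ^ 4 := by
          calc (1 + X ^ 2) * (1 + Y ^ 2) ≤ (1 + X + |Y|) ^ 2 * (1 + X + |Y|) ^ 2 := by
                rw [← sq_abs Y]
                gcongr <;> nlinarith
            _ = _ := by ring
        gcongr
    _ = _ := by unfold bump; field_simp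

/-- Either the source satisfies a ≥ ℓ/2, or it lies at distance at least ℓ/2, where the kernel
variable controls 1 + ℓ. -/
lemma one_add_le_four_mul {μ ℓ a : ℝ} (hμ : 0 < μ) (hℓ : μ ^ 3 ≤ ℓ) (ha : 0 ≤ a) (haℓ : a ≤ ℓ) :
    1 + ℓ ≤ 4 * ((1 + a) * (1 + (ℓ - a) / μ) ^ 2) := by
  have hℓ0 : 0 < ℓ := (pow_pos hμ 3).trans_le hℓ
  have hX : 0 ≤ (ℓ - a) / μ := div_nonneg (by linarith) hμ.le
  have h1 : 1 ≤ (1 + (ℓ - a) / μ) ^ 2 := by nlinarith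
  rcases le_total (ℓ / 2) a with h | h
  · nlinarith
  · have h2 := one_add_le_sq_of_cube_le hμ hℓ
    have h3 : ℓ / μ ≤ 2 * ((ℓ - a) / μ) := by
      rw [← mul_div_assoc]; gcongr; linarith
    have h4 : 0 < ℓ / μ := by positivity
    have h5 : (1 + ℓ / μ) ^ 2 ≤ 4 * (1 + (ℓ - a) / μ) ^ 2 := by nlinarith
    nlinarith

variable {D σ : ℝ} {φ : ℝ × ℝ → ℂ}

/-- Whatever decay the source loses by lying to the left of ℓ is recovered from the rapid decay of
the kernel. The two bumps at scale μ integrate to a multiple of μ². -/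
lemma IsAiryKernel.exists_lintegral_middle (hκ : IsAiryKernel κ) (hσ : 9 / 4 < σ) :
    ∃ C, 0 < C ∧ ∀ (D μ ℓ y : ℝ) (φ : ℝ × ℝ → ℂ), 0 ≤ D → 0 < μ → μ ^ 3 ≤ ℓ →
      SliceBounds D σ φ →
      ∫⁻ p in {p : ℝ × ℝ | 0 < p.1 ∧ p.1 ≤ ℓ},
        ‖κ ((ℓ - p.1) / μ) ((y - p.2) / μ)‖ₑ * ‖φ p‖ₑ ≤
      ENNReal.ofReal (C * D * μ ^ 2 * (1 + ℓ) ^ (-σ)) := by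
  obtain ⟨C, hC, hb⟩ := hκ.exists_le_bump (2 * ⌈σ⌉₊)
  have hσ0 : 0 < σ := by linarith
  refine ⟨C * 4 ^ σ * Real.pi ^ 2, by positivity, fun D μ ℓ y φ hD hμ hℓ h => ?_⟩
  have hℓ0 : 0 < ℓ := (pow_pos hμ 3).trans_le hℓ
  have hms : MeasurableSet {p : ℝ × ℝ | 0 < p.1 ∧ p.1 ≤ ℓ} :=
    (measurableSet_lt measurable_const measurable_fst).inter
      (measurableSet_le measurable_fst measurable_const)
  have hbm := continuous_bump.measurable
  set E : ℝ := C * 4 ^ σ * D * (1 + ℓ) ^ (-σ) with hE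
  have hE0 : 0 ≤ E := by positivity
  calc _ ≤ ∫⁻ p in {p : ℝ × ℝ | 0 < p.1 ∧ p.1 ≤ ℓ}, ENNReal.ofReal E *
        ENNReal.ofReal (bump ((ℓ - p.1) / μ) * bump ((y - p.2) / μ)) := by
        refine lintegral_mono_ae ?_
        filter_upwards [ae_restrict_mem hms, ae_restrict_of_ae h.decay] with p hp h1
        obtain ⟨hp0, hpℓ⟩ := hp
        rw [← ofReal_norm, ← ofReal_norm, ← ENNReal.ofReal_mul (norm_nonneg _),
          ← ENNReal.ofReal_mul hE0]
        apply ENNReal.ofReal_le_ofReal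
        have hX : 0 ≤ (ℓ - p.1) / μ := div_nonneg (by linarith) hμ.le
        have h2 := hb μ ℓ y p hμ hpℓ
        have h4 : 0 < bump ((ℓ - p.1) / μ) * bump ((y - p.2) / μ) :=
          mul_pos (bump_pos _) (bump_pos _)
        set B := bump ((ℓ - p.1) / μ) * bump ((y - p.2) / μ)
        have h3 : (1 + p.1) ^ (-σ) ≤
            4 ^ σ * (1 + ℓ) ^ (-σ) * (1 + (ℓ - p.1) / μ) ^ (2 * ⌈σ⌉₊) := by
          have k1 : (1 + ℓ) ^ σ ≤ 4 ^ σ * ((1 + p.1) ^ σ *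
              (1 + (ℓ - p.1) / μ) ^ (2 * ⌈σ⌉₊)) := by
            calc (1 + ℓ) ^ σ ≤ (4 * ((1 + p.1) * (1 + (ℓ - p.1) / μ) ^ 2)) ^ σ := by
                  gcongr; exact one_add_le_four_mul hμ hℓ hp0.le hpℓ
              _ = 4 ^ σ * ((1 + p.1) ^ σ * ((1 + (ℓ - p.1) / μ) ^ 2) ^ σ) := by
                  rw [Real.mul_rpow (by norm_num) (by positivity),
                    Real.mul_rpow (by positivity) (by positivity)]
              _ ≤ _ := by
                  gcongr
                  rw [pow_mul, ← Real.rpow_natCast _ ⌈σ⌉₊]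
                  exact Real.rpow_le_rpow_of_exponent_le (by nlinarith) (Nat.le_ceil σ)
          rw [Real.rpow_neg (by positivity), Real.rpow_neg (by positivity),
            inv_le_iff_one_le_mul₀ (by positivity)]
          calc (1 : ℝ) = ((1 + ℓ) ^ σ)⁻¹ * (1 + ℓ) ^ σ :=
                (inv_mul_cancel₀ (by positivity)).symm
            _ ≤ ((1 + ℓ) ^ σ)⁻¹ * (4 ^ σ * ((1 + p.1) ^ σ *
              (1 + (ℓ - p.1) / μ) ^ (2 * ⌈σ⌉₊))) := by gcongr
            _ = _ := by ring
        calc _ ≤ C / (1 + (ℓ - p.1) / μ) ^ (2 * ⌈σ⌉₊) * B * (D * (4 ^ σ * (1 + ℓ) ^ (-σ) *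
              (1 + (ℓ - p.1) / μ) ^ (2 * ⌈σ⌉₊))) :=
              mul_le_mul h2 ((h1 hp0).trans (by gcongr)) (norm_nonneg _) (by positivity)
          _ = _ := by
            have hP : 1 + (ℓ - p.1) / μ ≠ 0 := by positivity
            rw [hE]
            generalize 1 + (ℓ - p.1) / μ = Q at hP
            field_simp
    _ ≤ ENNReal.ofReal E * ENNReal.ofReal (μ * μ * Real.pi ^ 2) := by
        rw [← lintegral_bump_prod ℓ y hμ hμ, lintegral_const_mul _ (by fun_prop)]
        gcongr
        exact Measure.restrict_le_self
    _ = _ := by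
        rw [← ENNReal.ofReal_mul hE0, hE]; congr 1; ring

lemma lintegral_le_left_add_right (f : ℝ × ℝ → ENNReal) :
    ∫⁻ p, f p ≤ (∫⁻ p in {p : ℝ × ℝ | p.1 < 0}, f p) + ∫⁻ p in {p : ℝ × ℝ | 0 < p.1}, f p := by
  have h0 : (volume : Measure (ℝ × ℝ)) {p : ℝ × ℝ | p.1 = 0} = 0 := by
    have : {p : ℝ × ℝ | p.1 = 0} = {0} ×ˢ univ := by ext p; simp
    rw [this, Measure.volume_eq_prod, Measure.prod_prod]
    simp
  have hu : (univ : Set (ℝ × ℝ)) ⊆ {p | p.1 = 0} ∪ ({p | p.1 < 0} ∪ {p | 0 < p.1}) := by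
    intro p _
    rcases lt_trichotomy p.1 0 with h | h | h
    · exact Or.inr (Or.inl h)
    · exact Or.inl h
    · exact Or.inr (Or.inr h)
  calc ∫⁻ p, f p = ∫⁻ p in univ, f p := by rw [Measure.restrict_univ]
    _ ≤ ∫⁻ p in {p | p.1 = 0} ∪ ({p | p.1 < 0} ∪ {p | 0 < p.1}), f p := lintegral_mono_set hu
    _ ≤ (∫⁻ p in {p | p.1 = 0}, f p) + ∫⁻ p in {p | p.1 < 0} ∪ {p | 0 < p.1}, f p :=
        lintegral_union_le _ _ _
    _ ≤ 0 + ((∫⁻ p in {p : ℝ × ℝ | p.1 < 0}, f p) + ∫⁻ p in {p : ℝ × ℝ | 0 < p.1}, f p) := by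
        rw [setLIntegral_measure_zero _ _ h0]
        gcongr
        exact lintegral_union_le _ _ _
    _ = _ := zero_add _

/-- The quantitative bound for convolution of an Airy kernel at scale `μ` with a function that
decays on the right. -/
lemma IsAiryKernel.exists_lintegral_le (hκ : IsAiryKernel κ) (hσ : 9 / 4 < σ) :
    ∃ C, 0 < C ∧ ∀ (D μ ℓ y : ℝ) (φ : ℝ × ℝ → ℂ), 0 ≤ D → 0 < μ → μ ^ 3 ≤ ℓ →
      SliceBounds D σ φ →
      ∫⁻ p, ‖κ ((ℓ - p.1) / μ) ((y - p.2) / μ)‖ₑ * ‖φ p‖ₑ ≤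
        ENNReal.ofReal (C * D * μ ^ (-(1 / 4) : ℝ) * (1 + ℓ) ^ (9 / 4 - σ)) := by
  obtain ⟨CL, hCL, hL⟩ := hκ.exists_le_majL ⌈σ⌉₊
  obtain ⟨CM, hCM, hM⟩ := hκ.exists_lintegral_middle hσ
  obtain ⟨CR, hCR, hR⟩ := hκ.exists_le_majR
  have hσ' : 0 < σ - 9 / 4 := by linarith
  refine ⟨CL * Real.pi + (CM + CR * (Real.pi / (σ - 9 / 4))), by positivity,
    fun D μ ℓ y φ hD hμ hℓ h => ?_⟩
  have hℓ0 : 0 < ℓ := (pow_pos hμ 3).trans_le hℓ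
  have hm := le_one_add_of_cube_le hμ hℓ
  set T : ℝ := μ ^ (-(1 / 4) : ℝ) * (1 + ℓ) ^ (9 / 4 - σ) with hT
  have hT0 : 0 < T := by positivity
  -- Because μ ≤ 1 + ℓ, the left (r = 0) and middle (r = 2) contributions are no larger than the
  -- right one.
  have hTa : ∀ r : ℝ, 0 ≤ r → r ≤ 2 → μ ^ r * (1 + ℓ) ^ (-σ) ≤ T := by
    intro r hr0 hr2
    calc μ ^ r * (1 + ℓ) ^ (-σ) = μ ^ (-(1 / 4) : ℝ) * (μ ^ (r + 1 / 4) * (1 + ℓ) ^ (-σ)) := by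
          rw [← mul_assoc, ← Real.rpow_add hμ]; congr 2; ring
      _ ≤ μ ^ (-(1 / 4) : ℝ) * ((1 + ℓ) ^ (9 / 4 : ℝ) * (1 + ℓ) ^ (-σ)) := by
          gcongr
          calc μ ^ (r + 1 / 4) ≤ (1 + ℓ) ^ (r + 1 / 4) := by gcongr
            _ ≤ _ := Real.rpow_le_rpow_of_exponent_le (by linarith) (by linarith)
      _ = T := by rw [hT, ← Real.rpow_add (by positivity)]; rfl
  have left : ∫⁻ p in {p : ℝ × ℝ | p.1 < 0}, ‖κ ((ℓ - p.1) / μ) ((y - p.2) / μ)‖ₑ * ‖φ p‖ₑ ≤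
      ENNReal.ofReal (CL * Real.pi * D * T) := by
    have hms : MeasurableSet {p : ℝ × ℝ | p.1 < 0} :=
      measurableSet_lt measurable_fst measurable_const
    calc _ ≤ ∫⁻ p in {p : ℝ × ℝ | p.1 < 0}, ENNReal.ofReal (CL / (1 + ℓ) ^ ⌈σ⌉₊) *
          (ENNReal.ofReal (majL y p) * ‖φ p‖ₑ) := by
          refine setLIntegral_mono' hms fun p hp => ?_
          rw [← mul_assoc, ← ENNReal.ofReal_mul (by positivity)]
          gcongr
          rw [← ofReal_norm]
          exact ENNReal.ofReal_le_ofReal (hL μ ℓ y p hμ hℓ hp)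
      _ ≤ ENNReal.ofReal (CL / (1 + ℓ) ^ ⌈σ⌉₊) * ENNReal.ofReal (Real.pi * D) := by
          rw [lintegral_const_mul' _ _ ENNReal.ofReal_ne_top]
          gcongr
          exact h.lintegral_left y
      _ ≤ _ := by
          rw [← ENNReal.ofReal_mul (by positivity)]
          apply ENNReal.ofReal_le_ofReal
          have : ((1 + ℓ) ^ ⌈σ⌉₊)⁻¹ ≤ T := by
            refine le_trans ?_ (hTa 0 le_rfl (by norm_num))
            rw [Real.rpow_zero, one_mul, Real.rpow_neg (by positivity)]
            gcongr
            rw [← Real.rpow_natCast]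
            exact Real.rpow_le_rpow_of_exponent_le (by linarith) (Nat.le_ceil σ)
          have hp := Real.pi_pos
          calc _ = CL * Real.pi * D * ((1 + ℓ) ^ ⌈σ⌉₊)⁻¹ := by ring
            _ ≤ _ := by gcongr
  have middle := hM D μ ℓ y φ hD hμ hℓ h
  have right : ∫⁻ p in {p : ℝ × ℝ | ℓ < p.1}, ‖κ ((ℓ - p.1) / μ) ((y - p.2) / μ)‖ₑ * ‖φ p‖ₑ ≤
      ENNReal.ofReal (CR * (Real.pi / (σ - 9 / 4)) * D * T) := by
    have hms : MeasurableSet {p : ℝ × ℝ | ℓ < p.1} :=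
      measurableSet_lt measurable_const measurable_fst
    calc _ ≤ ∫⁻ p in {p : ℝ × ℝ | ℓ < p.1}, ENNReal.ofReal (CR * μ ^ (-(1 / 4) : ℝ)) *
          (ENNReal.ofReal (majR y p) * ‖φ p‖ₑ) := by
          refine setLIntegral_mono' hms fun p hp => ?_
          have hp : ℓ < p.1 := hp
          rw [← mul_assoc, ← ENNReal.ofReal_mul (by positivity)]
          gcongr
          rw [← ofReal_norm]
          exact ENNReal.ofReal_le_ofReal (hR μ ℓ y p hμ hℓ hp.le)
      _ ≤ ENNReal.ofReal (CR * μ ^ (-(1 / 4) : ℝ)) *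
          ENNReal.ofReal (D * Real.pi * ((1 + ℓ) ^ (9 / 4 - σ) / (σ - 9 / 4))) := by
          rw [lintegral_const_mul' _ _ ENNReal.ofReal_ne_top]
          gcongr
          exact h.lintegral_right hD hσ hℓ0.le y
      _ = _ := by
          rw [← ENNReal.ofReal_mul (by positivity), hT]
          congr 1; ring
  refine (lintegral_le_left_add_right _).trans ?_
  have hsplit : {p : ℝ × ℝ | 0 < p.1} ⊆ {p | 0 < p.1 ∧ p.1 ≤ ℓ} ∪ {p | ℓ < p.1} := by
    intro p hp
    rcases le_or_gt p.1 ℓ with h1 | h1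
    · exact Or.inl ⟨hp, h1⟩
    · exact Or.inr h1
  have hp := Real.pi_pos
  calc _ ≤ ENNReal.ofReal (CL * Real.pi * D * T) +
        (ENNReal.ofReal (CM * D * T) + ENNReal.ofReal (CR * (Real.pi / (σ - 9 / 4)) * D * T)) := by
        refine add_le_add left ((lintegral_mono_set hsplit).trans
          ((lintegral_union_le _ _ _).trans (add_le_add (middle.trans ?_) right)))
        apply ENNReal.ofReal_le_ofReal
        have := hTa 2 (by norm_num) le_rfl
        rw [Real.rpow_two] at this
        calc _ = CM * D * (μ ^ 2 * (1 + ℓ) ^ (-σ)) := by ring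
          _ ≤ _ := by gcongr
    _ = _ := by
        rw [← ENNReal.ofReal_add (by positivity) (by positivity),
          ← ENNReal.ofReal_add (by positivity) (by positivity)]
        congr 1
        rw [hT]; ring

/-- The majorant of all translates of the kernel. -/
noncomputable def maj (y : ℝ) (p : ℝ × ℝ) : ℝ := if p.1 < 0 then majL y p else majR y p

/-- Domination uniform in ℓ at fixed time, for differentiating under the integral in x. The constant
may depend on μ here, unlike in the quantitative bounds. -/
lemma IsAiryKernel.exists_le_maj (hκ : IsAiryKernel κ) {μ : ℝ} (hμ : 0 < μ) :
    ∃ C, 0 < C ∧ ∀ ℓ y : ℝ, ∀ p : ℝ × ℝ, μ ^ 3 ≤ ℓ →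
      |κ ((ℓ - p.1) / μ) ((y - p.2) / μ)| ≤ C * maj y p := by
  obtain ⟨CL, hCL, hL⟩ := hκ.exists_le_majL 0
  obtain ⟨CM, hCM, hM⟩ := hκ.exists_le_bump 0
  obtain ⟨CR, hCR, hR⟩ := hκ.exists_le_majR
  refine ⟨CL + (CM * (1 + μ ^ 2) + CR * μ ^ (-(1 / 4) : ℝ)), by positivity, fun ℓ y p hℓ => ?_⟩
  have hR0 : 0 < CR * μ ^ (-(1 / 4) : ℝ) := by positivity
  have hM0 : 0 < CM * (1 + μ ^ 2) := by positivity
  unfold maj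
  split_ifs with hp
  · have h0 : 0 ≤ majL y p :=
      mul_nonneg (mul_nonneg (by positivity) (bump_pos _).le) (bump_pos _).le
    have := hL μ ℓ y p hμ hℓ hp
    rw [pow_zero, div_one] at this
    exact this.trans (by gcongr; linarith)
  · have hp : 0 ≤ p.1 := not_lt.1 hp
    have h0 : 0 ≤ majR y p := mul_nonneg (by positivity) (bump_pos _).le
    rcases le_total ℓ p.1 with h | h
    · exact (hR μ ℓ y p hμ hℓ h).trans (by gcongr; linarith)
    · have h1 := hM μ ℓ y p hμ h
      rw [pow_zero, div_one] at h1
      have h2 : bump ((y - p.2) / μ) ≤ (1 + μ ^ 2) * majR y p := by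
        have h3 : bump ((y - p.2) / μ) ≤ (1 + μ ^ 2) * bump ((y - p.2) / (1 + p.1)) := by
          unfold bump
          rw [← div_eq_mul_inv, ← one_div, div_le_div_iff₀ (by positivity) (by positivity), one_mul]
          have : ((y - p.2) / (1 + p.1)) ^ 2 ≤ (y - p.2) ^ 2 := by
            rw [div_pow]
            exact div_le_self (sq_nonneg _) (by nlinarith)
          have e : (1 + μ ^ 2) * (1 + ((y - p.2) / μ) ^ 2) =
              1 + μ ^ 2 + (y - p.2) ^ 2 + ((y - p.2) / μ) ^ 2 := by
            field_simp
            ring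
          rw [e]
          nlinarith [sq_nonneg ((y - p.2) / μ), sq_nonneg μ]
        refine h3.trans ?_
        gcongr
        exact le_mul_of_one_le_left (bump_pos _).le
          (Real.one_le_rpow (by linarith) (by norm_num))
      calc _ ≤ CM * (1 * bump ((y - p.2) / μ)) := h1.trans (by
            have := (bump_pos ((y - p.2) / μ)).le
            gcongr; exact bump_le_one _)
        _ ≤ CM * ((1 + μ ^ 2) * majR y p) := by rw [one_mul]; gcongr
        _ ≤ _ := by rw [← mul_assoc]; gcongr; linarith

lemma measurable_maj (y : ℝ) : Measurable (maj y) :=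
  Measurable.ite (measurableSet_lt measurable_fst measurable_const) (measurable_majL y)
    (measurable_majR y)

lemma maj_nonneg (y : ℝ) (p : ℝ × ℝ) : 0 ≤ maj y p := by
  unfold maj
  split_ifs with hp
  · exact mul_nonneg (mul_nonneg (by positivity) (bump_pos _).le) (bump_pos _).le
  · have hp : 0 ≤ p.1 := not_lt.1 hp
    exact mul_nonneg (by positivity) (bump_pos _).le

lemma SliceBounds.integrable_maj (h : SliceBounds D σ φ) (hD : 0 ≤ D) (hσ : 9 / 4 < σ) (y : ℝ) :
    Integrable fun p => maj y p * ‖φ p‖ := by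
  refine ⟨(measurable_maj y).aestronglyMeasurable.mul h.aesm.norm, ?_⟩
  refine (lintegral_le_left_add_right _).trans_lt (ENNReal.add_lt_top.2 ⟨?_, ?_⟩)
  · refine lt_of_le_of_lt ?_ ((h.lintegral_left y).trans_lt ENNReal.ofReal_lt_top)
    refine setLIntegral_mono' (measurableSet_lt measurable_fst measurable_const) fun p hp => ?_
    rw [enorm_mul, enorm_norm, Real.enorm_eq_ofReal (maj_nonneg y p)]
    simp only [maj]
    rw [if_pos (by exact hp)]
  · refine lt_of_le_of_lt ?_ ((h.lintegral_right hD hσ le_rfl y).trans_lt ENNReal.ofReal_lt_top)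
    refine setLIntegral_mono' (measurableSet_lt measurable_const measurable_fst) fun p hp => ?_
    rw [enorm_mul, enorm_norm, Real.enorm_eq_ofReal (maj_nonneg y p)]
    simp only [maj]
    rw [if_neg (by exact not_lt.2 (le_of_lt hp))]

end

section

/-! ### The propagator on one time slice -/

/-- The kernel of `S(μ³)` between the source `p` and the point `(ℓ - μ³, y)`. -/
noncomputable def kerA (μ ℓ y : ℝ) (p : ℝ × ℝ) : ℝ :=
  2 * √3 / μ ^ 2 * ker0 ((ℓ - p.1) / μ) ((y - p.2) / μ)

/-- The kernel of `∂_x S(μ³)` between the source `p` and the point `(ℓ - μ³, y)`. -/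
noncomputable def kerAx (μ ℓ y : ℝ) (p : ℝ × ℝ) : ℝ :=
  2 * √3 / μ ^ 3 * ker1 ((ℓ - p.1) / μ) ((y - p.2) / μ)

lemma kernelA_eq_kerA {μ : ℝ} (hμ : 0 < μ) (ℓ y : ℝ) (p : ℝ × ℝ) :
    kernelA (ℓ - p.1) (y - p.2) (μ ^ 3) = ((kerA μ ℓ y p : ℝ) : ℂ) := by
  rw [kernelA_eq _ _ hμ, kerA, ker0]
  congr 5 <;> ring

lemma hasDerivAt_ker0 (X Y : ℝ) : HasDerivAt (fun X => ker0 X Y) (ker1 X Y) X := by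
  have h1 : HasDerivAt (fun X => airyD 0 (X + √3 * Y)) (airyD 1 (X + √3 * Y) * 1) X :=
    (hasDerivAt_airyD 0 _).comp X ((hasDerivAt_id X).add_const _)
  have h2 : HasDerivAt (fun X => airyD 0 (X - √3 * Y)) (airyD 1 (X - √3 * Y) * 1) X :=
    (hasDerivAt_airyD 0 _).comp X ((hasDerivAt_id X).sub_const _)
  refine (h1.mul h2).congr_deriv ?_
  rw [ker1]; ring

lemma contDiff_kerA (μ ℓ y : ℝ) : ContDiff ℝ (⊤ : ℕ∞) (kerA μ ℓ y) := by
  have h := contDiff_airyD 0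
  unfold kerA ker0
  fun_prop

lemma continuous_kerAx (μ ℓ y : ℝ) : Continuous (kerAx μ ℓ y) := by
  have h0 := (contDiff_airyD 0).continuous
  have h1 := (contDiff_airyD 1).continuous
  unfold kerAx ker1
  fun_prop

lemma hasDerivAt_kerA {μ : ℝ} (hμ : 0 < μ) (ℓ y : ℝ) (p : ℝ × ℝ) :
    HasDerivAt (fun ℓ => kerA μ ℓ y p) (kerAx μ ℓ y p) ℓ := by
  have h := ((hasDerivAt_ker0 ((ℓ - p.1) / μ) ((y - p.2) / μ)).comp ℓ
    (((hasDerivAt_id ℓ).sub_const p.1).div_const μ)).const_mul (2 * √3 / μ ^ 2)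
  refine h.congr_deriv ?_
  rw [kerAx]; field_simp

lemma fderiv_kerA {μ : ℝ} (hμ : 0 < μ) (ℓ y : ℝ) (p : ℝ × ℝ) :
    fderiv ℝ (kerA μ ℓ y) p (1, 0) = -kerAx μ ℓ y p := by
  have hd : HasFDerivAt (kerA μ ℓ y) (fderiv ℝ (kerA μ ℓ y) p) p :=
    ((contDiff_kerA μ ℓ y).differentiable (by simp)).differentiableAt.hasFDerivAt
  have hl : HasDerivAt (fun s : ℝ => (s, p.2)) (1, 0) p.1 :=
    (hasDerivAt_id p.1).prodMk (hasDerivAt_const p.1 p.2)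
  have h1 : HasDerivAt (fun s : ℝ => kerA μ ℓ y (s, p.2)) (fderiv ℝ (kerA μ ℓ y) p (1, 0)) p.1 :=
    HasFDerivAt.comp_hasDerivAt (f := fun s : ℝ => (s, p.2)) p.1 hd hl
  have h2 : HasDerivAt (fun s : ℝ => kerA μ ℓ y (s, p.2)) (-kerAx μ ℓ y p) p.1 := by
    have h := ((hasDerivAt_ker0 ((ℓ - p.1) / μ) ((y - p.2) / μ)).comp p.1
      (((hasDerivAt_id p.1).const_sub ℓ).div_const μ)).const_mul (2 * √3 / μ ^ 2)
    refine h.congr_deriv ?_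
    rw [kerAx]; field_simp
  exact h1.unique h2

/-- The reflection p ↦ (x + t, y) − p moves the dependence on x from the rough φ to the smooth
kernel. -/
lemma propagatorIntegrand_eq {μ : ℝ} (hμ : 0 < μ) (φ : ℝ × ℝ → ℂ) (x y : ℝ) (p : ℝ × ℝ) :
    propagatorIntegrand (μ ^ 3) φ x y p =
      (fun q => kerA μ (x + μ ^ 3) y q • φ q) ((x + μ ^ 3, y) - p) := by
  have h := kernelA_eq_kerA hμ (x + μ ^ 3) y ((x + μ ^ 3, y) - p)
  simp only [Prod.fst_sub, Prod.snd_sub, sub_sub_cancel] at h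
  simp only [propagatorIntegrand, h, Complex.real_smul]
  rfl

lemma integrable_propagatorIntegrand_iff {μ : ℝ} (hμ : 0 < μ) (φ : ℝ × ℝ → ℂ) (x y : ℝ) :
    Integrable (propagatorIntegrand (μ ^ 3) φ x y) ↔
      Integrable fun q => kerA μ (x + μ ^ 3) y q • φ q := by
  rw [funext (propagatorIntegrand_eq hμ φ x y)]
  exact integrable_comp_sub_left (fun q => kerA μ (x + μ ^ 3) y q • φ q) (x + μ ^ 3, y)

lemma propagator_eq {μ : ℝ} (hμ : 0 < μ) (φ : ℝ × ℝ → ℂ) (x y : ℝ) :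
    propagator (μ ^ 3) φ x y =
      (((2 * Real.pi) ^ 2)⁻¹ : ℝ) • ∫ q, kerA μ (x + μ ^ 3) y q • φ q := by
  rw [propagator, funext (propagatorIntegrand_eq hμ φ x y)]
  congr 1
  exact integral_sub_left_eq_self (fun q => kerA μ (x + μ ^ 3) y q • φ q) volume (x + μ ^ 3, y)

variable {D σ : ℝ} {φ G : ℝ × ℝ → ℂ}

lemma IsAiryKernel.exists_norm_smul_le {κ : ℝ → ℝ → ℝ} (hκ : IsAiryKernel κ) {μ : ℝ} (hμ : 0 < μ)
    (c : ℝ) : ∃ C, 0 < C ∧ ∀ (φ : ℝ × ℝ → ℂ) (ℓ y : ℝ) (p : ℝ × ℝ), μ ^ 3 ≤ ℓ →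
      ‖(c * κ ((ℓ - p.1) / μ) ((y - p.2) / μ)) • φ p‖ ≤ C * (maj y p * ‖φ p‖) := by
  obtain ⟨C, hC, h⟩ := hκ.exists_le_maj hμ
  refine ⟨(|c| + 1) * C, by positivity, fun φ ℓ y p hℓ => ?_⟩
  have := maj_nonneg y p
  rw [norm_smul, Real.norm_eq_abs, abs_mul]
  calc |c| * |κ ((ℓ - p.1) / μ) ((y - p.2) / μ)| * ‖φ p‖
      ≤ (|c| + 1) * (C * maj y p) * ‖φ p‖ := by
        gcongr
        · linarith
        · exact h ℓ y p hℓ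
    _ = _ := by ring

lemma SliceBounds.integrable_kerA (h : SliceBounds D σ φ) (hD : 0 ≤ D) (hσ : 9 / 4 < σ) {μ ℓ : ℝ}
    (hμ : 0 < μ) (hℓ : μ ^ 3 ≤ ℓ) (y : ℝ) : Integrable fun q => kerA μ ℓ y q • φ q := by
  obtain ⟨C, -, hb⟩ := isAiryKernel_ker0.exists_norm_smul_le hμ (2 * √3 / μ ^ 2)
  exact ((h.integrable_maj hD hσ y).const_mul C).mono'
    ((contDiff_kerA μ ℓ y).continuous.aestronglyMeasurable.smul h.aesm)
    (ae_of_all _ fun p => hb φ ℓ y p hℓ)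

lemma SliceBounds.integrable_kerAx (h : SliceBounds D σ φ) (hD : 0 ≤ D) (hσ : 9 / 4 < σ) {μ ℓ : ℝ}
    (hμ : 0 < μ) (hℓ : μ ^ 3 ≤ ℓ) (y : ℝ) : Integrable fun q => kerAx μ ℓ y q • φ q := by
  obtain ⟨C, -, hb⟩ := isAiryKernel_ker1.exists_norm_smul_le hμ (2 * √3 / μ ^ 3)
  exact ((h.integrable_maj hD hσ y).const_mul C).mono'
    ((continuous_kerAx μ ℓ y).aestronglyMeasurable.smul h.aesm)
    (ae_of_all _ fun p => hb φ ℓ y p hℓ)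

lemma SliceBounds.hasDerivAt_propagator (h : SliceBounds D σ φ) (hD : 0 ≤ D) (hσ : 9 / 4 < σ)
    {μ x : ℝ} (hμ : 0 < μ) (hx : 0 < x) (y : ℝ) :
    HasDerivAt (fun z => propagator (μ ^ 3) φ z y)
      ((((2 * Real.pi) ^ 2)⁻¹ : ℝ) • ∫ q, kerAx μ (x + μ ^ 3) y q • φ q) x := by
  obtain ⟨C, -, hb⟩ := isAiryKernel_ker1.exists_norm_smul_le hμ (2 * √3 / μ ^ 3)
  simp_rw [propagator_eq hμ φ _ y]
  refine HasDerivAt.fun_const_smul (((2 * Real.pi) ^ 2)⁻¹ : ℝ) ?_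
  refine (hasDerivAt_integral_of_dominated_loc_of_deriv_le (𝕜 := ℝ)
    (F := fun z q => kerA μ (z + μ ^ 3) y q • φ q)
    (F' := fun z q => kerAx μ (z + μ ^ 3) y q • φ q) (s := Ioi 0)
    (bound := fun p => C * (maj y p * ‖φ p‖)) (Ioi_mem_nhds hx)
    (Eventually.of_forall fun z =>
      (contDiff_kerA μ _ y).continuous.aestronglyMeasurable.smul h.aesm)
    (h.integrable_kerA hD hσ hμ (by linarith) y)
    ((continuous_kerAx μ _ y).aestronglyMeasurable.smul h.aesm)
    (ae_of_all _ fun p z hz => hb φ _ y p (by linarith [mem_Ioi.1 hz]))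
    ((h.integrable_maj hD hσ y).const_mul C)
    (ae_of_all _ fun p z _ => ?_)).2
  have h1 : HasDerivAt (fun z => kerA μ (z + μ ^ 3) y p) (kerAx μ (z + μ ^ 3) y p) z :=
    HasDerivAt.comp_add_const z (μ ^ 3) (hasDerivAt_kerA hμ (z + μ ^ 3) y p)
  exact h1.smul_const (φ p)

lemma SliceBounds.dxPropagator_eq (h : SliceBounds D σ φ) (hD : 0 ≤ D) (hσ : 9 / 4 < σ)
    {μ x : ℝ} (hμ : 0 < μ) (hx : 0 < x) (y : ℝ) :
    dxPropagator (μ ^ 3) φ x y =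
      (((2 * Real.pi) ^ 2)⁻¹ : ℝ) • ∫ q, kerAx μ (x + μ ^ 3) y q • φ q :=
  (h.hasDerivAt_propagator hD hσ hμ hx y).deriv

lemma norm_inv_two_pi_sq_smul_le (z : ℂ) : ‖(((2 * Real.pi) ^ 2)⁻¹ : ℝ) • z‖ ≤ ‖z‖ := by
  rw [norm_smul, Real.norm_eq_abs, abs_of_pos (by positivity)]
  refine mul_le_of_le_one_left (norm_nonneg _) (inv_le_one_of_one_le₀ ?_)
  nlinarith [Real.pi_gt_three]

/-- The decay estimate for `∂_x S(μ³) φ`. -/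
lemma exists_norm_dxPropagator_le_decay {σ : ℝ} (hσ : 9 / 4 < σ) : ∃ C, 0 < C ∧
    ∀ (D μ x y : ℝ) (φ : ℝ × ℝ → ℂ), 0 ≤ D → 0 < μ → 0 < x → SliceBounds D σ φ →
      ‖dxPropagator (μ ^ 3) φ x y‖ ≤ C * D * μ ^ (-(13 / 4) : ℝ) * (1 + x) ^ (9 / 4 - σ) := by
  obtain ⟨C, hC, hb⟩ := isAiryKernel_ker1.exists_lintegral_le hσ
  refine ⟨2 * √3 * C, by positivity, fun D μ x y φ hD hμ hx h => ?_⟩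
  have hμ3 : 0 < μ ^ 3 := by positivity
  rw [h.dxPropagator_eq hD hσ hμ hx y]
  refine (norm_inv_two_pi_sq_smul_le _).trans ?_
  have h1 := hb D μ (x + μ ^ 3) y φ hD hμ (by linarith) h
  have hR : 0 ≤ 2 * √3 * C * D * μ ^ (-(13 / 4) : ℝ) * (1 + x) ^ (9 / 4 - σ) := by positivity
  rw [← ENNReal.ofReal_le_ofReal_iff hR, ofReal_norm]
  calc ‖∫ q, kerAx μ (x + μ ^ 3) y q • φ q‖ₑ ≤ ∫⁻ q, ‖kerAx μ (x + μ ^ 3) y q • φ q‖ₑ :=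
        enorm_integral_le_lintegral_enorm _
    _ = ∫⁻ q, ENNReal.ofReal (2 * √3 / μ ^ 3) *
        (‖ker1 ((x + μ ^ 3 - q.1) / μ) ((y - q.2) / μ)‖ₑ * ‖φ q‖ₑ) := by
        congr 1
        funext q
        rw [enorm_smul, kerAx, enorm_mul,
          Real.enorm_eq_ofReal (by positivity : 0 ≤ 2 * √3 / μ ^ 3), mul_assoc]
    _ ≤ ENNReal.ofReal (2 * √3 / μ ^ 3) *
        ENNReal.ofReal (C * D * μ ^ (-(1 / 4) : ℝ) * (1 + (x + μ ^ 3)) ^ (9 / 4 - σ)) := by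
        rw [lintegral_const_mul' _ _ ENNReal.ofReal_ne_top]
        gcongr
    _ ≤ _ := by
        rw [← ENNReal.ofReal_mul (by positivity)]
        apply ENNReal.ofReal_le_ofReal
        have e1 : μ ^ (-(13 / 4) : ℝ) = μ ^ (-(1 / 4) : ℝ) / μ ^ 3 := by
          rw [← Real.rpow_natCast, ← Real.rpow_sub hμ]; norm_num
        have e2 : (1 + (x + μ ^ 3)) ^ (9 / 4 - σ) ≤ (1 + x) ^ (9 / 4 - σ) :=
          Real.rpow_le_rpow_of_nonpos (by positivity) (by linarith) (by linarith)
        calc _ ≤ 2 * √3 / μ ^ 3 * (C * D * μ ^ (-(1 / 4) : ℝ) * (1 + x) ^ (9 / 4 - σ)) := by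
              gcongr
          _ = _ := by rw [e1]; ring

/-- The weighted `L¹` bounds of a function on the plane. -/
structure L1Bounds (D : ℝ) (G : ℝ × ℝ → ℂ) : Prop where
  left : eLpNorm (fun p : ℝ × ℝ => (bracket p.1)⁻¹ • G p) 1
      (volume.restrict {p : ℝ × ℝ | p.1 < 0}) ≤ ENNReal.ofReal D
  right : eLpNorm G 1 (volume.restrict {p : ℝ × ℝ | 0 < p.1}) ≤ ENNReal.ofReal D

/-- On the right the kernel is just O(μ⁻²). On the left its decay towards the source absorbs the
weight ⟨x⟩⁻¹ with no further dependence on time. -/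
lemma exists_lintegral_kerA_le : ∃ C, 0 < C ∧
    ∀ (D μ ℓ y : ℝ) (G : ℝ × ℝ → ℂ), 0 ≤ D → 0 < μ → μ ^ 3 ≤ ℓ → L1Bounds D G →
      ∫⁻ p, ‖kerA μ ℓ y p • G p‖ₑ ≤ ENNReal.ofReal (C * D * μ ^ (-2 : ℝ)) := by
  obtain ⟨C0, hC0, h0⟩ := exists_abs_ker0_le
  obtain ⟨C1, hC1, h1⟩ := isAiryKernel_ker0.exists_le_majL 0
  refine ⟨2 * √3 * (C1 + C0), by positivity, fun D μ ℓ y G hD hμ hℓ h => ?_⟩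
  have hc : 0 < 2 * √3 / μ ^ 2 := by positivity
  have hL : ∫⁻ p in {p : ℝ × ℝ | p.1 < 0}, ‖kerA μ ℓ y p • G p‖ₑ ≤
      ENNReal.ofReal (2 * √3 / μ ^ 2 * C1) * ENNReal.ofReal D := by
    have := h.left
    rw [eLpNorm_one_eq_lintegral_enorm] at this
    refine le_trans ?_ (mul_le_mul_right this _)
    rw [← lintegral_const_mul' _ _ ENNReal.ofReal_ne_top]
    refine setLIntegral_mono' (measurableSet_lt measurable_fst measurable_const) fun p hp => ?_
    rw [enorm_smul, enorm_smul, ← mul_assoc]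
    gcongr
    have hb := (bracket_pos p.1)
    rw [Real.enorm_eq_ofReal (inv_nonneg.2 hb.le), ← ENNReal.ofReal_mul (by positivity),
      ← ofReal_norm]
    apply ENNReal.ofReal_le_ofReal
    rw [kerA, Real.norm_eq_abs, abs_mul, abs_of_pos hc, mul_assoc]
    gcongr
    refine (h1 μ ℓ y p hμ hℓ hp).trans ?_
    rw [pow_zero, div_one]
    gcongr
    unfold majL
    have b1 := bump_pos p.1
    have b2 := bump_pos (y - p.2)
    calc (1 + |p.1|)⁻¹ * bump p.1 * bump (y - p.2) ≤ (bracket p.1)⁻¹ * 1 * 1 := by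
          gcongr
          · exact bracket_le _
          · exact bump_le_one _
          · exact bump_le_one _
      _ = _ := by ring
  have hR : ∫⁻ p in {p : ℝ × ℝ | 0 < p.1}, ‖kerA μ ℓ y p • G p‖ₑ ≤
      ENNReal.ofReal (2 * √3 / μ ^ 2 * C0) * ENNReal.ofReal D := by
    have := h.right
    rw [eLpNorm_one_eq_lintegral_enorm] at this
    refine le_trans ?_ (mul_le_mul_right this _)
    rw [← lintegral_const_mul' _ _ ENNReal.ofReal_ne_top]
    refine lintegral_mono fun p => ?_
    rw [enorm_smul]
    gcongr
    rw [← ofReal_norm]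
    apply ENNReal.ofReal_le_ofReal
    rw [kerA, Real.norm_eq_abs, abs_mul, abs_of_pos hc]
    gcongr
    exact h0 _ _
  refine (lintegral_le_left_add_right _).trans ((add_le_add hL hR).trans_eq ?_)
  rw [← ENNReal.ofReal_mul (by positivity), ← ENNReal.ofReal_mul (by positivity),
    ← ENNReal.ofReal_add (by positivity) (by positivity)]
  congr 1
  rw [Real.rpow_neg hμ.le, Real.rpow_two]
  field_simp

/-- The dispersive estimate for `∂_x S(μ³) φ = S(μ³) ∂_x φ`. -/
lemma exists_norm_dxPropagator_le_dispersive : ∃ C, 0 < C ∧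
    ∀ (D D' σ μ x y : ℝ) (φ G : ℝ × ℝ → ℂ), 0 ≤ D → 0 ≤ D' → 9 / 4 < σ → 0 < μ → 0 < x →
      SliceBounds D' σ φ → HasWeakDerivX φ G → L1Bounds D G →
      ‖dxPropagator (μ ^ 3) φ x y‖ ≤ C * D * μ ^ (-2 : ℝ) := by
  obtain ⟨C, hC, hb⟩ := exists_lintegral_kerA_le
  refine ⟨C, hC, fun D D' σ μ x y φ G hD hD' hσ hμ hx h hw hG => ?_⟩
  have hμ3 : 0 < μ ^ 3 := by positivity
  have hℓ : μ ^ 3 ≤ x + μ ^ 3 := by linarith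
  have h1 := hb D μ (x + μ ^ 3) y G hD hμ hℓ hG
  have iG : Integrable fun q => kerA μ (x + μ ^ 3) y q • G q :=
    ⟨(contDiff_kerA μ _ y).continuous.aestronglyMeasurable.smul hw.2.1.aestronglyMeasurable,
      h1.trans_lt ENNReal.ofReal_lt_top⟩
  have ibp := hw.integral_smul_eq_neg (contDiff_kerA μ (x + μ ^ 3) y)
    (kx := fun p => -kerAx μ (x + μ ^ 3) y p) (fderiv_kerA hμ _ y)
    (h.integrable_kerA hD' hσ hμ hℓ y)
    (by simp only [neg_smul]; exact (h.integrable_kerAx hD' hσ hμ hℓ y).neg) iG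
  simp only [neg_smul, integral_neg, neg_inj] at ibp
  rw [h.dxPropagator_eq hD' hσ hμ hx y, ibp]
  refine (norm_inv_two_pi_sq_smul_le _).trans ?_
  have hR : 0 ≤ C * D * μ ^ (-2 : ℝ) := by positivity
  rw [← ENNReal.ofReal_le_ofReal_iff hR, ofReal_norm]
  exact (enorm_integral_le_lintegral_enorm _).trans h1

end

section

/-! ### Integrals in time -/

/-- Use the integrable bound up to the crossing point r of P s^(−α) and Q s^(−β), and the other one
after it; both pieces are multiples of P r^(1 − α). -/
lemma integral_le_of_rpow_bounds {α β P Q D b : ℝ} (hα : α < 1) (hβ : 1 < β) (hP : 0 < P)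
    (hQ : 0 < Q) (hD : 0 ≤ D) (hb : 0 ≤ b) {h : ℝ → ℝ} (hi : IntervalIntegrable h volume 0 b)
    (h1 : ∀ᵐ s : ℝ, s ∈ Ioo 0 b → h s ≤ D * (P * s ^ (-α)))
    (h2 : ∀ᵐ s : ℝ, s ∈ Ioo 0 b → h s ≤ D * (Q * s ^ (-β))) :
    ∫ s in (0 : ℝ)..b, h s ≤
      (1 / (1 - α) + 1 / (β - 1)) * D * (P * (Q / P) ^ ((1 - α) / (β - α))) := by
  set r : ℝ := (Q / P) ^ (1 / (β - α)) with hr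
  have hβα : 0 < β - α := by linarith
  have hα' : 0 < 1 - α := by linarith
  have hβ' : 0 < β - 1 := by linarith
  have hQP : 0 < Q / P := by positivity
  have hr0 : 0 < r := by positivity
  have e1 : (Q / P) ^ ((1 - α) / (β - α)) = r ^ (1 - α) := by
    rw [hr, ← Real.rpow_mul hQP.le]; congr 1; ring
  have e2 : Q = P * r ^ (β - α) := by
    rw [hr, ← Real.rpow_mul hQP.le, one_div_mul_cancel hβα.ne', Real.rpow_one]; field_simp
  set c := min b r with hc
  have hc0 : 0 ≤ c := le_min hb hr0.le
  have hcb : c ≤ b := min_le_left _ _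
  have i1 : IntervalIntegrable h volume 0 c :=
    hi.mono_set (by rw [uIcc_of_le hc0, uIcc_of_le hb]; exact Icc_subset_Icc_right hcb)
  have i2 : IntervalIntegrable h volume c b :=
    hi.mono_set (by rw [uIcc_of_le hcb, uIcc_of_le hb]; exact Icc_subset_Icc_left hc0)
  have b1 : ∫ s in (0 : ℝ)..c, h s ≤ D * (P * (r ^ (1 - α) / (1 - α))) := by
    have im : IntervalIntegrable (fun s : ℝ => s ^ (-α)) volume 0 c :=
      intervalIntegral.intervalIntegrable_rpow' (by linarith)
    calc ∫ s in (0 : ℝ)..c, h s ≤ ∫ s in (0 : ℝ)..c, D * (P * s ^ (-α)) := by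
          refine intervalIntegral.integral_mono_ae_restrict hc0 i1 ((im.const_mul P).const_mul D) ?_
          rw [Filter.EventuallyLE, ← restrict_Ioo_eq_restrict_Icc,
            ae_restrict_iff' measurableSet_Ioo]
          filter_upwards [h1] with s hs hs'
          exact hs ⟨hs'.1, hs'.2.trans_le hcb⟩
      _ = D * (P * (c ^ (1 - α) / (1 - α))) := by
          rw [intervalIntegral.integral_const_mul, intervalIntegral.integral_const_mul,
            integral_rpow (Or.inl (by linarith)), Real.zero_rpow (by linarith), sub_zero,
            neg_add_eq_sub]
      _ ≤ _ := by gcongr; exact min_le_right _ _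
  have b2 : ∫ s in c..b, h s ≤ D * (P * (r ^ (1 - α) / (β - 1))) := by
    rcases le_total b r with hbr | hbr
    · rw [show c = b from min_eq_left hbr, intervalIntegral.integral_same]; positivity
    · have hcr : c = r := min_eq_right hbr
      rw [hcr] at i2 ⊢
      have h0 : (0 : ℝ) ∉ uIcc r b := by
        rw [uIcc_of_le hbr]; exact fun hh => absurd hh.1 (not_le.2 hr0)
      have im : IntervalIntegrable (fun s : ℝ => s ^ (-β)) volume r b :=
        intervalIntegral.intervalIntegrable_rpow (Or.inr h0)
      calc ∫ s in r..b, h s ≤ ∫ s in r..b, D * (Q * s ^ (-β)) := by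
            refine intervalIntegral.integral_mono_ae_restrict hbr i2
              ((im.const_mul Q).const_mul D) ?_
            rw [Filter.EventuallyLE, ← restrict_Ioo_eq_restrict_Icc,
              ae_restrict_iff' measurableSet_Ioo]
            filter_upwards [h2] with s hs hs'
            exact hs ⟨hr0.trans hs'.1, hs'.2⟩
        _ = D * (Q * ((r ^ (1 - β) - b ^ (1 - β)) / (β - 1))) := by
            rw [intervalIntegral.integral_const_mul, intervalIntegral.integral_const_mul,
              integral_rpow (Or.inr ⟨by linarith, h0⟩), neg_add_eq_sub]
            congr 2
            rw [← neg_sub β 1, div_neg, ← neg_div, neg_sub]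
        _ ≤ D * (Q * (r ^ (1 - β) / (β - 1))) := by
            gcongr
            linarith [Real.rpow_nonneg hb (1 - β)]
        _ = _ := by
            rw [e2, show 1 - α = (β - α) + (1 - β) by ring, Real.rpow_add hr0]; ring
  rw [← intervalIntegral.integral_add_adjacent_intervals i1 i2, e1]
  calc _ ≤ D * (P * (r ^ (1 - α) / (1 - α))) + D * (P * (r ^ (1 - α) / (β - 1))) := add_le_add b1 b2
    _ = _ := by ring

lemma ae_comp_sub_left {p : ℝ → Prop} (t : ℝ) (h : ∀ᵐ s : ℝ, p s) : ∀ᵐ s : ℝ, p (t - s) :=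
  (Measure.measurePreserving_sub_left (volume : Measure ℝ) t).quasiMeasurePreserving.ae h

lemma integral_le_of_dispersive_bounds {Y D a t : ℝ} (hY : 0 < Y) (hD : 0 ≤ D) (hat : a ≤ t)
    {h : ℝ → ℝ} (hi : IntervalIntegrable h volume a t)
    (h1 : ∀ᵐ s : ℝ, s ∈ Ioo a t → h s ≤ D * (t - s) ^ (-(2 / 3) : ℝ))
    (h2 : ∀ᵐ s : ℝ, s ∈ Ioo a t → h s ≤ D * (Y * (t - s) ^ (-(13 / 12) : ℝ))) :
    ∫ s in a..t, h s ≤ 15 * D * Y ^ (4 / 5 : ℝ) := by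
  have hi' : IntervalIntegrable (fun s => h (t - s)) volume 0 (t - a) := by
    simpa using (hi.comp_sub_left t).symm
  have key := integral_le_of_rpow_bounds (α := 2 / 3) (β := 13 / 12) (P := 1) (Q := Y) (D := D)
    (b := t - a) (by norm_num) (by norm_num) one_pos hY hD (by linarith) hi' ?_ ?_
  · rw [intervalIntegral.integral_comp_sub_left, sub_sub_cancel, sub_zero] at key
    refine key.trans_eq ?_
    norm_num
  · filter_upwards [ae_comp_sub_left t h1] with s hs hs'
    have := hs ⟨by linarith [hs'.2], by linarith [hs'.1]⟩
    rwa [sub_sub_cancel, ← one_mul (s ^ _)] at this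
  · filter_upwards [ae_comp_sub_left t h2] with s hs hs'
    have := hs ⟨by linarith [hs'.2], by linarith [hs'.1]⟩
    rwa [sub_sub_cancel] at this

lemma intervalIntegrable_sub_rpow (t : ℝ) :
    IntervalIntegrable (fun s : ℝ => (t - s) ^ (-(2 / 3) : ℝ)) volume 0 t := by
  have := (intervalIntegral.intervalIntegrable_rpow' (a := 0) (b := t)
    (by norm_num : (-1 : ℝ) < -(2 / 3))).comp_sub_left t
  simpa using this.symm

lemma integral_sub_rpow (t : ℝ) : ∫ s in (0 : ℝ)..t, (t - s) ^ (-(2 / 3) : ℝ) =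
    3 * t ^ (1 / 3 : ℝ) := by
  rw [intervalIntegral.integral_comp_sub_left (fun s : ℝ => s ^ (-(2 / 3) : ℝ)), sub_self, sub_zero,
    integral_rpow (Or.inl (by norm_num))]
  norm_num
  ring

/-! ### The forcing on time slices -/

variable {ν σ₁ σ₂ C₂ : ℝ} {F : ℝ → ℝ × ℝ → ℂ}

/-- The factor 2^σ comes from 1 + x ≤ 2⟨x⟩; m ≥ 1 lets the same constant serve for the L² bound. -/
lemma sliceBounds_of_bracket {m σ C₂ : ℝ} {φ : ℝ × ℝ → ℂ} (hσ : 0 ≤ σ) (hC : 0 ≤ C₂) (hm : 1 ≤ m)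
    (hφ : AEStronglyMeasurable φ)
    (hd : ∀ᵐ p : ℝ × ℝ, 0 < p.1 → ‖φ p‖ ≤ C₂ * (m * bracket p.1 ^ (-σ)))
    (hL : eLpNorm (fun p : ℝ × ℝ => (bracket p.1)⁻¹ • φ p) 2
      (volume.restrict {p : ℝ × ℝ | p.1 < 0}) ≤ ENNReal.ofReal C₂) :
    SliceBounds (C₂ * m * 2 ^ σ) σ φ := by
  have h2 : (1 : ℝ) ≤ 2 ^ σ := Real.one_le_rpow (by norm_num) hσ
  refine ⟨hφ, ?_, hL.trans (ENNReal.ofReal_le_ofReal ?_)⟩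
  · filter_upwards [hd] with p hp h0
    have hb : bracket p.1 ^ (-σ) ≤ 2 ^ σ * (1 + p.1) ^ (-σ) := by
      have h1 : (1 + p.1) / 2 ≤ bracket p.1 := by
        have := le_two_mul_bracket p.1
        rw [abs_of_pos h0] at this
        linarith
      calc bracket p.1 ^ (-σ) ≤ ((1 + p.1) / 2) ^ (-σ) :=
            Real.rpow_le_rpow_of_nonpos (by positivity) h1 (by linarith)
        _ = _ := by
            rw [Real.div_rpow (by positivity) (by norm_num), Real.rpow_neg (by norm_num : (0:ℝ) ≤ 2),
              div_inv_eq_mul, mul_comm]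
    calc ‖φ p‖ ≤ C₂ * (m * (2 ^ σ * (1 + p.1) ^ (-σ))) := (hp h0).trans (by gcongr)
      _ = _ := by ring
  · calc C₂ = C₂ * 1 * 1 := by ring
      _ ≤ _ := by gcongr

/-- At almost every time, the forcing is a function to which the slice estimates apply, with the
early or the late decay. -/
lemma ForcingBounds.ae_slice (h : ForcingBounds 1 ν σ₁ σ₂ C₂ F) (hν : 0 ≤ ν) (h1 : 0 ≤ σ₁)
    (h2 : 0 ≤ σ₂) (hC : 0 ≤ C₂) : ∀ᵐ s : ℝ, 0 < s →
      (∃ G, HasWeakDerivX (F s) G ∧ L1Bounds C₂ G) ∧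
      ((s < 1 ∧ SliceBounds (C₂ * s ^ (-ν) * 2 ^ σ₁) σ₁ (F s)) ∨
        (1 < s ∧ SliceBounds (C₂ * 1 * 2 ^ σ₂) σ₂ (F s))) := by
  -- Neither decay hypothesis covers s = 1, a null set.
  have hne : ∀ᵐ s : ℝ, s ≠ 1 := by simp [ae_iff]
  filter_upwards [h.decay_early, h.decay_late, h.left_L2, h.deriv_L1, hne] with s he hl hL hd hs1 hs
  obtain ⟨G, hw, g1, g2⟩ := hd hs
  refine ⟨⟨G, hw, g1, g2⟩, ?_⟩
  rcases lt_or_gt_of_ne hs1 with hs1 | hs1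
  · exact Or.inl ⟨hs1, sliceBounds_of_bracket h1 hC
      (Real.one_le_rpow_of_pos_of_le_one_of_nonpos hs hs1.le (by linarith))
      hw.1.aestronglyMeasurable (he hs hs1) (hL hs)⟩
  · refine Or.inr ⟨hs1, sliceBounds_of_bracket h2 hC le_rfl hw.1.aestronglyMeasurable ?_ (hL hs)⟩
    simpa only [one_mul] using hl hs1

lemma exists_cube_eq {τ : ℝ} (hτ : 0 < τ) : ∃ μ, 0 < μ ∧ μ = τ ^ (1 / 3 : ℝ) ∧ μ ^ 3 = τ := by
  refine ⟨τ ^ (1 / 3 : ℝ), by positivity, rfl, ?_⟩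
  rw [← Real.rpow_natCast, ← Real.rpow_mul hτ.le]; norm_num

lemma one_add_rpow_le_bracket {x e : ℝ} (hx : 0 < x) (he : e ≤ 0) :
    (1 + x) ^ e ≤ bracket x ^ e := by
  have := bracket_le x
  rw [abs_of_pos hx] at this
  exact Real.rpow_le_rpow_of_nonpos (bracket_pos x) this he

/-- The slice estimates for the Duhamel integrand. -/
lemma exists_duhamel_integrand_bounds (hν : 0 ≤ ν) (h1 : 9 / 4 < σ₁) (h2 : 9 / 4 < σ₂) :
    ∃ A, 0 < A ∧ ∀ (C₂ : ℝ) (F : ℝ → ℝ × ℝ → ℂ), 0 ≤ C₂ → ForcingBounds 1 ν σ₁ σ₂ C₂ F →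
      ∀ t x y : ℝ, 0 < x →
      (∀ᵐ s : ℝ, s ∈ Ioo 0 t →
        ‖dxPropagator (t - s) (F s) x y‖ ≤ A * C₂ * (t - s) ^ (-(2 / 3) : ℝ)) ∧
      (∀ᵐ s : ℝ, s ∈ Ioo 0 t → s < 1 → ‖dxPropagator (t - s) (F s) x y‖ ≤
        A * C₂ * (s ^ (-ν) * bracket x ^ (-(σ₁ - 9 / 4)) * (t - s) ^ (-(13 / 12) : ℝ))) ∧
      (∀ᵐ s : ℝ, s ∈ Ioo 0 t → 1 < s → ‖dxPropagator (t - s) (F s) x y‖ ≤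
        A * C₂ * (bracket x ^ (-(σ₂ - 9 / 4)) * (t - s) ^ (-(13 / 12) : ℝ))) := by
  obtain ⟨A0, hA0, hd⟩ := exists_norm_dxPropagator_le_dispersive
  obtain ⟨A1, hA1, hb1⟩ := exists_norm_dxPropagator_le_decay h1
  obtain ⟨A2, hA2, hb2⟩ := exists_norm_dxPropagator_le_decay h2
  refine ⟨A0 + A1 * 2 ^ σ₁ + A2 * 2 ^ σ₂, by positivity, fun C₂ F hC h t x y hx => ?_⟩
  have hs := h.ae_slice hν (by linarith) (by linarith) hC
  have p1 : 0 < A1 * 2 ^ σ₁ := by positivity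
  have p2 : 0 < A2 * 2 ^ σ₂ := by positivity
  have hpow : ∀ {μ τ : ℝ}, 0 < τ → μ = τ ^ (1 / 3 : ℝ) → μ ^ (-2 : ℝ) = τ ^ (-(2 / 3) : ℝ) ∧
      μ ^ (-(13 / 4) : ℝ) = τ ^ (-(13 / 12) : ℝ) := by
    intro μ τ hτ e
    rw [e, ← Real.rpow_mul hτ.le, ← Real.rpow_mul hτ.le]
    norm_num
  refine ⟨?_, ?_, ?_⟩
  · filter_upwards [hs] with s hs ht
    obtain ⟨⟨G, hw, hG⟩, hS⟩ := hs ht.1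
    have hτ : 0 < t - s := by linarith [ht.2]
    obtain ⟨μ, hμ, e, hμ3⟩ := exists_cube_eq hτ
    have hs0 := ht.1
    have : ‖dxPropagator (t - s) (F s) x y‖ ≤ A0 * C₂ * (t - s) ^ (-(2 / 3) : ℝ) := by
      rw [← (hpow hτ e).1, ← hμ3]
      rcases hS with ⟨_, hS⟩ | ⟨_, hS⟩
      · exact hd C₂ _ σ₁ μ x y _ G hC (by positivity) h1 hμ hx hS hw hG
      · exact hd C₂ _ σ₂ μ x y _ G hC (by positivity) h2 hμ hx hS hw hG
    refine this.trans ?_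
    gcongr
    linarith
  · filter_upwards [hs] with s hs ht hs1
    obtain ⟨-, hS⟩ := hs ht.1
    have hτ : 0 < t - s := by linarith [ht.2]
    obtain ⟨μ, hμ, e, hμ3⟩ := exists_cube_eq hτ
    have hs0 := ht.1
    rcases hS with ⟨_, hS⟩ | ⟨hs1', hS⟩
    · have := hb1 _ μ x y _ (by positivity) hμ hx hS
      rw [hμ3, (hpow hτ e).2] at this
      have hB := one_add_rpow_le_bracket hx (by linarith : 9 / 4 - σ₁ ≤ 0)
      rw [neg_sub]
      calc _ ≤ A1 * (C₂ * s ^ (-ν) * 2 ^ σ₁) * (t - s) ^ (-(13 / 12) : ℝ) *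
            bracket x ^ (9 / 4 - σ₁) := this.trans (by gcongr)
        _ = A1 * 2 ^ σ₁ * C₂ * (s ^ (-ν) * bracket x ^ (9 / 4 - σ₁) *
            (t - s) ^ (-(13 / 12) : ℝ)) := by ring
        _ ≤ _ := by
            have := bracket_pos x
            gcongr
            linarith
    · linarith
  · filter_upwards [hs] with s hs ht hs1
    obtain ⟨-, hS⟩ := hs ht.1
    have hτ : 0 < t - s := by linarith [ht.2]
    obtain ⟨μ, hμ, e, hμ3⟩ := exists_cube_eq hτ
    have hs0 := ht.1
    rcases hS with ⟨hs1', _⟩ | ⟨_, hS⟩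
    · linarith
    · have := hb2 _ μ x y _ (by positivity) hμ hx hS
      rw [hμ3, (hpow hτ e).2] at this
      have hB := one_add_rpow_le_bracket hx (by linarith : 9 / 4 - σ₂ ≤ 0)
      rw [neg_sub]
      calc _ ≤ A2 * (C₂ * 1 * 2 ^ σ₂) * (t - s) ^ (-(13 / 12) : ℝ) *
            bracket x ^ (9 / 4 - σ₂) := this.trans (by gcongr)
        _ = A2 * 2 ^ σ₂ * C₂ * (bracket x ^ (9 / 4 - σ₂) *
            (t - s) ^ (-(13 / 12) : ℝ)) := by ring
        _ ≤ _ := by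
            have := bracket_pos x
            gcongr
            linarith

/-- For almost every s the x-derivative is an integral against an explicit kernel jointly measurable
in s and the source point, so measurability in s follows from that of parametric integrals. -/
lemma ForcingBounds.aestronglyMeasurable_dxPropagator (h : ForcingBounds 1 ν σ₁ σ₂ C₂ F)
    (hν : 0 ≤ ν) (h1 : 9 / 4 < σ₁) (h2 : 9 / 4 < σ₂) (hC : 0 ≤ C₂) {t x : ℝ} (y : ℝ)
    (hx : 0 < x) :
    AEStronglyMeasurable (fun s => dxPropagator (t - s) (F s) x y)
      (volume.restrict (Ioo 0 t)) := by
  set k : ℝ × (ℝ × ℝ) → ℝ := fun q =>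
    kerAx ((t - q.1) ^ (1 / 3 : ℝ)) (x + ((t - q.1) ^ (1 / 3 : ℝ)) ^ 3) y q.2 with hk
  have hkm : Measurable k := by
    have h0 := (contDiff_airyD 0).continuous.measurable
    have h1 := (contDiff_airyD 1).continuous.measurable
    simp only [hk, kerAx, ker1]
    fun_prop
  have hac : ((volume.restrict (Ioo (0 : ℝ) t)).prod (volume : Measure (ℝ × ℝ))) ≪
      ((volume.restrict (Ioi (0 : ℝ))).prod (volume : Measure (ℝ × ℝ))) :=
    (Measure.absolutelyContinuous_of_le
      (Measure.restrict_mono Ioo_subset_Ioi_self le_rfl)).prod Measure.AbsolutelyContinuous.rfl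
  have hm : AEStronglyMeasurable (fun q : ℝ × (ℝ × ℝ) => k q • F q.1 q.2)
      ((volume.restrict (Ioo (0 : ℝ) t)).prod (volume : Measure (ℝ × ℝ))) :=
    hkm.aestronglyMeasurable.smul (h.aestronglyMeasurable.mono_ac hac)
  have hm2 := hm.integral_prod_right'.const_smul (((2 * Real.pi) ^ 2)⁻¹ : ℝ)
  refine hm2.congr ?_
  rw [Filter.EventuallyEq, ae_restrict_iff' measurableSet_Ioo]
  filter_upwards [h.ae_slice hν (by linarith) (by linarith) hC] with s hs ht
  obtain ⟨-, hS⟩ := hs ht.1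
  have hτ : 0 < t - s := by linarith [ht.2]
  obtain ⟨μ, hμ, e, hμ3⟩ := exists_cube_eq hτ
  have hs0 := ht.1
  have key : dxPropagator (μ ^ 3) (F s) x y =
      (((2 * Real.pi) ^ 2)⁻¹ : ℝ) • ∫ q, kerAx μ (x + μ ^ 3) y q • F s q := by
    rcases hS with ⟨_, hS⟩ | ⟨_, hS⟩
    · exact hS.dxPropagator_eq (by positivity) h1 hμ hx y
    · exact hS.dxPropagator_eq (by positivity) h2 hμ hx y
  rw [hμ3] at key
  rw [key]
  simp only [Pi.smul_apply, hk, ← e, hμ3]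

lemma ForcingBounds.duhamelWellDefined (h : ForcingBounds 1 ν σ₁ σ₂ C₂ F)
    (hν : 0 ≤ ν) (h1 : 9 / 4 < σ₁) (h2 : 9 / 4 < σ₂) (hC : 0 ≤ C₂) {t x : ℝ} (y : ℝ)
    (ht : 0 ≤ t) (hx : 0 < x) : DuhamelWellDefined F t x y := by
  refine ⟨?_, ?_⟩
  · filter_upwards [h.ae_slice hν (by linarith) (by linarith) hC] with s hs hst
    obtain ⟨-, hS⟩ := hs hst.1
    have hτ : 0 < t - s := by linarith [hst.2]
    obtain ⟨μ, hμ, e, hμ3⟩ := exists_cube_eq hτ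
    have hs0 := hst.1
    have hμ3' : 0 < μ ^ 3 := by positivity
    rw [← hμ3, integrable_propagatorIntegrand_iff hμ]
    rcases hS with ⟨_, hS⟩ | ⟨_, hS⟩
    · exact ⟨hS.integrable_kerA (by positivity) h1 hμ (by linarith) y,
        (hS.hasDerivAt_propagator (by positivity) h1 hμ hx y).differentiableAt⟩
    · exact ⟨hS.integrable_kerA (by positivity) h2 hμ (by linarith) y,
        (hS.hasDerivAt_propagator (by positivity) h2 hμ hx y).differentiableAt⟩
  · obtain ⟨A, hA, hb⟩ := exists_duhamel_integrand_bounds hν h1 h2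
    rw [intervalIntegrable_iff_integrableOn_Ioo_of_le ht]
    -- The dispersive bound alone is an integrable majorant over the whole interval (0, t).
    have hi := (intervalIntegrable_sub_rpow t).const_mul (A * C₂)
    rw [intervalIntegrable_iff_integrableOn_Ioo_of_le ht] at hi
    refine Integrable.mono' hi (h.aestronglyMeasurable_dxPropagator hν h1 h2 hC y hx) ?_
    rw [ae_restrict_iff' measurableSet_Ioo]
    exact (hb C₂ F hC h t x y hx).1

end

section

/-! ### The Duhamel term -/

variable {ν σ₁ σ₂ C₂ : ℝ} {F : ℝ → ℝ × ℝ → ℂ}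

lemma ForcingBounds.of_half (h : ForcingBounds (1 / 2) ν σ₁ σ₂ C₂ F) :
    ForcingBounds 1 ν σ₁ σ₂ C₂ F where
  aestronglyMeasurable := h.aestronglyMeasurable
  decay_early := h.decay_early
  decay_late := by
    filter_upwards [h.decay_late] with t ht h1
    exact ht (by linarith)
  left_L2 := h.left_L2
  deriv_L1 := h.deriv_L1

/-- On (0, b) one has t − s ≥ b, so the powers of t − s may be frozen at b. The interpolation then
runs between s⁰ and s^(−ν), whence the exponent 1/ν. -/
lemma integral_initial_le {D X b t : ℝ} (hν : 1 < ν) (hD : 0 ≤ D) (hX : 0 < X)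
    (hb : 0 < b) (hbt : 2 * b ≤ t) {h : ℝ → ℝ} (hi : IntervalIntegrable h volume 0 b)
    (h1 : ∀ᵐ s : ℝ, s ∈ Ioo 0 b → h s ≤ D * (t - s) ^ (-(2 / 3) : ℝ))
    (h2 : ∀ᵐ s : ℝ, s ∈ Ioo 0 b → h s ≤ D * (s ^ (-ν) * X * (t - s) ^ (-(13 / 12) : ℝ))) :
    ∫ s in (0 : ℝ)..b, h s ≤
      (1 + 1 / (ν - 1)) * D * (b ^ (-(2 / 3) - 5 / (12 * ν)) * X ^ (1 / ν)) := by
  have hν0 : 0 < ν := by linarith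
  have key := integral_le_of_rpow_bounds (α := 0) (β := ν) (P := b ^ (-(2 / 3) : ℝ))
    (Q := b ^ (-(13 / 12) : ℝ) * X) (D := D) (b := b) one_pos hν (by positivity) (by positivity)
    hD hb.le hi ?_ ?_
  · refine key.trans_eq ?_
    rw [sub_zero, sub_zero, div_one]
    congr 1
    have e1 : b ^ (-(13 / 12) : ℝ) * X / b ^ (-(2 / 3) : ℝ) = b ^ (-(5 / 12) : ℝ) * X := by
      rw [mul_div_right_comm, ← Real.rpow_sub hb]; norm_num
    rw [e1, Real.mul_rpow (by positivity) hX.le, ← Real.rpow_mul hb.le, ← mul_assoc,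
      ← Real.rpow_add hb]
    congr 2
    field_simp
    ring
  · filter_upwards [h1] with s hs hs'
    refine (hs hs').trans ?_
    rw [neg_zero, Real.rpow_zero, mul_one]
    gcongr ?_ * ?_
    exact Real.rpow_le_rpow_of_nonpos hb (by linarith [hs'.2]) (by norm_num)
  · filter_upwards [h2] with s hs hs'
    refine (hs hs').trans ?_
    have hs0 := hs'.1
    have : (t - s) ^ (-(13 / 12) : ℝ) ≤ b ^ (-(13 / 12) : ℝ) :=
      Real.rpow_le_rpow_of_nonpos hb (by linarith [hs'.2]) (by norm_num)
    calc D * (s ^ (-ν) * X * (t - s) ^ (-(13 / 12) : ℝ))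
        ≤ D * (s ^ (-ν) * X * b ^ (-(13 / 12) : ℝ)) := by gcongr
      _ = _ := by ring

lemma exists_norm_duhamel_le (hν : 1 < ν) (h2 : 9 / 4 < σ₂) (h12 : σ₂ ≤ σ₁) :
    ∃ C, 0 < C ∧ ∀ (C₂ : ℝ) (F : ℝ → ℝ × ℝ → ℂ), 0 ≤ C₂ → ForcingBounds 1 ν σ₁ σ₂ C₂ F →
      ∀ t x y : ℝ, 0 < t → 0 < x →
      ‖duhamel F t x y‖ ≤ C * C₂ * t ^ (1 / 3 : ℝ) ∧
      (t ≤ 1 → ‖duhamel F t x y‖ ≤ C * C₂ *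
        (t ^ (-(2 / 3) - 5 / (12 * ν)) * (bracket x ^ (-(σ₁ - 9 / 4))) ^ (1 / ν) +
          (t ^ (-ν) * bracket x ^ (-(σ₁ - 9 / 4))) ^ (4 / 5 : ℝ))) ∧
      (1 < t → ‖duhamel F t x y‖ ≤ C * C₂ *
        ((bracket x ^ (-(σ₁ - 9 / 4))) ^ (1 / ν) +
          (bracket x ^ (-(σ₂ - 9 / 4))) ^ (4 / 5 : ℝ))) := by
  have h1 : 9 / 4 < σ₁ := by linarith
  have hν0 : 0 < ν := by linarith
  have hν1 : 0 < ν - 1 := by linarith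
  obtain ⟨A, hA, hb⟩ := exists_duhamel_integrand_bounds hν0.le h1 h2
  set κ : ℝ := 1 + 1 / (ν - 1) with hκ
  have hκ0 : 0 < κ := by positivity
  set e : ℝ := -(2 / 3) - 5 / (12 * ν) with he
  set c : ℝ := (1 / 2 : ℝ) ^ e with hc
  have hc0 : 0 < c := by positivity
  set d : ℝ := ((1 / 2 : ℝ) ^ (-ν)) ^ (4 / 5 : ℝ) with hd
  have hd0 : 0 < d := by positivity
  refine ⟨A * (3 + κ * c + 15 * d), by positivity, fun C₂ F hC h t x y ht hx => ?_⟩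
  obtain ⟨ba, bE, bL⟩ := hb C₂ F hC h t x y hx
  have hB := bracket_pos x
  set X₁ := bracket x ^ (-(σ₁ - 9 / 4)) with hX₁
  set X₂ := bracket x ^ (-(σ₂ - 9 / 4)) with hX₂
  have hX₁0 : 0 < X₁ := by positivity
  have hX₂0 : 0 < X₂ := by positivity
  have hX12 : X₁ ≤ X₂ := Real.rpow_le_rpow_of_exponent_le (one_le_bracket x) (by linarith)
  have hi : IntervalIntegrable (fun s => ‖dxPropagator (t - s) (F s) x y‖) volume 0 t :=
    (h.duhamelWellDefined hν0.le h1 h2 hC y ht.le hx).2.norm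
  have hn : ‖duhamel F t x y‖ ≤ ∫ s in (0 : ℝ)..t, ‖dxPropagator (t - s) (F s) x y‖ :=
    intervalIntegral.norm_integral_le_integral_norm ht.le
  set g : ℝ → ℝ := fun s => ‖dxPropagator (t - s) (F s) x y‖ with hg
  have hAC : 0 ≤ A * C₂ := by positivity
  -- The cut at b: b ≤ 1 gives the early decay on (0, b), 2b ≤ t keeps that interval away from s =
  -- t, and Y is the decay factor available on (b, t).
  have part : ∀ b, 0 < b → 2 * b ≤ t → b ≤ 1 → ∀ Y, 0 < Y →
      (∀ᵐ s : ℝ, s ∈ Ioo b t → g s ≤ A * C₂ * (Y * (t - s) ^ (-(13 / 12) : ℝ))) →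
      ‖duhamel F t x y‖ ≤ A * C₂ * (κ * (b ^ e * X₁ ^ (1 / ν)) + 15 * Y ^ (4 / 5 : ℝ)) := by
    intro b hb0 hbt hb1 Y hY hgY
    have i1 : IntervalIntegrable g volume 0 b := hi.mono_set (by
      rw [uIcc_of_le hb0.le, uIcc_of_le ht.le]; exact Icc_subset_Icc_right (by linarith))
    have i2 : IntervalIntegrable g volume b t := hi.mono_set (by
      rw [uIcc_of_le (by linarith), uIcc_of_le ht.le]; exact Icc_subset_Icc_left hb0.le)
    have k1 := integral_initial_le hν hAC hX₁0 hb0 hbt i1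
      (by filter_upwards [ba] with s hs hs'; exact hs ⟨hs'.1, by linarith [hs'.2]⟩)
      (by filter_upwards [bE] with s hs hs'
          exact hs ⟨hs'.1, by linarith [hs'.2]⟩ (by linarith [hs'.2]))
    have k2 := integral_le_of_dispersive_bounds hY hAC (by linarith : b ≤ t) i2
      (by filter_upwards [ba] with s hs hs'; exact hs ⟨by linarith [hs'.1], hs'.2⟩) hgY
    rw [← intervalIntegral.integral_add_adjacent_intervals i1 i2] at hn
    calc _ ≤ _ := hn.trans (add_le_add k1 k2)
      _ = _ := by ring
  refine ⟨?_, fun ht1 => ?_, fun ht1 => ?_⟩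
  · have : ∫ s in (0 : ℝ)..t, g s ≤ ∫ s in (0 : ℝ)..t, A * C₂ * (t - s) ^ (-(2 / 3) : ℝ) := by
      refine intervalIntegral.integral_mono_ae_restrict ht.le hi
        ((intervalIntegrable_sub_rpow t).const_mul _) ?_
      rw [Filter.EventuallyLE, ← restrict_Ioo_eq_restrict_Icc, ae_restrict_iff' measurableSet_Ioo]
      exact ba
    rw [intervalIntegral.integral_const_mul, integral_sub_rpow] at this
    calc _ ≤ A * C₂ * (3 * t ^ (1 / 3 : ℝ)) := hn.trans this
      _ = A * 3 * C₂ * t ^ (1 / 3 : ℝ) := by ring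
      _ ≤ _ := by
        gcongr
        have : 0 < κ * c := by positivity
        linarith
  · have hb0 : 0 < t / 2 := by linarith
    have := part (t / 2) hb0 (by linarith) (by linarith) ((t / 2) ^ (-ν) * X₁) (by positivity) (by
      filter_upwards [bE] with s hs hs'
      have hs0 : 0 < s := hb0.trans hs'.1
      have hts : 0 < t - s := by linarith [hs'.2]
      refine (hs ⟨hs0, hs'.2⟩ (by linarith [hs'.2])).trans ?_
      have : s ^ (-ν) ≤ (t / 2) ^ (-ν) :=
        Real.rpow_le_rpow_of_nonpos hb0 hs'.1.le (by linarith)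
      gcongr)
    have e1 : (t / 2) ^ e = c * t ^ e := by
      rw [hc, ← Real.mul_rpow (by norm_num) ht.le]; congr 1; ring
    have e2 : ((t / 2) ^ (-ν) * X₁) ^ (4 / 5 : ℝ) = d * (t ^ (-ν) * X₁) ^ (4 / 5 : ℝ) := by
      rw [hd, ← Real.mul_rpow (by positivity) (by positivity), ← mul_assoc,
        ← Real.mul_rpow (by norm_num) ht.le]
      congr 3; ring
    rw [e1, e2] at this
    set U := t ^ e * X₁ ^ (1 / ν) with hU
    set V := (t ^ (-ν) * X₁) ^ (4 / 5 : ℝ) with hV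
    have hU0 : 0 < U := by positivity
    have hV0 : 0 < V := by positivity
    calc _ ≤ A * C₂ * (κ * c * U + 15 * d * V) := this.trans_eq (by rw [hU]; ring)
      _ ≤ A * C₂ * ((3 + κ * c + 15 * d) * U + (3 + κ * c + 15 * d) * V) := by
        have : 0 < κ * c := by positivity
        gcongr <;> linarith
      _ = _ := by ring
  -- On (1/2, 1) the early decay is used with s^(−ν) ≤ 2^ν and X₁ ≤ X₂, so late decay is needed only
  -- for s > 1.
  · have := part (1 / 2) (by norm_num) (by linarith) (by norm_num) ((1 / 2) ^ (-ν) * X₂)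
      (by positivity) (by
      have hne : ∀ᵐ s : ℝ, s ≠ 1 := by simp [ae_iff]
      filter_upwards [bE, bL, hne] with s hs hs2 hs1 hs'
      have hs0 : 0 < s := by linarith [hs'.1]
      have hts : 0 < t - s := by linarith [hs'.2]
      rcases lt_or_gt_of_ne hs1 with hs1 | hs1
      · refine (hs ⟨hs0, hs'.2⟩ hs1).trans ?_
        have : s ^ (-ν) ≤ (1 / 2) ^ (-ν) :=
          Real.rpow_le_rpow_of_nonpos (by norm_num) hs'.1.le (by linarith)
        gcongr
      · refine (hs2 ⟨hs0, hs'.2⟩ hs1).trans ?_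
        have : (1 : ℝ) ≤ (1 / 2) ^ (-ν) :=
          Real.one_le_rpow_of_pos_of_le_one_of_nonpos (by norm_num) (by norm_num) (by linarith)
        gcongr
        exact le_mul_of_one_le_left hX₂0.le this)
    rw [Real.mul_rpow (by positivity) hX₂0.le] at this
    set U := X₁ ^ (1 / ν) with hU
    set V := X₂ ^ (4 / 5 : ℝ) with hV
    have hU0 : 0 < U := by positivity
    have hV0 : 0 < V := by positivity
    calc _ ≤ A * C₂ * (κ * c * U + 15 * d * V) := this.trans_eq (by rw [hc, hd]; ring)
      _ ≤ A * C₂ * ((3 + κ * c + 15 * d) * U + (3 + κ * c + 15 * d) * V) := by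
        have : 0 < κ * c := by positivity
        gcongr <;> linarith
      _ = _ := by ring

/-! ### Comparison of the rates -/

/-- The ratio of the two rates is exactly (X / t^(ν + 5/12))^(1/ν − 4/5), with a nonnegative
exponent for ν ≤ 5/4. The companion lemma is the case of the opposite sign. -/
lemma initial_rate_le_final_rate {t X K : ℝ} (hν0 : 0 < ν) (hν : ν ≤ 5 / 4) (ht : 0 < t)
    (hX : 0 < X) (hK : 0 < K) (h : X ≤ K * t ^ (ν + 5 / 12)) :
    t ^ (-(2 / 3) - 5 / (12 * ν)) * X ^ (1 / ν) ≤
      K ^ (1 / ν - 4 / 5) * (t ^ (-ν) * X) ^ (4 / 5 : ℝ) := by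
  have he : 0 ≤ 1 / ν - 4 / 5 := by
    rw [sub_nonneg, le_div_iff₀ hν0]; linarith
  have h1 : X ^ (1 / ν - 4 / 5) ≤ K ^ (1 / ν - 4 / 5) * t ^ ((ν + 5 / 12) * (1 / ν - 4 / 5)) := by
    rw [Real.rpow_mul ht.le, ← Real.mul_rpow hK.le (by positivity)]
    gcongr
  calc t ^ (-(2 / 3) - 5 / (12 * ν)) * X ^ (1 / ν)
      = t ^ (-(2 / 3) - 5 / (12 * ν)) * (X ^ (4 / 5 : ℝ) * X ^ (1 / ν - 4 / 5)) := by
        rw [← Real.rpow_add hX]; congr 2; ring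
    _ ≤ t ^ (-(2 / 3) - 5 / (12 * ν)) * (X ^ (4 / 5 : ℝ) *
        (K ^ (1 / ν - 4 / 5) * t ^ ((ν + 5 / 12) * (1 / ν - 4 / 5)))) := by gcongr
    _ = K ^ (1 / ν - 4 / 5) * (t ^ (-(2 / 3) - 5 / (12 * ν) + (ν + 5 / 12) * (1 / ν - 4 / 5)) *
        X ^ (4 / 5 : ℝ)) := by rw [Real.rpow_add ht]; ring
    _ = _ := by
        rw [Real.mul_rpow (by positivity) hX.le, ← Real.rpow_mul ht.le]
        congr 3
        field_simp
        ring

lemma final_rate_le_initial_rate {t X K : ℝ} (hν : 5 / 4 ≤ ν) (ht : 0 < t)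
    (hX : 0 < X) (hK : 0 < K) (h : X ≤ K * t ^ (ν + 5 / 12)) :
    (t ^ (-ν) * X) ^ (4 / 5 : ℝ) ≤
      K ^ (4 / 5 - 1 / ν) * (t ^ (-(2 / 3) - 5 / (12 * ν)) * X ^ (1 / ν)) := by
  have hν0 : 0 < ν := by linarith
  have he : 0 ≤ 4 / 5 - 1 / ν := by
    rw [sub_nonneg, div_le_iff₀ hν0]; linarith
  have h1 : X ^ (4 / 5 - 1 / ν) ≤ K ^ (4 / 5 - 1 / ν) * t ^ ((ν + 5 / 12) * (4 / 5 - 1 / ν)) := by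
    rw [Real.rpow_mul ht.le, ← Real.mul_rpow hK.le (by positivity)]
    gcongr
  calc (t ^ (-ν) * X) ^ (4 / 5 : ℝ)
      = t ^ (-ν * (4 / 5)) * (X ^ (1 / ν) * X ^ (4 / 5 - 1 / ν)) := by
        rw [← Real.rpow_add hX, Real.mul_rpow (by positivity) hX.le, ← Real.rpow_mul ht.le]
        congr 2; ring
    _ ≤ t ^ (-ν * (4 / 5)) * (X ^ (1 / ν) *
        (K ^ (4 / 5 - 1 / ν) * t ^ ((ν + 5 / 12) * (4 / 5 - 1 / ν)))) := by gcongr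
    _ = K ^ (4 / 5 - 1 / ν) * (t ^ (-ν * (4 / 5) + (ν + 5 / 12) * (4 / 5 - 1 / ν)) *
        X ^ (1 / ν)) := by rw [Real.rpow_add ht]; ring
    _ = _ := by
        congr 3
        field_simp
        ring

/-! ### Comparison of exponents for the corollary. -/

lemma duhamel_zero (F : ℝ → ℝ × ℝ → ℂ) (x y : ℝ) : duhamel F 0 x y = 0 := by
  simp [duhamel]

/-- The target bound at the crossing point t^(ν + 5/12) = B^(−(σ − 9/4)), after dividing out. The
requirement (1 + ν)(σ − 9/4) ≥ σ(ν + 5/12) is precisely σ ≥ (27/7)(ν + 1). -/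
lemma rpow_mul_rpow_le_one {B σ : ℝ} (hB : 1 ≤ B) (hν : 0 < ν) (hσ : 27 / 7 * (ν + 1) ≤ σ) :
    (B ^ (-(σ - 9 / 4))) ^ ((1 + ν) / 3 / (ν + 5 / 12)) * B ^ (σ / 3) ≤ 1 := by
  have hB0 : 0 < B := by linarith
  rw [← Real.rpow_mul hB0.le, ← Real.rpow_add hB0]
  apply Real.rpow_le_one_of_one_le_of_nonpos hB
  have : -(σ - 9 / 4) * ((1 + ν) / 3 / (ν + 5 / 12)) + σ / 3 =
      (27 / 7 * (ν + 1) - σ) * (7 / 36) / (ν + 5 / 12) := by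
    field_simp
    ring
  rw [this]
  exact div_nonpos_of_nonpos_of_nonneg (by linarith) (by linarith)

lemma rpow_third_le_rate {t B σ : ℝ} (hB : 1 ≤ B) (hν : 0 < ν) (ht : 0 < t)
    (hσ : 27 / 7 * (ν + 1) ≤ σ) (h : t ^ (ν + 5 / 12) ≤ B ^ (-(σ - 9 / 4))) :
    t ^ (1 / 3 : ℝ) ≤ t ^ (-(ν / 3)) * B ^ (-(σ / 3)) := by
  have hB0 : 0 < B := by linarith
  have hc : 0 < ν + 5 / 12 := by linarith
  have h1 : t ^ ((1 + ν) / 3) ≤ (B ^ (-(σ - 9 / 4))) ^ ((1 + ν) / 3 / (ν + 5 / 12)) := by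
    calc t ^ ((1 + ν) / 3) = (t ^ (ν + 5 / 12)) ^ ((1 + ν) / 3 / (ν + 5 / 12)) := by
          rw [← Real.rpow_mul ht.le]; congr 1; field_simp
      _ ≤ _ := by gcongr
  calc t ^ (1 / 3 : ℝ) = t ^ (-(ν / 3)) * B ^ (-(σ / 3)) * (t ^ ((1 + ν) / 3) * B ^ (σ / 3)) := by
        have e1 : t ^ (1 / 3 : ℝ) = t ^ (-(ν / 3)) * t ^ ((1 + ν) / 3) := by
          rw [← Real.rpow_add ht]; congr 1; ring
        have e2 : B ^ (-(σ / 3)) * B ^ (σ / 3) = 1 := by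
          rw [← Real.rpow_add hB0, neg_add_cancel, Real.rpow_zero]
        rw [e1]
        linear_combination (-(t ^ (-(ν / 3)) * t ^ ((1 + ν) / 3))) * e2
    _ ≤ t ^ (-(ν / 3)) * B ^ (-(σ / 3)) * 1 := by
        gcongr
        exact (mul_le_mul_of_nonneg_right h1 (by positivity)).trans
          (rpow_mul_rpow_le_one hB hν hσ)
    _ = _ := mul_one _

/-- The quotient of the two sides is a power t^p times a quantity free of t, so it is largest at an
endpoint. At t = 1 the condition `hc` decides, at the crossing point `hσ`. -/
lemma initial_rate_le_rate {t B σ : ℝ} (hB : 1 ≤ B) (hν : 0 < ν) (ht : 0 < t) (ht1 : t ≤ 1)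
    (hσ : 27 / 7 * (ν + 1) ≤ σ) (hc : 0 < (1 - ν / 3) * σ - 9 / 4)
    (h : B ^ (-(σ - 9 / 4)) ≤ t ^ (ν + 5 / 12)) :
    t ^ (-(2 / 3) - 5 / (12 * ν)) * (B ^ (-(σ - 9 / 4))) ^ (1 / ν) ≤
      t ^ (-(ν / 3)) * B ^ (-(σ / 3)) := by
  have hB0 : 0 < B := by linarith
  have hc' : 0 < ν + 5 / 12 := by linarith
  set X := B ^ (-(σ - 9 / 4)) with hX
  have hX0 : 0 < X := by positivity
  set p : ℝ := ν / 3 - 2 / 3 - 5 / (12 * ν) with hp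
  have key : t ^ p * X ^ (1 / ν) * B ^ (σ / 3) ≤ 1 := by
    rcases le_total 0 p with hp0 | hp0
    · have h1 : t ^ p ≤ 1 := Real.rpow_le_one ht.le ht1 hp0
      have h2 : X ^ (1 / ν) * B ^ (σ / 3) ≤ 1 := by
        rw [hX, ← Real.rpow_mul hB0.le, ← Real.rpow_add hB0]
        apply Real.rpow_le_one_of_one_le_of_nonpos hB
        have : -(σ - 9 / 4) * (1 / ν) + σ / 3 = -((1 - ν / 3) * σ - 9 / 4) / ν := by
          field_simp
          ring
        rw [this]
        exact div_nonpos_of_nonpos_of_nonneg (by linarith) hν.le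
      rw [mul_assoc]
      exact mul_le_one₀ h1 (by positivity) h2
    · have h1 : t ^ p ≤ X ^ (p / (ν + 5 / 12)) := by
        calc t ^ p = (t ^ (ν + 5 / 12)) ^ (p / (ν + 5 / 12)) := by
              rw [← Real.rpow_mul ht.le]; congr 1; field_simp
          _ ≤ _ := Real.rpow_le_rpow_of_nonpos hX0 h
              (div_nonpos_of_nonpos_of_nonneg hp0 hc'.le)
      calc t ^ p * X ^ (1 / ν) * B ^ (σ / 3)
          ≤ X ^ (p / (ν + 5 / 12)) * X ^ (1 / ν) * B ^ (σ / 3) := by gcongr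
        _ = X ^ ((1 + ν) / 3 / (ν + 5 / 12)) * B ^ (σ / 3) := by
            rw [← Real.rpow_add hX0]
            congr 2
            rw [hp]
            field_simp
            ring
        _ ≤ 1 := rpow_mul_rpow_le_one hB hν hσ
  calc t ^ (-(2 / 3) - 5 / (12 * ν)) * X ^ (1 / ν)
      = t ^ (-(ν / 3)) * B ^ (-(σ / 3)) * (t ^ p * X ^ (1 / ν) * B ^ (σ / 3)) := by
        have e1 : t ^ (-(2 / 3) - 5 / (12 * ν)) = t ^ (-(ν / 3)) * t ^ p := by
          rw [← Real.rpow_add ht]; congr 1; rw [hp]; ring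
        have e2 : B ^ (-(σ / 3)) * B ^ (σ / 3) = 1 := by
          rw [← Real.rpow_add hB0, neg_add_cancel, Real.rpow_zero]
        rw [e1]
        linear_combination (-(t ^ (-(ν / 3)) * t ^ p * X ^ (1 / ν))) * e2
    _ ≤ t ^ (-(ν / 3)) * B ^ (-(σ / 3)) * 1 := by gcongr
    _ = _ := mul_one _

/-! ### Assembly of the estimate and its corollary. -/

lemma duhamel_estimate (hν : 1 < ν) (h2 : 9 / 4 < σ₂) (h12 : σ₂ ≤ σ₁) {K : ℝ} (hK : 0 < K) :
    ∃ C : ℝ, 0 < C ∧ ∀ (C₂ : ℝ) (F : ℝ → ℝ × ℝ → ℂ), 0 ≤ C₂ →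
        ForcingBounds (1 / 2) ν σ₁ σ₂ C₂ F →
        ∀ t x y : ℝ, 0 < t → 0 < x →
          DuhamelWellDefined F t x y ∧
          (t ^ (ν + 5 / 12) ≤ K * bracket x ^ (-(σ₁ - 9 / 4)) →
            ‖duhamel F t x y‖ ≤ C * C₂ * t ^ (1 / 3 : ℝ)) ∧
          (bracket x ^ (-(σ₁ - 9 / 4)) ≤ K * t ^ (ν + 5 / 12) → t ^ (ν + 5 / 12) < 1 →
            ν < 5 / 4 →
            ‖duhamel F t x y‖ ≤
              C * C₂ * (t ^ (-(4 / 5 * ν)) * bracket x ^ (-(4 / 5 * (σ₁ - 9 / 4))))) ∧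
          (bracket x ^ (-(σ₁ - 9 / 4)) ≤ K * t ^ (ν + 5 / 12) → t ^ (ν + 5 / 12) < 1 →
            5 / 4 < ν →
            ‖duhamel F t x y‖ ≤
              C * C₂ * (t ^ (-(2 / 3) - 5 / (12 * ν)) *
                bracket x ^ (-(1 / ν * (σ₁ - 9 / 4))))) ∧
          (1 < t →
            ‖duhamel F t x y‖ ≤
              C * C₂ * bracket x ^
                (-(min (sigmaTilde σ₁ / ν)
                  (min (sigmaTilde σ₂) (4 / 5 * (σ₂ - 9 / 4)))))) := by
  obtain ⟨C, hC, hb⟩ := exists_norm_duhamel_le hν h2 h12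
  have hν0 : 0 < ν := by linarith
  have k1 : 0 < K ^ (1 / ν - 4 / 5) := by positivity
  have k2 : 0 < K ^ (4 / 5 - 1 / ν) := by positivity
  refine ⟨C * (2 + K ^ (1 / ν - 4 / 5) + K ^ (4 / 5 - 1 / ν)), by positivity,
    fun C₂ F hC₂ h t x y ht hx => ?_⟩
  obtain ⟨b1, b2, b3⟩ := hb C₂ F hC₂ h.of_half t x y ht hx
  have hB := bracket_pos x
  have hB1 := one_le_bracket x
  set M := 2 + K ^ (1 / ν - 4 / 5) + K ^ (4 / 5 - 1 / ν) with hM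
  have hM0 : 0 < M := by positivity
  have lt_one : t ^ (ν + 5 / 12) < 1 → t ≤ 1 := by
    intro h
    by_contra hcon
    exact absurd h (not_lt.2 (Real.one_le_rpow (not_le.1 hcon).le (by linarith)))
  set X := bracket x ^ (-(σ₁ - 9 / 4)) with hX
  have hX0 : 0 < X := by positivity
  refine ⟨h.of_half.duhamelWellDefined hν0.le (by linarith) h2 hC₂ y ht.le hx, fun _ => ?_,
    fun hcase ht1 hν' => ?_, fun hcase ht1 hν' => ?_, fun ht1 => ?_⟩
  · refine b1.trans ?_
    gcongr
    exact le_mul_of_one_le_right hC.le (by linarith)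
  · have r := initial_rate_le_final_rate hν0 hν'.le ht hX0 hK hcase
    have e : t ^ (-(4 / 5 * ν)) * bracket x ^ (-(4 / 5 * (σ₁ - 9 / 4))) =
        (t ^ (-ν) * X) ^ (4 / 5 : ℝ) := by
      rw [hX, Real.mul_rpow (by positivity) (by positivity), ← Real.rpow_mul ht.le,
        ← Real.rpow_mul hB.le]
      congr 2 <;> ring
    rw [e]
    set V := (t ^ (-ν) * X) ^ (4 / 5 : ℝ)
    have hV : 0 < V := by positivity
    calc _ ≤ C * C₂ * (K ^ (1 / ν - 4 / 5) * V + V) := (b2 (lt_one ht1)).trans (by gcongr)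
      _ = C * C₂ * ((K ^ (1 / ν - 4 / 5) + 1) * V) := by ring
      _ ≤ C * C₂ * (M * V) := by gcongr; linarith
      _ = _ := by ring
  · have r := final_rate_le_initial_rate hν'.le ht hX0 hK hcase
    have e : bracket x ^ (-(1 / ν * (σ₁ - 9 / 4))) = X ^ (1 / ν) := by
      rw [hX, ← Real.rpow_mul hB.le]; congr 1; ring
    rw [e]
    set U := t ^ (-(2 / 3) - 5 / (12 * ν)) * X ^ (1 / ν)
    have hU : 0 < U := by positivity
    calc _ ≤ C * C₂ * (U + K ^ (4 / 5 - 1 / ν) * U) := (b2 (lt_one ht1)).trans (by gcongr)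
      _ = C * C₂ * ((1 + K ^ (4 / 5 - 1 / ν)) * U) := by ring
      _ ≤ C * C₂ * (M * U) := by gcongr; linarith
      _ = _ := by ring
  · set m := min (sigmaTilde σ₁ / ν) (min (sigmaTilde σ₂) (4 / 5 * (σ₂ - 9 / 4))) with hm
    have r1 : X ^ (1 / ν) ≤ bracket x ^ (-m) := by
      rw [hX, ← Real.rpow_mul hB.le]
      apply Real.rpow_le_rpow_of_exponent_le hB1
      have : m ≤ (σ₁ - 9 / 4) / ν := (min_le_left _ _).trans (by
        gcongr; exact min_le_left _ _)
      rw [mul_one_div, neg_div]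
      linarith
    have r2 : (bracket x ^ (-(σ₂ - 9 / 4))) ^ (4 / 5 : ℝ) ≤ bracket x ^ (-m) := by
      rw [← Real.rpow_mul hB.le]
      apply Real.rpow_le_rpow_of_exponent_le hB1
      have : m ≤ 4 / 5 * (σ₂ - 9 / 4) := (min_le_right _ _).trans (min_le_right _ _)
      linarith
    calc _ ≤ C * C₂ * (bracket x ^ (-m) + bracket x ^ (-m)) := (b3 ht1).trans (by gcongr)
      _ = C * C₂ * (2 * bracket x ^ (-m)) := by ring
      _ ≤ C * C₂ * (M * bracket x ^ (-m)) := by gcongr; linarith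
      _ = _ := by ring

lemma duhamel_corollary {r : ℝ} (hν : 5 / 4 < ν) (h12 : σ₂ ≤ σ₁)
    (h2 : 11 / 2 ≤ σ₂) (hmax : 27 / 7 + 15 / 7 * r ≤ σ₂) (h3 : 27 / 7 * (ν + 1) ≤ σ₁)
    (h4 : ν / 2 * σ₂ + 5 / 8 + 3 / 2 * ν * r ≤ σ₁) :
    ∃ C : ℝ, 0 < C ∧ ∀ (C₂ : ℝ) (F : ℝ → ℝ × ℝ → ℂ), 0 ≤ C₂ →
        ForcingBounds 1 ν σ₁ σ₂ C₂ F →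
        ∀ t x y : ℝ, 0 ≤ t → 0 < x →
          DuhamelWellDefined F t x y ∧
          (0 < (1 - ν / 3) * σ₁ - 9 / 4 → t ≤ 1 →
            ‖duhamel F t x y‖ ≤
              C * C₂ * (t ^ (-(ν / 3)) * bracket x ^ (-(σ₁ / 3)))) ∧
          (1 / 2 < t →
            ‖duhamel F t x y‖ ≤ C * C₂ * bracket x ^ (-(1 / 3 * σ₂) - r)) := by
  have h2' : 9 / 4 < σ₂ := by linarith
  obtain ⟨C, hC, hb⟩ := exists_norm_duhamel_le (by linarith : 1 < ν) h2' h12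
  have hν0 : 0 < ν := by linarith
  set c : ℝ := (1 / 2 : ℝ) ^ (-(2 / 3) - 5 / (12 * ν)) with hc
  have hc0 : 0 < c := by positivity
  set d : ℝ := ((1 / 2 : ℝ) ^ (-ν)) ^ (4 / 5 : ℝ) with hd
  have hd0 : 0 < d := by positivity
  refine ⟨C * (2 + c + d), by positivity, fun C₂ F hC₂ h t x y ht hx =>
    ⟨h.duhamelWellDefined hν0.le (by linarith) h2' hC₂ y ht hx, fun hcond ht1 => ?_,
      fun ht1 => ?_⟩⟩
  · have hB := bracket_pos x
    have hB1 := one_le_bracket x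
    rcases ht.eq_or_lt with rfl | ht
    -- At t = 0 the Duhamel term vanishes, so the default value of `0 ^ (-(ν / 3))` is harmless.
    · rw [duhamel_zero, norm_zero]; positivity
    obtain ⟨b1, b2, -⟩ := hb C₂ F hC₂ h t x y ht hx
    set T := t ^ (-(ν / 3)) * bracket x ^ (-(σ₁ / 3)) with hT
    have hT0 : 0 < T := by positivity
    rcases le_total (t ^ (ν + 5 / 12)) (bracket x ^ (-(σ₁ - 9 / 4))) with hcase | hcase
    · have r1 := rpow_third_le_rate hB1 hν0 ht h3 hcase
      calc _ ≤ C * C₂ * (1 * T) := b1.trans (by rw [one_mul]; gcongr)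
        _ ≤ C * C₂ * ((2 + c + d) * T) := by gcongr; linarith
        _ = _ := by ring
    · have r1 := initial_rate_le_rate hB1 hν0 ht ht1 h3 hcond hcase
      have r2 := final_rate_le_initial_rate hν.le ht (by positivity) one_pos
        (hcase.trans_eq (one_mul _).symm)
      rw [Real.one_rpow, one_mul] at r2
      calc _ ≤ C * C₂ * (T + T) := (b2 ht1).trans (by gcongr; exact r2.trans r1)
        _ = C * C₂ * (2 * T) := by ring
        _ ≤ C * C₂ * ((2 + c + d) * T) := by gcongr; linarith
        _ = _ := by ring
  · have hB := bracket_pos x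
    have hB1 := one_le_bracket x
    have ht0 : 0 < t := by linarith
    obtain ⟨-, b2, b3⟩ := hb C₂ F hC₂ h t x y ht0 hx
    set T := bracket x ^ (-(1 / 3 * σ₂) - r) with hT
    have hT0 : 0 < T := by positivity
    set X₁ := bracket x ^ (-(σ₁ - 9 / 4)) with hX₁
    have hX₁0 : 0 < X₁ := by positivity
    -- Two thirds of `h4` read ν(σ₂/3 + r) ≤ (2/3)σ₁ − 5/12, and this is at most σ₁ − 9/4 once σ₁ ≥
    -- 11/2.
    have r1 : X₁ ^ (1 / ν) ≤ T := by
      rw [hX₁, ← Real.rpow_mul hB.le]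
      apply Real.rpow_le_rpow_of_exponent_le hB1
      rw [mul_one_div, div_le_iff₀ hν0]
      nlinarith
    -- The inequality (4/5)(σ₂ − 9/4) ≥ σ₂/3 + r is equivalent to `hmax`.
    have r2 : (bracket x ^ (-(σ₂ - 9 / 4))) ^ (4 / 5 : ℝ) ≤ T := by
      rw [← Real.rpow_mul hB.le]
      apply Real.rpow_le_rpow_of_exponent_le hB1
      linarith
    rcases le_or_gt t 1 with ht2 | ht2
    · have r3 : X₁ ^ (4 / 5 : ℝ) ≤ T := by
        refine le_trans ?_ r2
        gcongr
        exact Real.rpow_le_rpow_of_exponent_le hB1 (by linarith)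
      have r4 : t ^ (-(2 / 3) - 5 / (12 * ν)) ≤ c := by
        refine Real.rpow_le_rpow_of_nonpos (by norm_num) ht1.le ?_
        have : 0 < 5 / (12 * ν) := by positivity
        linarith
      have r5 : (t ^ (-ν) * X₁) ^ (4 / 5 : ℝ) ≤ d * T := by
        rw [Real.mul_rpow (by positivity) hX₁0.le]
        have : t ^ (-ν) ≤ (1 / 2) ^ (-ν) :=
          Real.rpow_le_rpow_of_nonpos (by norm_num) ht1.le (by linarith)
        rw [hd]
        gcongr
      calc _ ≤ C * C₂ * (c * T + d * T) := (b2 ht2).trans (by gcongr)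
        _ = C * C₂ * ((c + d) * T) := by ring
        _ ≤ C * C₂ * ((2 + c + d) * T) := by gcongr; linarith
        _ = _ := by ring
    · calc _ ≤ C * C₂ * (T + T) := (b3 ht2).trans (by gcongr)
        _ = C * C₂ * (2 * T) := by ring
        _ ≤ C * C₂ * ((2 + c + d) * T) := by gcongr; linarith
        _ = _ := by ring

end

end ZK

theorem proposition11p2 :
    -- the Duhamel estimate
    (∀ ν σ₁ σ₂ : ℝ, 1 < ν → 9 / 4 < σ₂ → σ₂ ≤ σ₁ → ∀ K : ℝ, 0 < K →
      ∃ C : ℝ, 0 < C ∧ ∀ (C₂ : ℝ) (F : ℝ → ℝ × ℝ → ℂ), 0 ≤ C₂ →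
        ZK.ForcingBounds (1 / 2) ν σ₁ σ₂ C₂ F →
        ∀ t x y : ℝ, 0 < t → 0 < x →
          ZK.DuhamelWellDefined F t x y ∧
          (t ^ (ν + 5 / 12) ≤ K * ZK.bracket x ^ (-(σ₁ - 9 / 4)) →
            ‖ZK.duhamel F t x y‖ ≤ C * C₂ * t ^ (1 / 3 : ℝ)) ∧
          (ZK.bracket x ^ (-(σ₁ - 9 / 4)) ≤ K * t ^ (ν + 5 / 12) → t ^ (ν + 5 / 12) < 1 →
            ν < 5 / 4 →
            ‖ZK.duhamel F t x y‖ ≤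
              C * C₂ * (t ^ (-(4 / 5 * ν)) * ZK.bracket x ^ (-(4 / 5 * (σ₁ - 9 / 4))))) ∧
          (ZK.bracket x ^ (-(σ₁ - 9 / 4)) ≤ K * t ^ (ν + 5 / 12) → t ^ (ν + 5 / 12) < 1 →
            5 / 4 < ν →
            ‖ZK.duhamel F t x y‖ ≤
              C * C₂ * (t ^ (-(2 / 3) - 5 / (12 * ν)) *
                ZK.bracket x ^ (-(1 / ν * (σ₁ - 9 / 4))))) ∧
          (1 < t →
            ‖ZK.duhamel F t x y‖ ≤
              C * C₂ * ZK.bracket x ^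
                (-(min (ZK.sigmaTilde σ₁ / ν)
                  (min (ZK.sigmaTilde σ₂) (4 / 5 * (σ₂ - 9 / 4))))))) ∧
    -- its corollary
    (∀ ν σ₁ σ₂ r : ℝ, 5 / 4 < ν → 0 ≤ r → σ₂ ≤ σ₁ → 11 / 2 ≤ σ₁ → 11 / 2 ≤ σ₂ →
      max (27 / 7 + 15 / 7 * r) (5 / 4 + 3 * r) ≤ σ₂ →
      27 / 7 * (ν + 1) ≤ σ₁ →
      ν / 2 * σ₂ + 5 / 8 + 3 / 2 * ν * r ≤ σ₁ →
      ∃ C : ℝ, 0 < C ∧ ∀ (C₂ : ℝ) (F : ℝ → ℝ × ℝ → ℂ), 0 ≤ C₂ →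
        ZK.ForcingBounds 1 ν σ₁ σ₂ C₂ F →
        ∀ t x y : ℝ, 0 ≤ t → 0 < x →
          ZK.DuhamelWellDefined F t x y ∧
          (0 < (1 - ν / 3) * σ₁ - 9 / 4 → t ≤ 1 →
            ‖ZK.duhamel F t x y‖ ≤
              C * C₂ * (t ^ (-(ν / 3)) * ZK.bracket x ^ (-(σ₁ / 3)))) ∧
          (1 / 2 < t →
            ‖ZK.duhamel F t x y‖ ≤ C * C₂ * ZK.bracket x ^ (-(1 / 3 * σ₂) - r))) := by
  refine ⟨fun ν σ₁ σ₂ hν h2 h12 K hK => ZK.duhamel_estimate hν h2 h12 hK,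
    fun ν σ₁ σ₂ r hν _ h12 _ h2 hmax h3 h4 =>
      ZK.duhamel_corollary hν h12 h2 ((le_max_left _ _).trans hmax) h3 h4⟩
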